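/- **Setting.** Let $n=\ell+r$ with $\ell,r\ge 0$, and $m\ge 0$. Let $\Lambda_0=\mathrm{diag}(\lambda_1,\dots,\lambda_n)\in C^1([0,1];\mathbb R^{n\times n})$ with $\lambda_i>0$ on $[0,1]$ for $i\le \ell$ and $\lambda_i<0$ on $[0,1]$ for $i>\ell$, let $\Lambda_1\in C^1([0,1];\mathbb R^{n\times n})$, $K\in\mathbb R^{n\times n}$, $B\in\mathbb R^{n\times m}$, $L_1,L_2\in\mathbb R^{m\times n}$, $k_i>0$, and let $K_i\in\mathbb R^{m\times m}$ have full rank. Write $\phi=(\phi_+,\phi_-)\in\mathbb R^\ell\times\mathbb R^{r}$. For constant $w_b\in\mathbb R^n$, $w_y,y_{ref}\in\mathbb R^m$ consider the closed loop $$\phi_t+\Lambda_0(s)\phi_s+\Lambda_1(s)\phi=0,\quad s\in(0,1),\ t\ge0,$$ $$\begin{bmatrix}\phi_+(t,0)\\ \phi_-(t,1)\end{bmatrix}=K\begin{bmatrix}\phi_+(t,1)\\ \phi_-(t,0)\end{bmatrix}+k_iBK_iz(t)+w_b,$$ $$z_t=y-y_{ref},\qquad y=L_1\begin{bmatrix}\phi_+(t,0)\\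 \phi_-(t,1)\end{bmatrix}+L_2\begin{bmatrix}\phi_+(t,1)\\ \phi_-(t,0)\end{bmatrix}+w_y,$$ with state $(\phi,z)$ in $\mathcal X_e=L^2((0,1);\mathbb R^n)\times\mathbb R^m$; put $\mathcal X_{e1}=H^1((0,1);\mathbb R^n)\times\mathbb R^m$. An equilibrium is a $(\phi_\infty,z_\infty)\in\mathcal X_{e1}$ that satisfies these equations with $\phi_t=0$, $z_t=0$. Let $\Phi:[0,1]\to\mathbb R^{n\times n}$ be the unique solution of $\Phi_s=-\Lambda_0^{-1}\Lambda_1\Phi$, $\Phi(0)=\mathrm{Id}_n$, with blocks $\Phi_{jk}$ according to $n=\ell+r$, and $$\Phi_+(1)=\begin{bmatrix}\Phi_{11}(1)&\Phi_{12}(1)\\0&\mathrm{Id}_{r}\end{bmatrix},\quad \Phi_-(1)=\begin{bmatrix}\mathrm{Id}_\ell&0\\ \Phi_{21}(1)&\Phi_{22}(1)\end{bmatrix},\quad N=\Phi_-(1)-K\Phi_+(1),\quad G=L_1\Phi_-(1)+L_2\Phi_+(1).$$ *Rank condition:* $N$ has full rank, and so has $T_1=GN^{-1}B\in\mathbb R^{m\times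 m}$. *ISS condition:* there are a $C^1$ function $P:[0,1]\to\mathbb R^{n\times n}$ with diagonal values, numbers $\mu,\underline P,\overline P>0$ and a positive definite $S\in\mathbb R^{n\times n}$ with $(P\Lambda_0)_s-P\Lambda_1-\Lambda_1^\top P\le-\mu P$ and $\underline P\,\mathrm{Id}_n\le P\le\overline P\,\mathrm{Id}_n$ on $[0,1]$, and $-K_+^\top P(1)\Lambda_0(1)K_++K_-^\top P(0)\Lambda_0(0)K_-\le -S$, where $K_+=\begin{bmatrix}\mathrm{Id}_\ell&0\\K_{21}&K_{22}\end{bmatrix}$ and $K_-=\begin{bmatrix}K_{11}&K_{12}\\0&\mathrm{Id}_{r}\end{bmatrix}$. **Proposition.** 1. If the rank condition holds, then for all $w_b,w_y,y_{ref}$ the closed loop has exactly one equilibrium $(\phi_\infty,z_\infty)$, and it is given by $$z_\infty=\tfrac1{k_i}K_i^{-1}T_1^{-1}\left(y_{ref}-w_y-GN^{-1}w_b\right),\qquad \phi_\infty(s)=\Phi(s)N^{-1}\left(k_iBK_iz_\infty+w_b\right).$$ 2. Assume the ISS condition, or only that $N$ has full rank. Then the rank condition is necessary and sufficient for the closed loop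 to have an equilibrium for all $w_b,w_y,y_{ref}$. 3. If the rank condition holds, then for all $w_b,w_y,y_{ref}$ the closed loop is well-posed: every initial state in $\mathcal X_e$ has a unique weak solution in $C^0([0,\infty);\mathcal X_e)$; and for every initial state in $\mathcal X_{e1}$ that satisfies the boundary condition there is a unique strong solution in $C^0([0,\infty);\mathcal X_{e1})\cap C^1([0,\infty);\mathcal X_e)$, which is also the weak solution. Here $v=(\phi,z)\in C^0([0,\infty);\mathcal X_e)$ is a weak solution with initial state $(\phi_0,z_0)$ if $v(0)=(\phi_0,z_0)$ and, for all $T>0$ and all $C^1$ functions $\psi:[0,T]\times[0,1]\to\mathbb R^n$, $\eta:[0,T]\to\mathbb R^m$ with $p=K^\top(q+L_1^\top\eta)+L_2^\top\eta$ on $[0,T]$, where $p=\begin{bmatrix}(|\Lambda_0|\psi)_+(t,1)\\(|\Lambda_0|\psi)_-(t,0)\end{bmatrix}$ and $q=\begin{bmatrix}(|\Lambda_0|\psi)_+(t,0)\\(|\Lambda_0|\psi)_-(t,1)\end{bmatrix}$, $$\Big[\int_0^1\psi\cdot\phi\,ds+\eta\cdot z\Big]_{t=0}^{t=T}=\int_0^T\Big(\int_0^1\big(\psi_t+(\Lambda_0\psi)_s-\Lambda_1^\top\psi\big)\cdot\phi\,ds+\eta_t\cdot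 z+(q+L_1^\top\eta)\cdot(k_iBK_iz+w_b)+\eta\cdot(w_y-y_{ref})\Big)dt.$$ -/

import Mathlib

open MeasureTheory Set

noncomputable section

namespace HypReg

/-- Index set of `ℝⁿ`, `n = ℓ + r`, split into the `ℓ` components with positive speed
and the `r = n - ℓ` components with negative speed. -/
abbrev Idx (ℓ r : ℕ) : Type := Fin ℓ ⊕ Fin r

/-- The Hilbert space `L²((0,1), ℝⁿ)`. -/
abbrev L2 (ℓ r : ℕ) : Type :=
  Lp (EuclideanSpace ℝ (Idx ℓ r)) 2 (volume.restrict (Ioo (0 : ℝ) 1))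

/-- The extended state space `L²((0,1), ℝⁿ) × ℝᵐ`. -/
abbrev State (ℓ r m : ℕ) : Type := L2 ℓ r × EuclideanSpace ℝ (Fin m)

/-- The plant: `φ_t + Λ₀ φ_s + Λ₁ φ = 0` on `(0,1)`, `Λ₀ = diag (lam)`, with the boundary condition
`(φ₊(t,0), φ₋(t,1)) = K (φ₊(t,1), φ₋(t,0)) + B u(t) + w_b` and the output
`y(t) = L₁ (φ₊(t,0), φ₋(t,1)) + L₂ (φ₊(t,1), φ₋(t,0)) + w_y`. -/
structure Plant (ℓ r m : ℕ) where
  lam : Idx ℓ r → ℝ → ℝ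
  Lam1 : ℝ → Matrix (Idx ℓ r) (Idx ℓ r) ℝ
  K : Matrix (Idx ℓ r) (Idx ℓ r) ℝ
  B : Matrix (Idx ℓ r) (Fin m) ℝ
  L₁ : Matrix (Fin m) (Idx ℓ r) ℝ
  L₂ : Matrix (Fin m) (Idx ℓ r) ℝ
  lam_C1 : ∀ i, ContDiffOn ℝ 1 (lam i) (Icc 0 1)
  Lam1_C1 : ∀ i j, ContDiffOn ℝ 1 (fun s => Lam1 s i j) (Icc 0 1)
  lam_pos : ∀ i : Fin ℓ, ∀ s ∈ Icc (0 : ℝ) 1, 0 < lam (Sum.inl i) s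
  lam_neg : ∀ j : Fin r, ∀ s ∈ Icc (0 : ℝ) 1, lam (Sum.inr j) s < 0

/-- The constant disturbances `w_b`, `w_y` and the constant reference `y_ref`. -/
structure Exo (ℓ r m : ℕ) where
  wb : Idx ℓ r → ℝ
  wy : Fin m → ℝ
  yref : Fin m → ℝ

/-- `(c₊(0), c₋(1))`. -/
def incoming {ℓ r : ℕ} (c : ℝ → Idx ℓ r → ℝ) : Idx ℓ r → ℝ :=
  Sum.elim (fun i => c 0 (Sum.inl i)) (fun j => c 1 (Sum.inr j))

/-- `(c₊(1), c₋(0))`. -/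
def outgoing {ℓ r : ℕ} (c : ℝ → Idx ℓ r → ℝ) : Idx ℓ r → ℝ :=
  Sum.elim (fun i => c 1 (Sum.inl i)) (fun j => c 0 (Sum.inr j))

/-- `f` belongs to `H¹((0,1), ℝⁿ)`, with weak derivative `df` and with the
(absolutely) continuous representative `c` on `[0,1]`. -/
def IsH1 {ℓ r : ℕ} (f df : L2 ℓ r) (c : ℝ → Idx ℓ r → ℝ) : Prop :=
  (∀ s ∈ Icc (0 : ℝ) 1, ∀ i, c s i = c 0 i + ∫ x in (0 : ℝ)..s, df x i) ∧
  ∀ᵐ s ∂(volume.restrict (Ioo (0 : ℝ) 1)), ∀ i, f s i = c s i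

namespace Plant

variable {ℓ r m : ℕ} (P : Plant ℓ r m)

/-- `Λ₀(s) = diag (lam₁(s), …, lamₙ(s))`. -/
def Lam0 (s : ℝ) : Matrix (Idx ℓ r) (Idx ℓ r) ℝ := Matrix.diagonal (fun i => P.lam i s)

/-! ### Fundamental matrix and rank condition -/

/-- `Φ` solves `Φ_s = -Λ₀⁻¹ Λ₁ Φ` on `[0,1]`, `Φ(0) = Id`. -/
def IsFundamental (Φ : ℝ → Matrix (Idx ℓ r) (Idx ℓ r) ℝ) : Prop :=
  Φ 0 = 1 ∧
  ∀ s ∈ Icc (0 : ℝ) 1, ∀ i j,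
    HasDerivWithinAt (fun x => Φ x i j) ((-((P.Lam0 s)⁻¹ * P.Lam1 s * Φ s)) i j) (Icc 0 1) s

end Plant

/-- `Φ₊(1) = [Φ₁₁(1), Φ₁₂(1); 0, Id]`. -/
def phiPlus {ℓ r : ℕ} (Φ : ℝ → Matrix (Idx ℓ r) (Idx ℓ r) ℝ) : Matrix (Idx ℓ r) (Idx ℓ r) ℝ :=
  Matrix.fromBlocks (Φ 1).toBlocks₁₁ (Φ 1).toBlocks₁₂ 0 1

/-- `Φ₋(1) = [Id, 0; Φ₂₁(1), Φ₂₂(1)]`. -/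
def phiMinus {ℓ r : ℕ} (Φ : ℝ → Matrix (Idx ℓ r) (Idx ℓ r) ℝ) : Matrix (Idx ℓ r) (Idx ℓ r) ℝ :=
  Matrix.fromBlocks 1 0 (Φ 1).toBlocks₂₁ (Φ 1).toBlocks₂₂

namespace Plant

variable {ℓ r m : ℕ} (P : Plant ℓ r m)

/-- `Φ₋(1) - K Φ₊(1)`. -/
def matN (Φ : ℝ → Matrix (Idx ℓ r) (Idx ℓ r) ℝ) : Matrix (Idx ℓ r) (Idx ℓ r) ℝ :=
  phiMinus Φ - P.K * phiPlus Φ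

/-- `L₁ Φ₋(1) + L₂ Φ₊(1)`. -/
def matG (Φ : ℝ → Matrix (Idx ℓ r) (Idx ℓ r) ℝ) : Matrix (Fin m) (Idx ℓ r) ℝ :=
  P.L₁ * phiMinus Φ + P.L₂ * phiPlus Φ

/-- `T₁ = (L₁ Φ₋(1) + L₂ Φ₊(1)) (Φ₋(1) - K Φ₊(1))⁻¹ B`. -/
def matT1 (Φ : ℝ → Matrix (Idx ℓ r) (Idx ℓ r) ℝ) : Matrix (Fin m) (Fin m) ℝ :=
  P.matG Φ * (P.matN Φ)⁻¹ * P.B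

/-- The rank condition: `Φ₋(1) - K Φ₊(1)` and `T₁` have full rank. -/
def RankCondition (Φ : ℝ → Matrix (Idx ℓ r) (Idx ℓ r) ℝ) : Prop :=
  (P.matN Φ).rank = ℓ + r ∧ (P.matT1 Φ).rank = m

/-! ### Input-to-state exponential stability of the open loop -/

/-- `K₊ = [Id, 0; K₂₁, K₂₂]`. -/
def Kplus : Matrix (Idx ℓ r) (Idx ℓ r) ℝ :=
  Matrix.fromBlocks 1 0 P.K.toBlocks₂₁ P.K.toBlocks₂₂

/-- `K₋ = [K₁₁, K₁₂; 0, Id]`. -/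
def Kminus : Matrix (Idx ℓ r) (Idx ℓ r) ℝ :=
  Matrix.fromBlocks P.K.toBlocks₁₁ P.K.toBlocks₁₂ 0 1

/-- The Lyapunov condition for input-to-state exponential stability of the open loop, with a
diagonal `C¹` weight `Q(s) = diag (q₁(s), …, qₙ(s))`; `X ≤ Y` means that `Y - X` is
positive semidefinite. -/
def ISSCondition : Prop :=
  ∃ (q : Idx ℓ r → ℝ → ℝ) (μ qlow qup : ℝ) (S : Matrix (Idx ℓ r) (Idx ℓ r) ℝ),
    (∀ i, ContDiffOn ℝ 1 (q i) (Icc 0 1)) ∧ 0 < μ ∧ 0 < qlow ∧ 0 < qup ∧ S.PosDef ∧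
    (∀ s ∈ Icc (0 : ℝ) 1,
      (-(μ • Matrix.diagonal (fun i => q i s))
        - (Matrix.diagonal (fun i => derivWithin (fun x => q i x * P.lam i x) (Icc 0 1) s)
            - Matrix.diagonal (fun i => q i s) * P.Lam1 s
            - (P.Lam1 s).transpose * Matrix.diagonal (fun i => q i s))).PosSemidef) ∧
    (∀ s ∈ Icc (0 : ℝ) 1, ∀ i, qlow ≤ q i s ∧ q i s ≤ qup) ∧
    (-S - (-(P.Kplus.transpose * Matrix.diagonal (fun i => q i 1) * P.Lam0 1 * P.Kplus)
        + P.Kminus.transpose * Matrix.diagonal (fun i => q i 0) * P.Lam0 0 * P.Kminus)).PosSemidef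

/-! ### The closed loop `u = kᵢ Kᵢ z`, `z_t = y - y_ref` -/

/-- The boundary condition, in closed loop, for a profile with continuous representative `c` and a
controller state `z`. -/
def BoundaryCondition (ki : ℝ) (Ki : Matrix (Fin m) (Fin m) ℝ) (d : Exo ℓ r m)
    (c : ℝ → Idx ℓ r → ℝ) (z : Fin m → ℝ) : Prop :=
  incoming c = P.K.mulVec (outgoing c) + P.B.mulVec (ki • Ki.mulVec z) + d.wb

/-- The output `y` for a profile with continuous representative `c`. -/
def output (d : Exo ℓ r m) (c : ℝ → Idx ℓ r → ℝ) : Fin m → ℝ :=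
  P.L₁.mulVec (incoming c) + P.L₂.mulVec (outgoing c) + d.wy

/-- The closed-loop equations at one instant: the state `v = (φ, z)` is in `H¹ × ℝᵐ`, `φ` has weak
derivative `dφ`, the boundary condition holds, and the time derivative `v' = (φ_t, z_t)` satisfies
`φ_t + Λ₀ φ_s + Λ₁ φ = 0` and `z_t = y - y_ref`. -/
def ClosedLoopAt (ki : ℝ) (Ki : Matrix (Fin m) (Fin m) ℝ) (d : Exo ℓ r m)
    (v : State ℓ r m) (dφ : L2 ℓ r) (v' : State ℓ r m) : Prop :=
  ∃ c : ℝ → Idx ℓ r → ℝ,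
    IsH1 v.1 dφ c ∧
    P.BoundaryCondition ki Ki d c v.2.ofLp ∧
    (∀ᵐ s ∂(volume.restrict (Ioo (0 : ℝ) 1)),
      (v'.1 s).ofLp + (P.Lam0 s).mulVec (dφ s).ofLp + (P.Lam1 s).mulVec (v.1 s).ofLp = 0) ∧
    v'.2.ofLp = P.output d c - d.yref

/-- An equilibrium: a state at which the closed-loop equations hold with zero time derivative. -/
def IsEquilibrium (ki : ℝ) (Ki : Matrix (Fin m) (Fin m) ℝ) (d : Exo ℓ r m)
    (v : State ℓ r m) : Prop :=
  ∃ dφ : L2 ℓ r, P.ClosedLoopAt ki Ki d v dφ 0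

/-- Strong solution with initial state `v₀`, in `C⁰([0,∞); H¹ × ℝᵐ) ∩ C¹([0,∞); L² × ℝᵐ)`. -/
def IsStrongSolution (ki : ℝ) (Ki : Matrix (Fin m) (Fin m) ℝ) (d : Exo ℓ r m)
    (v₀ : State ℓ r m) (v : ℝ → State ℓ r m) : Prop :=
  ∃ (dφ : ℝ → L2 ℓ r) (v' : ℝ → State ℓ r m),
    v 0 = v₀ ∧
    ContinuousOn v (Ici 0) ∧ ContinuousOn dφ (Ici 0) ∧ ContinuousOn v' (Ici 0) ∧
    (∀ t ∈ Ici (0 : ℝ), HasDerivWithinAt v (v' t) (Ici 0) t) ∧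
    ∀ t ∈ Ici (0 : ℝ), P.ClosedLoopAt ki Ki d (v t) (dφ t) (v' t)

/-- `C¹` test functions `(ψ, η)` on `[0,T] × [0,1]` and `[0,T]` satisfying the adjoint boundary
condition, in which the unknown outgoing traces drop out after integration by parts. Here
`|Λ₀| ψ` is the flux of `ψ`. -/
def IsTest (T : ℝ) (ψ : ℝ → ℝ → Idx ℓ r → ℝ) (η : ℝ → Fin m → ℝ) : Prop :=
  ContDiff ℝ 1 (fun p : ℝ × ℝ => ψ p.1 p.2) ∧ ContDiff ℝ 1 η ∧
  ∀ t ∈ Icc (0 : ℝ) T,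
    outgoing (fun s i => |P.lam i s| * ψ t s i) =
      P.K.transpose.mulVec
        (incoming (fun s i => |P.lam i s| * ψ t s i) + P.L₁.transpose.mulVec (η t))
      + P.L₂.transpose.mulVec (η t)

/-- The formal adjoint `ψ_t + (Λ₀ ψ)_s - Λ₁ᵀ ψ`. -/
def adjointExpr (ψ : ℝ → ℝ → Idx ℓ r → ℝ) (t s : ℝ) : Idx ℓ r → ℝ := fun i =>
  deriv (fun τ => ψ τ s i) t + derivWithin (fun x => P.lam i x * ψ t x i) (Icc 0 1) s
    - (P.Lam1 s).transpose.mulVec (ψ t s) i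

/-- Weak solution in `C⁰([0,∞); L² × ℝᵐ)` with initial state `v₀`. -/
def IsWeakSolution (ki : ℝ) (Ki : Matrix (Fin m) (Fin m) ℝ) (d : Exo ℓ r m)
    (v₀ : State ℓ r m) (v : ℝ → State ℓ r m) : Prop :=
  v 0 = v₀ ∧ ContinuousOn v (Ici 0) ∧
  ∀ (T : ℝ), 0 < T → ∀ (ψ : ℝ → ℝ → Idx ℓ r → ℝ) (η : ℝ → Fin m → ℝ), P.IsTest T ψ η →
    ((∫ s in Ioo (0 : ℝ) 1, ψ T s ⬝ᵥ ((v T).1 s).ofLp) + η T ⬝ᵥ (v T).2.ofLp)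
      - ((∫ s in Ioo (0 : ℝ) 1, ψ 0 s ⬝ᵥ (v₀.1 s).ofLp) + η 0 ⬝ᵥ v₀.2.ofLp)
    = ∫ t in (0 : ℝ)..T,
        ((∫ s in Ioo (0 : ℝ) 1, P.adjointExpr ψ t s ⬝ᵥ ((v t).1 s).ofLp)
          + deriv η t ⬝ᵥ (v t).2.ofLp
          + (incoming (fun s i => |P.lam i s| * ψ t s i) + P.L₁.transpose.mulVec (η t))
              ⬝ᵥ (P.B.mulVec (ki • Ki.mulVec (v t).2.ofLp) + d.wb)
          + η t ⬝ᵥ (d.wy - d.yref))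

/-- The initial state is in `H¹ × ℝᵐ` and satisfies the boundary condition. -/
def IsCompatible (ki : ℝ) (Ki : Matrix (Fin m) (Fin m) ℝ) (d : Exo ℓ r m)
    (v₀ : State ℓ r m) : Prop :=
  ∃ (dφ : L2 ℓ r) (c : ℝ → Idx ℓ r → ℝ),
    IsH1 v₀.1 dφ c ∧ P.BoundaryCondition ki Ki d c v₀.2.ofLp

/-- Well-posedness: a unique weak solution for every initial state in `L² × ℝᵐ`, and, for
compatible initial states in `H¹ × ℝᵐ`, a unique strong solution, which is the weak one. -/
def WellPosed (ki : ℝ) (Ki : Matrix (Fin m) (Fin m) ℝ) (d : Exo ℓ r m) : Prop :=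
  (∀ v₀ : State ℓ r m, ∃ v : ℝ → State ℓ r m, P.IsWeakSolution ki Ki d v₀ v ∧
      ∀ v₁, P.IsWeakSolution ki Ki d v₀ v₁ → EqOn v₁ v (Ici 0)) ∧
  (∀ v₀ : State ℓ r m, P.IsCompatible ki Ki d v₀ → ∃ v : ℝ → State ℓ r m,
      P.IsStrongSolution ki Ki d v₀ v ∧ P.IsWeakSolution ki Ki d v₀ v ∧
      ∀ v₁, P.IsStrongSolution ki Ki d v₀ v₁ → EqOn v₁ v (Ici 0))

/-- `z_∞ = kᵢ⁻¹ Kᵢ⁻¹ T₁⁻¹ (y_ref - w_y - (L₁Φ₋(1) + L₂Φ₊(1)) (Φ₋(1) - KΦ₊(1))⁻¹ w_b)`. -/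
def zInf (Φ : ℝ → Matrix (Idx ℓ r) (Idx ℓ r) ℝ) (ki : ℝ) (Ki : Matrix (Fin m) (Fin m) ℝ)
    (d : Exo ℓ r m) : Fin m → ℝ :=
  ki⁻¹ • (Ki⁻¹ * (P.matT1 Φ)⁻¹).mulVec
    (d.yref - d.wy - (P.matG Φ * (P.matN Φ)⁻¹).mulVec d.wb)

/-- `φ_∞(0) = (Φ₋(1) - KΦ₊(1))⁻¹ (kᵢ B Kᵢ z_∞ + w_b)`. -/
def phiInf0 (Φ : ℝ → Matrix (Idx ℓ r) (Idx ℓ r) ℝ) (ki : ℝ) (Ki : Matrix (Fin m) (Fin m) ℝ)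
    (d : Exo ℓ r m) : Idx ℓ r → ℝ :=
  (P.matN Φ)⁻¹.mulVec (ki • (P.B * Ki).mulVec (P.zInf Φ ki Ki d) + d.wb)

end Plant

end HypReg

end

/-! Equilibria are a matter of linear algebra. A stationary profile solves a linear ODE, so it is
`Φ(s) a` with `a` its value at `0`, and its incoming and outgoing traces are `Φ₋(1) a` and `Φ₊(1)
a`. With the input `u = kᵢ Kᵢ z`, the boundary condition reads `N a = B u + w_b` and the output
condition reads `G a = y_ref - w_y` (`isEquilibrium_iff`). If `N` is invertible, eliminating `a`
leaves `T₁ u = y_ref - w_y - G N⁻¹ w_b`. This is solvable for all data exactly when `T₁` is onto,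
and then `u`, `z` and `a` are determined.

The ISS condition makes `N` injective (`isUnit_matN_of_ISSCondition`). A kernel vector gives a
profile `c` with homogeneous boundary condition. Along it `W = c · P Λ₀ c` is nonincreasing, while
the boundary inequality gives `x · S x ≤ W(1) - W(0)` for the outgoing trace `x`. So `x = 0`, and
then `c(0) = K₋ x = 0`.

For well-posedness an equilibrium is subtracted, which leaves a homogeneous problem with generator
`A` on `L² × ℝᵐ`. No stability is needed. In a weighted energy with a small weight at the incoming
ends, the outgoing boundary terms absorb both the reflected traces and the output, so `A - ω` is
dissipative for some `ω` (`exists_isEnergy`). The resolvent equation reduces by variation of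
constants to a square linear system, injective by dissipativity (`exists_resolvent_solution`). The
domain is dense (`dense_domain`), and the Hille–Yosida theorem gives a semigroup. Orbits that start
in the domain are strong solutions, and weak solutions are their limits.

Uniqueness holds already for weak solutions. The time integral `V` of the difference of two of them
satisfies `A V = V'` in the weak sense. A weak solution of `A x = y` lies in the domain: du
Bois-Reymond's lemma gives the regularity, and test functions with free end values give the boundary
and output equations (`mem_genGraph_of_weakGen`). The energy estimate then gives `V = 0`. -/

noncomputable section

namespace HypReg

open Filter Topology
open scoped RealInnerProductSpace

/-! ## The Hille–Yosida theorem -/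

section HilleYosida

variable {X : Type*} [NormedAddCommGroup X] [NormedSpace ℝ X]

/-- `G` is the graph of an operator whose resolvent at `n + 1` is `R n`, with powers of
`(n + 1) R n` bounded by `M`. -/
structure IsHilleYosida (G : Submodule ℝ (X × X)) (R : ℕ → X →L[ℝ] X) (M : ℝ) : Prop where
  mem : ∀ n y, (R n y, ((n : ℝ) + 1) • R n y - y) ∈ G
  left_inv : ∀ n, ∀ p ∈ G, R n (((n : ℝ) + 1) • p.1 - p.2) = p.1
  -- One `M`, possibly larger than 1, bounds all powers: in the application each factor contracts
  -- only an energy that is equivalent to the norm, not equal to it.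
  bound : ∀ n k : ℕ, ‖(((n : ℝ) + 1) • R n) ^ k‖ ≤ M
  dense : Dense {x | ∃ y, (x, y) ∈ G}

/-- The Yosida approximation `λ (λ R - 1)`. -/
def yosida (R : ℕ → X →L[ℝ] X) (n : ℕ) : X →L[ℝ] X :=
  ((n : ℝ) + 1) • (((n : ℝ) + 1) • R n - 1)

/-- The semigroup generated by the Yosida approximation. -/
def yosidaExp (R : ℕ → X →L[ℝ] X) (n : ℕ) (t : ℝ) : X →L[ℝ] X :=
  NormedSpace.exp (t • yosida R n)

/-- The exponential series is bounded term by term by `aᵏ M / k!`. The factor `exp a` is cancelled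
in `norm_yosidaExp_le`. -/
theorem norm_exp_smul_le_of_norm_pow_le [CompleteSpace X] (J : X →L[ℝ] X) {M : ℝ}
    (hJ : ∀ k, ‖J ^ k‖ ≤ M) {a : ℝ} (ha : 0 ≤ a) :
    ‖NormedSpace.exp (a • J)‖ ≤ Real.exp a * M := by
  have hs : HasSum (fun k : ℕ => ((k.factorial : ℝ)⁻¹ * a ^ k) * M) (Real.exp a * M) := by
    refine HasSum.mul_right _ ?_
    have := NormedSpace.exp_series_hasSum_exp' (𝕂 := ℝ) a
    simpa [Real.exp_eq_exp_ℝ, smul_eq_mul] using this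
  rw [NormedSpace.exp_eq_tsum ℝ]
  refine tsum_of_norm_bounded hs fun k => ?_
  rw [smul_pow, norm_smul, norm_smul, ← mul_assoc]
  have h1 : ‖((k.factorial : ℝ))⁻¹‖ = ((k.factorial : ℝ))⁻¹ := by
    rw [Real.norm_of_nonneg]; positivity
  have h2 : ‖a ^ k‖ = a ^ k := by rw [Real.norm_of_nonneg]; positivity
  rw [h1, h2]
  exact mul_le_mul_of_nonneg_left (hJ k) (by positivity)

namespace IsHilleYosida

variable {G : Submodule ℝ (X × X)} {R : ℕ → X →L[ℝ] X} {M : ℝ}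

/-- The resolvent identity `R n = R m + (m - n) R m R n` follows from `left_inv` at the graph point
over `R n y`. Comparing it with the identity for `n` and `m` exchanged, and dividing by `m - n ≠ 0`,
gives commutation. -/
theorem commute (h : IsHilleYosida G R M) (n m : ℕ) : Commute (R n) (R m) := by
  have key : ∀ n m : ℕ, ∀ y, R n y = R m y + ((m : ℝ) - n) • R m (R n y) := by
    intro n m y
    have := h.left_inv m _ (h.mem n y)
    have e : ((m : ℝ) + 1) • R n y - (((n : ℝ) + 1) • R n y - y)
        = y + ((m : ℝ) - n) • R n y := by module
    simp only [e, map_add, map_smul] at this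
    exact this.symm
  by_cases hnm : n = m
  · subst hnm; exact Commute.refl _
  ext y
  have h1 := key n m y
  have h2 := key m n y
  have h3 : ((m : ℝ) - n) • (R n (R m y) - R m (R n y)) = 0 := by
    have : ((m : ℝ) - n) • R m (R n y) = ((m : ℝ) - n) • R n (R m y) := by
      have e1 : ((m : ℝ) - n) • R m (R n y) = R n y - R m y := by
        rw [eq_sub_iff_add_eq, add_comm]; exact h1.symm
      have e2 : ((n : ℝ) - m) • R n (R m y) = R m y - R n y := by
        rw [eq_sub_iff_add_eq, add_comm]; exact h2.symm
      rw [e1, ← neg_sub (n : ℝ) m, neg_smul, e2, neg_sub]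
    rw [smul_sub, this, sub_self]
  have h4 : (m : ℝ) - n ≠ 0 := by
    rw [sub_ne_zero]; exact fun hh => hnm (Nat.cast_injective hh).symm
  have := (smul_eq_zero.mp h3).resolve_left h4
  simpa using sub_eq_zero.mp this

theorem commute_yosida (h : IsHilleYosida G R M) (n m : ℕ) : Commute (R n) (yosida R m) :=
  ((((h.commute n m).smul_right _).sub_right (Commute.one_right _))).smul_right _

theorem yosida_commute (h : IsHilleYosida G R M) (n m : ℕ) :
    Commute (yosida R n) (yosida R m) :=
  ((((h.commute_yosida n m).smul_left _).sub_left (Commute.one_left _))).smul_left _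

theorem commute_yosidaExp [CompleteSpace X] (h : IsHilleYosida G R M) (n m : ℕ) (t : ℝ) :
    Commute (R n) (yosidaExp R m t) :=
  ((h.commute_yosida n m).smul_right t).exp_right

theorem norm_yosidaExp_le [CompleteSpace X] (h : IsHilleYosida G R M) (n : ℕ) {t : ℝ}
    (ht : 0 ≤ t) : ‖yosidaExp R n t‖ ≤ M := by
  set a : ℝ := t * ((n : ℝ) + 1)
  have ha : 0 ≤ a := by positivity
  -- The exponent splits into `a J - a` with `J = (n + 1) R n`. The scalar part contributes `exp
  -- (-a)`, which compensates the growth `exp a` of the other factor.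
  have e : t • yosida R n = a • (((n : ℝ) + 1) • R n) + (-a) • (1 : X →L[ℝ] X) := by
    simp only [yosida, a]; module
  have hc : Commute (a • (((n : ℝ) + 1) • R n)) ((-a) • (1 : X →L[ℝ] X)) :=
    (Commute.one_right _).smul_right _
  let _ : NormedAlgebra ℚ (X →L[ℝ] X) := NormedAlgebra.restrictScalars ℚ ℝ _
  have e2 : NormedSpace.exp ((-a) • (1 : X →L[ℝ] X)) = Real.exp (-a) • 1 := by
    have := NormedSpace.algebraMap_exp_comm (𝕂 := ℝ) (𝔸 := X →L[ℝ] X) (-a)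
    rw [Algebra.algebraMap_eq_smul_one, Algebra.algebraMap_eq_smul_one] at this
    rw [← this, Real.exp_eq_exp_ℝ]
  rw [yosidaExp, e, NormedSpace.exp_add_of_commute hc, e2, mul_smul_comm, mul_one, norm_smul,
    Real.norm_of_nonneg (Real.exp_pos _).le]
  calc Real.exp (-a) * ‖NormedSpace.exp (a • (((n : ℝ) + 1) • R n))‖
      ≤ Real.exp (-a) * (Real.exp a * M) :=
        mul_le_mul_of_nonneg_left (norm_exp_smul_le_of_norm_pow_le _ (h.bound n) ha)
          (Real.exp_pos _).le
    _ = M := by rw [← mul_assoc, ← Real.exp_add]; simp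

theorem M_nonneg (h : IsHilleYosida G R M) : 0 ≤ M := (norm_nonneg _).trans (h.bound 0 0)

theorem hasDerivAt_yosidaExp [CompleteSpace X] (n : ℕ) (t : ℝ) :
    HasDerivAt (yosidaExp R n) (yosidaExp R n t * yosida R n) t :=
  hasDerivAt_exp_smul_const (yosida R n) t

theorem hasDerivAt_yosidaExp_apply [CompleteSpace X] (n : ℕ) (t : ℝ) (x : X) :
    HasDerivAt (fun s => yosidaExp R n s x) (yosidaExp R n t (yosida R n x)) t := by
  have := (hasDerivAt_yosidaExp (R := R) n t).clm_apply (hasDerivAt_const t x)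
  rw [map_zero, add_zero] at this
  exact this

theorem yosidaExp_zero [CompleteSpace X] (n : ℕ) : yosidaExp R n 0 = 1 := by
  let _ : NormedAlgebra ℚ (X →L[ℝ] X) := NormedAlgebra.restrictScalars ℚ ℝ _
  simp [yosidaExp, NormedSpace.exp_zero]

/-- On the domain the Yosida approximation is `(n + 1) R n` applied to `A x`, so its convergence to
`A x` reduces to strong convergence of `(n + 1) R n` to the identity. -/
theorem yosida_apply (h : IsHilleYosida G R M) (n : ℕ) {x y : X} (hxy : (x, y) ∈ G) :
    yosida R n x = (((n : ℝ) + 1) • R n) y := by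
  have := h.left_inv n _ hxy
  simp only [map_sub, map_smul] at this
  have e : ((n : ℝ) + 1) • R n x - x = R n y := by
    rw [sub_eq_iff_eq_add]; nth_rewrite 2 [← this]; abel
  simp [yosida, e]

theorem norm_smul_resolvent_le (h : IsHilleYosida G R M) (n : ℕ) :
    ‖((n : ℝ) + 1) • R n‖ ≤ M := by simpa using h.bound n 1

theorem norm_resolvent_le (h : IsHilleYosida G R M) (n : ℕ) : ‖R n‖ ≤ M / ((n : ℝ) + 1) := by
  have := h.norm_smul_resolvent_le n
  have hp : (0 : ℝ) < (n : ℝ) + 1 := by positivity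
  rw [norm_smul, Real.norm_of_nonneg hp.le] at this
  rw [le_div_iff₀ hp]; linarith

/-- For `x` in the domain the error is `R n (A x)`, of order `1 / (n + 1)`. Uniform boundedness and
density extend the limit to the whole space. -/
theorem tendsto_smul_resolvent (h : IsHilleYosida G R M) (y : X) :
    Tendsto (fun n : ℕ => (((n : ℝ) + 1) • R n) y) atTop (𝓝 y) := by
  have hM := h.M_nonneg
  have hdom : ∀ x ∈ {x | ∃ y, (x, y) ∈ G},
      Tendsto (fun n : ℕ => (((n : ℝ) + 1) • R n) x) atTop (𝓝 x) := by
    rintro x ⟨y, hxy⟩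
    rw [tendsto_iff_norm_sub_tendsto_zero]
    have hb : ∀ n : ℕ, ‖(((n : ℝ) + 1) • R n) x - x‖ ≤ M * ‖y‖ * (1 / ((n : ℝ) + 1)) := by
      intro n
      have := h.left_inv n _ hxy
      simp only [map_sub, map_smul] at this
      have e : ((n : ℝ) + 1) • R n x - x = R n y := by
        rw [sub_eq_iff_eq_add]; nth_rewrite 2 [← this]; abel
      rw [smul_apply, e]
      calc ‖R n y‖ ≤ ‖R n‖ * ‖y‖ := (R n).le_opNorm y
        _ ≤ M / ((n : ℝ) + 1) * ‖y‖ := by gcongr; exact h.norm_resolvent_le n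
        _ = _ := by ring
    refine squeeze_zero (fun _ => norm_nonneg _) hb ?_
    simpa using (tendsto_one_div_add_atTop_nhds_zero_nat (𝕜 := ℝ)).const_mul (M * ‖y‖)
  rw [Metric.tendsto_atTop]
  intro ε hε
  obtain ⟨x, hx, hxy⟩ := h.dense.exists_dist_lt y (show 0 < ε / (2 * (M + 1)) by positivity)
  obtain ⟨N, hN⟩ := Metric.tendsto_atTop.mp (hdom x hx) (ε / 2) (by positivity)
  refine ⟨N, fun n hn => ?_⟩
  have h1 := hN n hn
  rw [dist_eq_norm] at h1 hxy ⊢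
  have e : (((n : ℝ) + 1) • R n) y - y
      = (((n : ℝ) + 1) • R n) (y - x) + ((((n : ℝ) + 1) • R n) x - x) + (x - y) := by
    rw [map_sub]; abel
  have h2 : ‖(((n : ℝ) + 1) • R n) (y - x)‖ ≤ M * ‖y - x‖ :=
    (ContinuousLinearMap.le_opNorm _ _).trans
      (mul_le_mul_of_nonneg_right (h.norm_smul_resolvent_le n) (norm_nonneg _))
  have h3 : (M + 1) * ‖y - x‖ < ε / 2 := by
    rw [lt_div_iff₀ (by positivity)] at hxy
    nlinarith
  rw [e]
  have h4 := norm_add₃_le (a := (((n : ℝ) + 1) • R n) (y - x))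
    (b := (((n : ℝ) + 1) • R n) x - x) (c := x - y)
  rw [norm_sub_rev x y] at h4
  linarith

/-- The path `s ↦ exp((t - s) A_m) exp(s A_n) x` joins the two exponentials. Because everything
commutes, its derivative is the same product applied to `(A_n - A_m) x`, and the mean value
inequality applies. -/
theorem norm_yosidaExp_sub_le [CompleteSpace X] (h : IsHilleYosida G R M) (n m : ℕ) (x : X)
    {t : ℝ} (ht : 0 ≤ t) :
    ‖yosidaExp R n t x - yosidaExp R m t x‖ ≤ M * M * ‖yosida R n x - yosida R m x‖ * t := by
  have hM := h.M_nonneg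
  have hd : ∀ s ∈ Icc (0 : ℝ) t, HasDerivWithinAt
      (fun s => yosidaExp R m (t - s) (yosidaExp R n s x))
      ((yosidaExp R m (t - s)) (yosidaExp R n s (yosida R n x - yosida R m x)))
      (Icc 0 t) s := by
    intro s _
    have h1 : HasDerivAt (fun s => yosidaExp R m (t - s))
        (-(yosidaExp R m (t - s) * yosida R m)) s := by
      have := (hasDerivAt_yosidaExp (R := R) m (t - s)).scomp s ((hasDerivAt_id s).const_sub t)
      simpa [Function.comp_def] using this
    have h2 : HasDerivAt (fun s => yosidaExp R n s x) (yosidaExp R n s (yosida R n x)) s :=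
      hasDerivAt_yosidaExp_apply n s x
    have h3 := h1.clm_apply h2
    refine HasDerivAt.hasDerivWithinAt ?_
    convert h3 using 1
    have hc : yosida R m (yosidaExp R n s x) = yosidaExp R n s (yosida R m x) :=
      DFunLike.congr_fun (((h.yosida_commute m n).smul_right s).exp_right).eq x
    have e : (-(yosidaExp R m (t - s) * yosida R m)) (yosidaExp R n s x)
        = -(yosidaExp R m (t - s) (yosida R m (yosidaExp R n s x))) := rfl
    rw [e, hc, map_sub, map_sub]
    abel
  have := norm_image_sub_le_of_norm_deriv_le_segment' hd
    (C := M * M * ‖yosida R n x - yosida R m x‖) (fun s hs => ?_) t ⟨ht, le_rfl⟩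
  · simpa [yosidaExp_zero] using this
  · refine (ContinuousLinearMap.le_opNorm _ _).trans ?_
    rw [mul_assoc]
    refine mul_le_mul (h.norm_yosidaExp_le m (by linarith [hs.2])) ?_ (norm_nonneg _) hM
    refine (ContinuousLinearMap.le_opNorm _ _).trans ?_
    exact mul_le_mul_of_nonneg_right (h.norm_yosidaExp_le n hs.1) (norm_nonneg _)

/-- For `u` in the domain, `A_n u` converges, so the preceding estimate is uniform on bounded times.
A general `x` is replaced by a nearby `u`, at a cost of `M ‖x - u‖` in each of the two exponentials.
-/
theorem uniformCauchySeqOn_yosidaExp [CompleteSpace X] (h : IsHilleYosida G R M) (x : X) (τ : ℝ) :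
    UniformCauchySeqOn (fun n t => yosidaExp R n t x) atTop (Icc 0 τ) := by
  have hM := h.M_nonneg
  rw [Metric.uniformCauchySeqOn_iff]
  intro ε hε
  obtain ⟨u, ⟨y, huy⟩, hxu⟩ :=
    h.dense.exists_dist_lt x (show 0 < ε / (4 * (M + 1)) by positivity)
  have hcs : CauchySeq (fun n => yosida R n u) := by
    have : Tendsto (fun n => yosida R n u) atTop (𝓝 y) := by
      simpa only [h.yosida_apply _ huy] using h.tendsto_smul_resolvent y
    exact this.cauchySeq
  obtain ⟨N, hN⟩ := Metric.cauchySeq_iff.mp hcs (ε / (2 * (M * M * |τ| + 1))) (by positivity)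
  refine ⟨N, fun m hm n hn t ht => ?_⟩
  have h1 := hN m hm n hn
  rw [dist_eq_norm] at h1 hxu ⊢
  have e : yosidaExp R m t x - yosidaExp R n t x
      = yosidaExp R m t (x - u) + (yosidaExp R m t u - yosidaExp R n t u)
        + yosidaExp R n t (u - x) := by
    simp only [map_sub]; abel
  have b1 : ∀ k, ∀ w : X, ‖yosidaExp R k t w‖ ≤ M * ‖w‖ := fun k w =>
    (ContinuousLinearMap.le_opNorm _ _).trans
      (mul_le_mul_of_nonneg_right (h.norm_yosidaExp_le k ht.1) (norm_nonneg _))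
  have b2 := h.norm_yosidaExp_sub_le m n u ht.1
  have b3 : M * M * ‖yosida R m u - yosida R n u‖ * t
      ≤ (M * M * |τ| + 1) * ‖yosida R m u - yosida R n u‖ := by
    have : t ≤ |τ| := ht.2.trans (le_abs_self _)
    have hn := norm_nonneg (yosida R m u - yosida R n u)
    have : M * M * ‖yosida R m u - yosida R n u‖ * t
      ≤ M * M * ‖yosida R m u - yosida R n u‖ * |τ| := by gcongr
    nlinarith
  have b4 : (M * M * |τ| + 1) * ‖yosida R m u - yosida R n u‖ < ε / 2 := by
    rw [lt_div_iff₀ (by positivity)] at h1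
    nlinarith
  have b5 : (M + 1) * ‖x - u‖ < ε / 4 := by
    rw [lt_div_iff₀ (by positivity)] at hxu
    nlinarith
  have b6 := b1 m (x - u)
  have b7 := b1 n (u - x)
  rw [norm_sub_rev u x] at b7
  have b8 := norm_nonneg (x - u)
  rw [e]
  have := norm_add₃_le (a := yosidaExp R m t (x - u))
    (b := yosidaExp R m t u - yosidaExp R n t u) (c := yosidaExp R n t (u - x))
  linarith

/-- Generation theorem of Hille and Yosida: existence of the semigroup. -/
theorem exists_semigroup [CompleteSpace X] (h : IsHilleYosida G R M) :
    ∃ T : ℝ → X →L[ℝ] X, T 0 = 1 ∧ (∀ t, ‖T t‖ ≤ M) ∧ (∀ x, Continuous fun t => T t x) ∧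
      ∀ x y, (x, y) ∈ G → ∀ t ∈ Ici (0 : ℝ),
        HasDerivWithinAt (fun t => T t x) (T t y) (Ici 0) t ∧ (T t x, T t y) ∈ G := by
  have hM := h.M_nonneg
  have hlim : ∀ t x, ∃ z, Tendsto (fun n => yosidaExp R n (max t 0) x) atTop (𝓝 z) := by
    intro t x
    exact cauchySeq_tendsto_of_complete
      ((h.uniformCauchySeqOn_yosidaExp x (max t 0)).cauchySeq ⟨le_max_right _ _, le_rfl⟩)
  choose f hf using hlim
  -- Freezing the orbit for negative times makes it continuous on all of `ℝ`, which avoids one-sided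
  -- integrals below.
  let T : ℝ → X →L[ℝ] X := fun t =>
    continuousLinearMapOfTendsto (fun n => yosidaExp R n (max t 0)) (f := f t)
      (tendsto_pi_nhds.mpr (hf t))
  have hT : ∀ t x, Tendsto (fun n => yosidaExp R n (max t 0) x) atTop (𝓝 (T t x)) := hf
  clear_value T
  have hT' : ∀ t x, 0 ≤ t → Tendsto (fun n => yosidaExp R n t x) atTop (𝓝 (T t x)) := by
    intro t x ht
    have := hT t x
    rwa [max_eq_left ht] at this
  have hTb : ∀ t, ‖T t‖ ≤ M := by
    intro t
    refine ContinuousLinearMap.opNorm_le_bound _ hM fun x => ?_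
    refine le_of_tendsto (hT t x).norm (Eventually.of_forall fun n => ?_)
    exact (ContinuousLinearMap.le_opNorm _ _).trans
      (mul_le_mul_of_nonneg_right (h.norm_yosidaExp_le n (le_max_right _ _)) (norm_nonneg _))
  have hcont : ∀ n x, Continuous fun t => yosidaExp R n t x := by
    intro n x
    exact continuous_iff_continuousAt.mpr fun t => (hasDerivAt_yosidaExp_apply n t x).continuousAt
  have hTc0 : ∀ x, ContinuousOn (fun t => T t x) (Ici 0) := by
    intro x t ht
    have hu : TendstoUniformlyOn (fun n t => yosidaExp R n t x) (fun t => T t x) atTop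
        (Icc 0 (t + 1)) :=
      (h.uniformCauchySeqOn_yosidaExp x (t + 1)).tendstoUniformlyOn_of_tendsto
        fun s hs => hT' s x hs.1
    have hc : ContinuousOn (fun t => T t x) (Icc 0 (t + 1)) :=
      hu.continuousOn (Eventually.of_forall fun n => (hcont n x).continuousOn).frequently
    refine (hc t ⟨ht, by linarith⟩).mono_of_mem_nhdsWithin ?_
    exact inter_mem_nhdsWithin _ (Iic_mem_nhds (by linarith))
  have hTmax : ∀ t, T t = T (max t 0) := by
    intro t
    ext x
    refine tendsto_nhds_unique (hT t x) ?_
    have := hT (max t 0) x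
    rwa [max_eq_left (le_max_right t 0)] at this
  have hTc : ∀ x, Continuous fun t => T t x := by
    intro x
    have : (fun t => T t x) = (fun t => T t x) ∘ fun t => max t 0 := by
      ext t; simp only [Function.comp]; rw [← hTmax]
    rw [this]
    exact (hTc0 x).comp_continuous (by fun_prop) fun t => le_max_right t 0
  refine ⟨T, ?_, hTb, hTc, ?_⟩
  · ext x
    refine tendsto_nhds_unique (hT' 0 x le_rfl) ?_
    simp [yosidaExp_zero]
  · intro x y hxy t ht
    constructor
    -- The identity `T t x = x + ∫ T s y` is inherited from the approximations by dominated
    -- convergence. Differentiability is then the fundamental theorem of calculus.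
    · have hint : ∀ t ∈ Ici (0 : ℝ), T t x = x + ∫ s in (0 : ℝ)..t, T s y := by
        intro t ht
        have e : ∀ n, yosidaExp R n t x
            = x + ∫ s in (0 : ℝ)..t, yosidaExp R n s (yosida R n x) := by
          intro n
          have hd : ∀ s ∈ uIcc 0 t, HasDerivAt (fun s => yosidaExp R n s x)
              (yosidaExp R n s (yosida R n x)) s := by
            intro s _
            exact hasDerivAt_yosidaExp_apply n s x
          rw [intervalIntegral.integral_eq_sub_of_hasDerivAt hd
            ((hcont n _).intervalIntegrable _ _)]
          simp [yosidaExp_zero]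
        have hB : Tendsto (fun n => yosida R n x) atTop (𝓝 y) := by
          simpa only [h.yosida_apply _ hxy] using h.tendsto_smul_resolvent y
        have hl : Tendsto (fun n => ∫ s in (0 : ℝ)..t, yosidaExp R n s (yosida R n x)) atTop
            (𝓝 (∫ s in (0 : ℝ)..t, T s y)) := by
          refine intervalIntegral.tendsto_integral_filter_of_dominated_convergence
            (fun _ => M * (‖y‖ + 1)) ?_ ?_ intervalIntegrable_const ?_
          · exact Eventually.of_forall fun n => (hcont n _).aestronglyMeasurable
          · have hev : ∀ᶠ n in atTop, ‖yosida R n x‖ < ‖y‖ + 1 :=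
              hB.norm.eventually (gt_mem_nhds (by linarith))
            filter_upwards [hev] with n hn
            refine Eventually.of_forall fun s hs => ?_
            rw [uIoc_of_le ht] at hs
            exact (ContinuousLinearMap.le_opNorm _ _).trans
              (mul_le_mul (h.norm_yosidaExp_le n hs.1.le) hn.le (norm_nonneg _) hM)
          · refine Eventually.of_forall fun s hs => ?_
            rw [uIoc_of_le ht] at hs
            have h0 : Tendsto (fun n => yosidaExp R n s (yosida R n x - y)) atTop (𝓝 0) := by
              rw [tendsto_zero_iff_norm_tendsto_zero]
              refine squeeze_zero (fun _ => norm_nonneg _) (g := fun n => M * ‖yosida R n x - y‖)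
                (fun n => (ContinuousLinearMap.le_opNorm _ _).trans
                  (mul_le_mul_of_nonneg_right (h.norm_yosidaExp_le n hs.1.le)
                    (norm_nonneg _))) ?_
              simpa using (tendsto_iff_norm_sub_tendsto_zero.mp hB).const_mul M
            have := h0.add (hT' s y hs.1.le)
            simpa [map_sub] using this
        refine tendsto_nhds_unique (hT' t x ht) ?_
        simp_rw [e]
        exact hl.const_add x
      have hd : HasDerivAt (fun t => x + ∫ s in (0 : ℝ)..t, T s y) (T t y) t :=
        (intervalIntegral.integral_hasDerivAt_right ((hTc y).intervalIntegrable _ _)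
          ((hTc y).stronglyMeasurableAtFilter _ _) (hTc y).continuousAt).const_add x
      exact hd.hasDerivWithinAt.congr hint (hint t ht)
    -- Here `x = R 0 (x - y)`, and `T t` commutes with `R 0`. So `T t x` is in the range of the
    -- resolvent, and `mem` identifies its image as `T t y`.
    · have hx := h.left_inv 0 _ hxy
      simp only [Nat.cast_zero, zero_add, one_smul] at hx
      have hc : ∀ w, T t (R 0 w) = R 0 (T t w) := by
        intro w
        refine tendsto_nhds_unique (hT' t _ ht) ?_
        have := ((R 0).continuous.tendsto _).comp (hT' t w ht)
        refine this.congr fun n => ?_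
        exact DFunLike.congr_fun (h.commute_yosidaExp 0 n t).eq w
      have := h.mem 0 (T t (x - y))
      rw [← hc, hx] at this
      simpa using this

end IsHilleYosida

end HilleYosida

/-! ## Integral equations and primitives -/

section Volterra

variable {E : Type*} [NormedAddCommGroup E] [NormedSpace ℝ E]

/-- The integral equation `c = F + ∫ f(x, c)` on `[0,1]` is solvable for `f` continuous and globally
Lipschitz in the second variable. -/
theorem exists_integral_eq [CompleteSpace E] {f : ℝ → E → E} (hf : Continuous fun p : ℝ × E => f p.1 p.2)
    {C : ℝ} (hC : 0 ≤ C) (hL : ∀ x ∈ Icc (0 : ℝ) 1, ∀ u v, ‖f x u - f x v‖ ≤ C * ‖u - v‖)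
    {F : ℝ → E} (hF : Continuous F) :
    ∃ c : ℝ → E, Continuous c ∧
      ∀ s ∈ Icc (0 : ℝ) 1, c s = F s + ∫ x in (0 : ℝ)..s, f x (c x) := by
  have h01 : (0 : ℝ) ≤ 1 := zero_le_one
  let ext : C(Icc (0 : ℝ) 1, E) → ℝ → E := fun φ => IccExtend h01 φ
  have hext : ∀ φ, Continuous (ext φ) := fun φ => φ.continuous.Icc_extend'
  have hfe : ∀ φ, Continuous fun x => f x (ext φ x) := fun φ =>
    hf.comp (continuous_id.prodMk (hext φ))
  have hV : ∀ φ, Continuous fun s : ℝ => F s + ∫ x in (0 : ℝ)..s, f x (ext φ x) := fun φ =>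
    hF.add (intervalIntegral.continuous_primitive
      (fun a b => (hfe φ).intervalIntegrable a b) 0)
  let V : C(Icc (0 : ℝ) 1, E) → C(Icc (0 : ℝ) 1, E) := fun φ =>
    ⟨fun s => F s + ∫ x in (0 : ℝ)..s, f x (ext φ x), (hV φ).comp continuous_subtype_val⟩
  -- The factorial gain of the Picard iterates makes some iterate a contraction, whatever the size
  -- of `C`.
  have hVb : ∀ (k : ℕ) (φ ψ : C(Icc (0 : ℝ) 1, E)) (s : Icc (0 : ℝ) 1),
      ‖V^[k] φ s - V^[k] ψ s‖ ≤ (C * s) ^ k / k.factorial * dist φ ψ := by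
    intro k φ ψ
    induction k with
    | zero => intro s; simpa [dist_eq_norm] using ContinuousMap.norm_coe_le_norm (φ - ψ) s
    | succ k ih =>
      intro s
      rw [Function.iterate_succ_apply', Function.iterate_succ_apply']
      set a := V^[k] φ
      set b := V^[k] ψ
      have e : V a s - V b s = ∫ x in (0 : ℝ)..s, (f x (ext a x) - f x (ext b x)) := by
        rw [intervalIntegral.integral_sub ((hfe a).intervalIntegrable _ _)
          ((hfe b).intervalIntegrable _ _)]
        simp [V]
      have hs := s.2
      have hb : ∀ x ∈ Ioc (0 : ℝ) s, ‖f x (ext a x) - f x (ext b x)‖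
          ≤ C ^ (k + 1) / k.factorial * dist φ ψ * x ^ k := by
        intro x hx
        have hx1 : x ∈ Icc (0 : ℝ) 1 := ⟨hx.1.le, hx.2.trans hs.2⟩
        have ea : ext a x = a ⟨x, hx1⟩ := IccExtend_of_mem _ _ hx1
        have eb : ext b x = b ⟨x, hx1⟩ := IccExtend_of_mem _ _ hx1
        refine (hL x hx1 _ _).trans ?_
        rw [ea, eb]
        refine (mul_le_mul_of_nonneg_left (ih ⟨x, hx1⟩) hC).trans (le_of_eq ?_)
        simp only [mul_pow, pow_succ]; ring
      rw [e]
      refine (intervalIntegral.norm_integral_le_of_norm_le hs.1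
        (Eventually.of_forall hb) (by apply Continuous.intervalIntegrable; fun_prop)).trans
        (le_of_eq ?_)
      rw [intervalIntegral.integral_const_mul, integral_pow, Nat.factorial_succ]
      push_cast
      field_simp
      ring
  have hlip : ∀ k : ℕ, LipschitzWith (Real.toNNReal (C ^ k / k.factorial)) V^[k] := by
    intro k
    refine LipschitzWith.of_dist_le_mul fun φ ψ => ?_
    rw [Real.coe_toNNReal _ (by positivity), ContinuousMap.dist_le (by positivity)]
    intro s
    rw [dist_eq_norm]
    refine (hVb k φ ψ s).trans ?_
    have h1 : C * (s : ℝ) ≤ C := mul_le_of_le_one_right hC s.2.2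
    have h0 : 0 ≤ C * (s : ℝ) := mul_nonneg hC s.2.1
    gcongr
  obtain ⟨k, hk⟩ : ∃ k : ℕ, C ^ k / k.factorial < 1 :=
    ((FloorSemiring.tendsto_pow_div_factorial_atTop C).eventually
      (gt_mem_nhds one_pos)).exists
  have hcw : ContractingWith (Real.toNNReal (C ^ k / k.factorial)) V^[k] :=
    ⟨by rwa [Real.toNNReal_lt_one], hlip k⟩
  have hfix := hcw.isFixedPt_fixedPoint_iterate
  set φ := hcw.fixedPoint
  refine ⟨ext φ, hext φ, fun s hs => ?_⟩
  have := DFunLike.congr_fun hfix ⟨s, hs⟩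
  have e2 : ext φ s = φ ⟨s, hs⟩ := IccExtend_of_mem _ _ hs
  rw [e2]
  exact this.symm

/-- Uniqueness for the integral equation. -/
theorem eqOn_of_integral_eq [CompleteSpace E] {f : ℝ → E → E} {C : ℝ}
    (hL : ∀ x ∈ Icc (0 : ℝ) 1, ∀ u v, ‖f x u - f x v‖ ≤ C * ‖u - v‖) {F c d : ℝ → E}
    (hcf : ContinuousOn (fun x => f x (c x)) (Icc 0 1))
    (hdf : ContinuousOn (fun x => f x (d x)) (Icc 0 1))
    (hc : ∀ s ∈ Icc (0 : ℝ) 1, c s = F s + ∫ x in (0 : ℝ)..s, f x (c x))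
    (hd : ∀ s ∈ Icc (0 : ℝ) 1, d s = F s + ∫ x in (0 : ℝ)..s, f x (d x)) :
    EqOn c d (Icc 0 1) := by
  set g : ℝ → E := fun x => f x (c x) - f x (d x)
  have hg : ContinuousOn g (Icc 0 1) := hcf.sub hdf
  have hi : ∀ {h : ℝ → E}, ContinuousOn h (Icc 0 1) → ∀ s ∈ Icc (0 : ℝ) 1,
      IntervalIntegrable h volume 0 s := by
    intro h hh s hs
    refine ContinuousOn.intervalIntegrable (hh.mono ?_)
    rw [uIcc_of_le hs.1]; exact Icc_subset_Icc le_rfl hs.2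
  have he : ∀ s ∈ Icc (0 : ℝ) 1, c s - d s = ∫ x in (0 : ℝ)..s, g x := by
    intro s hs
    rw [hc s hs, hd s hs, intervalIntegral.integral_sub (hi hcf s hs) (hi hdf s hs)]; abel
  have hder : ∀ s ∈ Icc (0 : ℝ) 1,
      HasDerivWithinAt (fun s => ∫ x in (0 : ℝ)..s, g x) (g s) (Icc 0 1) s := by
    intro s hs
    have : Fact (s ∈ Icc (0 : ℝ) 1) := ⟨hs⟩
    exact intervalIntegral.integral_hasDerivWithinAt_right (hi hg s hs)
      (hg.stronglyMeasurableAtFilter_nhdsWithin measurableSet_Icc s) (hg s hs)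
  -- Grönwall is applied to the primitive of the difference of the integrands, which is
  -- differentiable and agrees with `c - d` on `[0,1]`.
  have h0 := eq_zero_of_abs_deriv_le_mul_abs_self_of_eq_zero_right (a := (0 : ℝ)) (b := 1)
    (f := fun s => ∫ x in (0 : ℝ)..s, g x) (f' := g) (K := C)
    (fun s hs => (hder s hs).continuousWithinAt)
    (fun s hs => ((hder s (Ico_subset_Icc_self hs)).mono_of_mem_nhdsWithin
      (Icc_mem_nhdsGE_of_mem hs)))
    (by simp) (fun s hs => by
      have hs' := Ico_subset_Icc_self hs
      rw [← he s hs']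
      exact hL s hs' _ _)
  intro s hs
  rw [← sub_eq_zero, he s hs]
  exact h0 s hs

end Volterra

/-! ### Calculus of absolutely continuous functions on `[0,1]` -/

/-- `u` is a primitive of the integrable function `f` on `[0,1]`. -/
def IsPrim (u f : ℝ → ℝ) : Prop :=
  IntervalIntegrable f volume 0 1 ∧ ∀ s ∈ Icc (0 : ℝ) 1, u s = u 0 + ∫ x in (0 : ℝ)..s, f x

namespace IsPrim

variable {u v f g : ℝ → ℝ}

/-- The integral expression is used in place of `u`, since Lebesgue differentiation gives its
derivative almost everywhere; `mul` relies on this. -/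
theorem absolutelyContinuous (h : IsPrim u f) :
    AbsolutelyContinuousOnInterval (fun s => u 0 + ∫ x in (0 : ℝ)..s, f x) 0 1 := by
  have h1 := h.1.absolutelyContinuousOnInterval_intervalIntegral (c := 0) (by simp)
  have h2 : AbsolutelyContinuousOnInterval (fun _ : ℝ => u 0) 0 1 :=
    (LipschitzWith.const (u 0)).lipschitzOnWith.absolutelyContinuousOnInterval
  exact h2.add h1

theorem continuousOn (h : IsPrim u f) : ContinuousOn u (Icc 0 1) := by
  have := h.absolutelyContinuous.continuousOn
  rw [uIcc_of_le zero_le_one] at this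
  exact this.congr h.2

theorem mono_integrable (h : IntervalIntegrable f volume 0 1) {s : ℝ} (hs : s ∈ Icc (0 : ℝ) 1) :
    IntervalIntegrable f volume 0 s :=
  h.mono_set (by rw [uIcc_of_le hs.1, uIcc_of_le zero_le_one]; exact Icc_subset_Icc le_rfl hs.2)

/-- Integration by parts for absolutely continuous functions. Together with `eq_sub` it yields the
energy identity, the pairing with test functions and the Lyapunov estimate. -/
theorem mul (hu : IsPrim u f) (hv : IsPrim v g) :
    IsPrim (fun s => u s * v s) (fun s => f s * v s + u s * g s) := by
  have hI : IntervalIntegrable (fun s => f s * v s + u s * g s) volume 0 1 := by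
    refine IntervalIntegrable.add (hu.1.mul_continuousOn ?_) (hv.1.continuousOn_mul ?_)
    · rw [uIcc_of_le zero_le_one]; exact hv.continuousOn
    · rw [uIcc_of_le zero_le_one]; exact hu.continuousOn
  refine ⟨hI, fun s hs => ?_⟩
  have hsub : uIcc 0 s ⊆ uIcc (0 : ℝ) 1 := by
    rw [uIcc_of_le hs.1, uIcc_of_le zero_le_one]; exact Icc_subset_Icc le_rfl hs.2
  set U := fun s => u 0 + ∫ x in (0 : ℝ)..s, f x with hU
  set W := fun s => v 0 + ∫ x in (0 : ℝ)..s, g x with hW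
  have key := (hu.absolutelyContinuous.mono hsub).integral_deriv_mul_eq_sub
    (hv.absolutelyContinuous.mono hsub)
  have hc : ∫ x in (0 : ℝ)..s, (f x * v x + u x * g x)
      = ∫ x in (0 : ℝ)..s, (deriv U x * W x + U x * deriv W x) := by
    refine intervalIntegral.integral_congr_ae ?_
    filter_upwards [hu.1.ae_hasDerivAt_integral, hv.1.ae_hasDerivAt_integral] with x h1 h2 hx
    rw [uIoc_of_le hs.1] at hx
    have hx' : x ∈ Icc (0 : ℝ) 1 := ⟨hx.1.le, hx.2.trans hs.2⟩
    have hx'' : x ∈ uIcc (0 : ℝ) 1 := by rwa [uIcc_of_le zero_le_one]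
    have d1 : deriv U x = f x := ((h1 hx'' 0 (by simp)).const_add (u 0)).deriv
    have d2 : deriv W x = g x := ((h2 hx'' 0 (by simp)).const_add (v 0)).deriv
    rw [d1, d2, hU, hW]
    simp only
    rw [← hu.2 x hx', ← hv.2 x hx']
  rw [hc, key]
  simp only [intervalIntegral.integral_same, add_zero]
  rw [← hu.2 s hs, ← hv.2 s hs]
  ring

theorem congr (h : IsPrim u f) (huv : EqOn u v (Icc 0 1))
    (hfg : ∀ᵐ s ∂(volume.restrict (Ioo (0 : ℝ) 1)), f s = g s) : IsPrim v g := by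
  have hfg' : ∀ᵐ s ∂volume, s ∈ Ioo (0 : ℝ) 1 → f s = g s :=
    (ae_restrict_iff' measurableSet_Ioo).mp hfg
  have h1 : ∀ᵐ s ∂volume, s ∈ Ioc (0 : ℝ) 1 → f s = g s := by
    -- Interval integrals live on `Ioc`, the measure of `L²` on `Ioo`; the endpoint `1` is a null
    -- set.
    have : ∀ᵐ s : ℝ ∂volume, s ≠ 1 := by simp [ae_iff, measure_singleton]
    filter_upwards [hfg', this] with s h2 h3 h4
    exact h2 ⟨h4.1, lt_of_le_of_ne h4.2 h3⟩
  refine ⟨h.1.congr_ae ?_, fun s hs => ?_⟩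
  · rw [uIoc_of_le zero_le_one]
    exact (ae_restrict_iff' measurableSet_Ioc).mpr h1
  · rw [← huv hs, ← huv ⟨le_rfl, zero_le_one⟩, h.2 s hs]
    congr 1
    refine intervalIntegral.integral_congr_ae ?_
    filter_upwards [h1] with x hx hxs
    rw [uIoc_of_le hs.1] at hxs
    exact hx ⟨hxs.1, hxs.2.trans hs.2⟩

theorem of_hasDerivWithinAt (hd : ∀ s ∈ Icc (0 : ℝ) 1, HasDerivWithinAt u (f s) (Icc 0 1) s)
    (hc : ContinuousOn f (Icc 0 1)) : IsPrim u f := by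
  have hI : IntervalIntegrable f volume 0 1 :=
    ContinuousOn.intervalIntegrable (by rwa [uIcc_of_le zero_le_one])
  refine ⟨hI, fun s hs => ?_⟩
  rw [intervalIntegral.integral_eq_sub_of_hasDerivAt_of_le hs.1
    (f := u) (fun x hx => ((hd x ⟨hx.1, hx.2.trans hs.2⟩).continuousWithinAt).mono
      (Icc_subset_Icc le_rfl hs.2))
    (fun x hx => (hd x ⟨hx.1.le, hx.2.le.trans hs.2⟩).hasDerivAt
      (Icc_mem_nhds hx.1 (hx.2.trans_le hs.2))) (mono_integrable hI hs)]
  ring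

theorem of_contDiffOn (h : ContDiffOn ℝ 1 u (Icc 0 1)) :
    IsPrim u (derivWithin u (Icc 0 1)) :=
  of_hasDerivWithinAt
    (fun s hs => (h.differentiableOn one_ne_zero s hs).hasDerivWithinAt)
    (h.continuousOn_derivWithin (uniqueDiffOn_Icc zero_lt_one) le_rfl)

theorem const (a : ℝ) : IsPrim (fun _ => a) (fun _ => 0) :=
  ⟨intervalIntegrable_const, fun s _ => by simp⟩

theorem add (hu : IsPrim u f) (hv : IsPrim v g) :
    IsPrim (fun s => u s + v s) (fun s => f s + g s) := by
  refine ⟨hu.1.add hv.1, fun s hs => ?_⟩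
  rw [intervalIntegral.integral_add (mono_integrable hu.1 hs) (mono_integrable hv.1 hs)]
  beta_reduce
  rw [hu.2 s hs, hv.2 s hs]
  ring

theorem const_mul (a : ℝ) (hu : IsPrim u f) : IsPrim (fun s => a * u s) (fun s => a * f s) := by
  refine ⟨hu.1.const_mul a, fun s hs => ?_⟩
  rw [intervalIntegral.integral_const_mul]
  beta_reduce
  rw [hu.2 s hs]
  ring

theorem eq_sub (hu : IsPrim u f) : ∫ s in Ioo (0 : ℝ) 1, f s = u 1 - u 0 := by
  rw [← integral_Ioc_eq_integral_Ioo, ← intervalIntegral.integral_of_le zero_le_one,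
    hu.2 1 ⟨zero_le_one, le_rfl⟩]
  ring

end IsPrim

variable {ℓ r m : ℕ}

/-! ## The space `L²((0,1), ℝⁿ)` -/

theorem L2.ext_ae {f g : L2 ℓ r}
    (h : ∀ᵐ s ∂(volume.restrict (Ioo (0 : ℝ) 1)), (f s).ofLp = (g s).ofLp) : f = g := by
  refine Lp.ext ?_
  filter_upwards [h] with s hs
  exact WithLp.ofLp_injective 2 hs

theorem L2.coe_add (f g : L2 ℓ r) : ∀ᵐ s ∂(volume.restrict (Ioo (0 : ℝ) 1)),
    ((f + g : L2 ℓ r) s).ofLp = (f s).ofLp + (g s).ofLp := by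
  filter_upwards [Lp.coeFn_add f g] with s hs
  rw [hs]; rfl

theorem L2.coe_sub (f g : L2 ℓ r) : ∀ᵐ s ∂(volume.restrict (Ioo (0 : ℝ) 1)),
    ((f - g : L2 ℓ r) s).ofLp = (f s).ofLp - (g s).ofLp := by
  filter_upwards [Lp.coeFn_sub f g] with s hs
  rw [hs]; rfl

theorem L2.coe_smul (a : ℝ) (f : L2 ℓ r) : ∀ᵐ s ∂(volume.restrict (Ioo (0 : ℝ) 1)),
    ((a • f : L2 ℓ r) s).ofLp = a • (f s).ofLp := by
  filter_upwards [Lp.coeFn_smul a f] with s hs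
  rw [hs]; rfl

theorem L2.coe_zero : ∀ᵐ s ∂(volume.restrict (Ioo (0 : ℝ) 1)),
    ((0 : L2 ℓ r) s).ofLp = 0 := by
  filter_upwards [Lp.coeFn_zero (EuclideanSpace ℝ (Idx ℓ r)) 2
    (volume.restrict (Ioo (0 : ℝ) 1))] with s hs
  rw [hs]; rfl

theorem L2.memLp_eval (f : L2 ℓ r) (i : Idx ℓ r) :
    MemLp (fun s => f s i) 2 (volume.restrict (Ioo (0 : ℝ) 1)) :=
  MemLp.eval_piLp (Lp.memLp f) i

theorem intervalIntegrable_of_integrable_Ioo {f : ℝ → ℝ}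
    (h : Integrable f (volume.restrict (Ioo (0 : ℝ) 1))) : IntervalIntegrable f volume 0 1 := by
  rw [intervalIntegrable_iff_integrableOn_Ioo_of_le zero_le_one]
  exact h

theorem L2.integrable_eval (f : L2 ℓ r) (i : Idx ℓ r) :
    Integrable (fun s => f s i) (volume.restrict (Ioo (0 : ℝ) 1)) :=
  (f.memLp_eval i).integrable (by norm_num)

theorem L2.intervalIntegrable_eval (f : L2 ℓ r) (i : Idx ℓ r) :
    IntervalIntegrable (fun s => f s i) volume 0 1 :=
  intervalIntegrable_of_integrable_Ioo (f.integrable_eval i)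

theorem L2.integrable_eval_mul (f g : L2 ℓ r) (i j : Idx ℓ r) :
    Integrable (fun s => f s i * g s j) (volume.restrict (Ioo (0 : ℝ) 1)) :=
  (f.memLp_eval i).integrable_mul (g.memLp_eval j)

theorem L2.inner_eq (f g : L2 ℓ r) :
    ⟪f, g⟫ = ∫ s in Ioo (0 : ℝ) 1, (f s).ofLp ⬝ᵥ (g s).ofLp := by
  rw [L2.inner_def]
  refine integral_congr_ae (Eventually.of_forall fun s => ?_)
  simp [PiLp.inner_apply, dotProduct, mul_comm]

theorem L2.inner_eq_sum (f g : L2 ℓ r) :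
    ⟪f, g⟫ = ∑ i, ∫ s in Ioo (0 : ℝ) 1, f s i * g s i := by
  rw [L2.inner_eq]
  simp only [dotProduct]
  rw [integral_finsetSum _ fun i _ => L2.integrable_eval_mul f g i i]

theorem isH1_iff {f df : L2 ℓ r} {c : ℝ → Idx ℓ r → ℝ} :
    IsH1 f df c ↔ (∀ i, IsPrim (fun s => c s i) (fun s => df s i)) ∧
      ∀ᵐ s ∂(volume.restrict (Ioo (0 : ℝ) 1)), (f s).ofLp = c s := by
  constructor
  · rintro ⟨h1, h2⟩
    refine ⟨fun i => ⟨df.intervalIntegrable_eval i, fun s hs => h1 s hs i⟩, ?_⟩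
    filter_upwards [h2] with s hs
    exact funext hs
  · rintro ⟨h1, h2⟩
    refine ⟨fun s hs i => (h1 i).2 s hs, ?_⟩
    filter_upwards [h2] with s hs i
    rw [← hs]

/-! ### Functions as elements of `L²` -/

open Classical in
/-- The class in `L²` of a function, if it is square integrable. -/
def toL2 (f : ℝ → Idx ℓ r → ℝ) : L2 ℓ r :=
  if h : MemLp (fun s => WithLp.toLp 2 (f s)) 2 (volume.restrict (Ioo (0 : ℝ) 1)) then
    h.toLp else 0

theorem memLp_of_continuousOn {f : ℝ → ℝ} (hf : ContinuousOn f (Icc 0 1)) :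
    MemLp f 2 (volume.restrict (Ioo (0 : ℝ) 1)) := by
  obtain ⟨C, hC⟩ := isCompact_Icc.exists_bound_of_continuousOn hf
  refine MemLp.of_bound ((hf.mono Ioo_subset_Icc_self).aestronglyMeasurable measurableSet_Ioo) C ?_
  filter_upwards [ae_restrict_mem measurableSet_Ioo] with s hs
  exact hC s (Ioo_subset_Icc_self hs)

theorem toL2_coe_of_memLp {f : ℝ → Idx ℓ r → ℝ}
    (hf : ∀ i, MemLp (fun s => f s i) 2 (volume.restrict (Ioo (0 : ℝ) 1))) :
    ∀ᵐ s ∂(volume.restrict (Ioo (0 : ℝ) 1)), (toL2 f s).ofLp = f s := by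
  have h : MemLp (fun s => WithLp.toLp 2 (f s)) 2 (volume.restrict (Ioo (0 : ℝ) 1)) :=
    MemLp.of_eval_piLp hf
  rw [toL2, dif_pos h]
  filter_upwards [h.coeFn_toLp] with s hs
  rw [hs]

theorem toL2_coe {f : ℝ → Idx ℓ r → ℝ} (hf : ∀ i, ContinuousOn (fun s => f s i) (Icc 0 1)) :
    ∀ᵐ s ∂(volume.restrict (Ioo (0 : ℝ) 1)), (toL2 f s).ofLp = f s :=
  toL2_coe_of_memLp fun i => memLp_of_continuousOn (hf i)

/-! ### Multiplication by a continuous matrix function -/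

theorem continuousOn_toEuclideanCLM {M : ℝ → Matrix (Idx ℓ r) (Idx ℓ r) ℝ}
    (hM : ∀ i j, ContinuousOn (fun s => M s i j) (Icc 0 1)) :
    ContinuousOn (fun s => Matrix.toEuclideanCLM (𝕜 := ℝ) (M s)) (Icc 0 1) := by
  have h1 : ContinuousOn M (Icc 0 1) :=
    continuousOn_pi.mpr fun i => continuousOn_pi.mpr fun j => hM i j
  have h2 : Continuous (fun A : Matrix (Idx ℓ r) (Idx ℓ r) ℝ =>
      Matrix.toEuclideanCLM (𝕜 := ℝ) A) :=
    LinearMap.continuous_of_finiteDimensional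
      (Matrix.toEuclideanCLM (n := Idx ℓ r) (𝕜 := ℝ)).toAlgEquiv.toLinearMap
  exact h2.comp_continuousOn h1

theorem exists_mulOp {M : ℝ → Matrix (Idx ℓ r) (Idx ℓ r) ℝ}
    (hM : ∀ i j, ContinuousOn (fun s => M s i j) (Icc 0 1)) :
    ∃ T : L2 ℓ r →L[ℝ] L2 ℓ r, ∀ f, ∀ᵐ s ∂(volume.restrict (Ioo (0 : ℝ) 1)),
      (T f s).ofLp = (M s).mulVec (f s).ofLp := by
  have hA := continuousOn_toEuclideanCLM hM
  set A : ℝ → EuclideanSpace ℝ (Idx ℓ r) →L[ℝ] EuclideanSpace ℝ (Idx ℓ r) :=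
    fun s => Matrix.toEuclideanCLM (𝕜 := ℝ) (M s)
  obtain ⟨C, hC⟩ := isCompact_Icc.exists_bound_of_continuousOn hA
  have hAm : AEStronglyMeasurable A (volume.restrict (Ioo (0 : ℝ) 1)) :=
    (hA.mono Ioo_subset_Icc_self).aestronglyMeasurable measurableSet_Ioo
  have hb : ∀ f : L2 ℓ r, ∀ᵐ s ∂(volume.restrict (Ioo (0 : ℝ) 1)),
      ‖A s (f s)‖ ≤ C * ‖f s‖ := by
    intro f
    filter_upwards [ae_restrict_mem measurableSet_Ioo] with s hs
    exact ((A s).le_opNorm _).trans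
      (mul_le_mul_of_nonneg_right (hC s (Ioo_subset_Icc_self hs)) (norm_nonneg _))
  have hmem : ∀ f : L2 ℓ r, MemLp (fun s => A s (f s)) 2 (volume.restrict (Ioo (0 : ℝ) 1)) := by
    intro f
    refine MemLp.of_le_mul (Lp.memLp f) ?_ (hb f)
    exact isBoundedBilinearMap_apply.continuous.comp_aestronglyMeasurable
      (hAm.prodMk (Lp.memLp f).1)
  let T : L2 ℓ r →ₗ[ℝ] L2 ℓ r :=
    { toFun := fun f => (hmem f).toLp
      map_add' := fun f g => by
        refine Lp.ext ?_
        filter_upwards [(hmem (f + g)).coeFn_toLp, (hmem f).coeFn_toLp, (hmem g).coeFn_toLp,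
          Lp.coeFn_add f g, Lp.coeFn_add ((hmem f).toLp) ((hmem g).toLp)] with s h1 h2 h3 h4 h5
        rw [h1, h5, Pi.add_apply, h2, h3, h4, Pi.add_apply, map_add]
      map_smul' := fun a f => by
        refine Lp.ext ?_
        filter_upwards [(hmem (a • f)).coeFn_toLp, (hmem f).coeFn_toLp,
          Lp.coeFn_smul a f, Lp.coeFn_smul a ((hmem f).toLp)] with s h1 h2 h3 h4
        rw [RingHom.id_apply, h1, h4, Pi.smul_apply, h2, h3, Pi.smul_apply, map_smul] }
  refine ⟨T.mkContinuous C fun f => ?_, fun f => ?_⟩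
  · refine Lp.norm_le_mul_norm_of_ae_le_mul ?_
    filter_upwards [(hmem f).coeFn_toLp, hb f] with s h1 h2
    rw [show (T f : ℝ → _) s = A s (f s) from h1]
    exact h2
  · filter_upwards [(hmem f).coeFn_toLp] with s h1
    rw [show (T.mkContinuous C _ f : L2 ℓ r) s = A s (f s) from h1]
    exact Matrix.ofLp_toEuclideanCLM (M s) (f s)

open Classical in
/-- Multiplication by a matrix function with continuous entries. -/
def mulOp (M : ℝ → Matrix (Idx ℓ r) (Idx ℓ r) ℝ) : L2 ℓ r →L[ℝ] L2 ℓ r :=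
  if h : ∀ i j, ContinuousOn (fun s => M s i j) (Icc 0 1) then (exists_mulOp h).choose else 0

theorem mulOp_coe {M : ℝ → Matrix (Idx ℓ r) (Idx ℓ r) ℝ}
    (hM : ∀ i j, ContinuousOn (fun s => M s i j) (Icc 0 1)) (f : L2 ℓ r) :
    ∀ᵐ s ∂(volume.restrict (Ioo (0 : ℝ) 1)), (mulOp M f s).ofLp = (M s).mulVec (f s).ofLp := by
  rw [mulOp, dif_pos hM]
  exact (exists_mulOp hM).choose_spec f

/-! ## The generator of the homogeneous closed loop -/

/-- Two-term combinations yield sums, multiples and differences by choice of the coefficients, so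
linearity is proved once. -/
theorem incoming_combine (a b : ℝ) (c d : ℝ → Idx ℓ r → ℝ) :
    incoming (fun s => a • c s + b • d s) = a • incoming c + b • incoming d := by
  funext i; rcases i with i | i <;> simp [incoming]

theorem outgoing_combine (a b : ℝ) (c d : ℝ → Idx ℓ r → ℝ) :
    outgoing (fun s => a • c s + b • d s) = a • outgoing c + b • outgoing d := by
  funext i; rcases i with i | i <;> simp [outgoing]

theorem L2.coe_combine (a b : ℝ) (f g : L2 ℓ r) : ∀ᵐ s ∂(volume.restrict (Ioo (0 : ℝ) 1)),
    ((a • f + b • g : L2 ℓ r) s).ofLp = a • (f s).ofLp + b • (g s).ofLp := by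
  filter_upwards [L2.coe_add (a • f) (b • g), L2.coe_smul a f, L2.coe_smul b g] with s h1 h2 h3
  rw [h1, h2, h3]

theorem IsH1.combine (a b : ℝ) {f df g dg : L2 ℓ r} {c d : ℝ → Idx ℓ r → ℝ}
    (h₁ : IsH1 f df c) (h₂ : IsH1 g dg d) :
    IsH1 (a • f + b • g) (a • df + b • dg) (fun s => a • c s + b • d s) := by
  rw [isH1_iff] at *
  refine ⟨fun i => ?_, ?_⟩
  · refine (((h₁.1 i).const_mul a).add ((h₂.1 i).const_mul b)).congr (fun s _ => by simp) ?_
    filter_upwards [L2.coe_combine a b df dg] with s hs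
    rw [hs]; simp
  · filter_upwards [L2.coe_combine a b f g, h₁.2, h₂.2] with s hs h1 h2
    rw [hs, h1, h2]

/-- Vanishing disturbances and reference. -/
def zeroExo : Exo ℓ r m := ⟨0, 0, 0⟩

namespace Plant

variable (P : Plant ℓ r m) {ki : ℝ} {Ki : Matrix (Fin m) (Fin m) ℝ}

/-- The closed-loop equations are linear in the state and the exogenous data. -/
theorem ClosedLoopAt.combine {P : Plant ℓ r m} (a b : ℝ) {d₁ d₂ d : Exo ℓ r m}
    (hwb : d.wb = a • d₁.wb + b • d₂.wb)
    -- Only the difference `w_y - y_ref` enters the equation for `z_t`.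
    (hwy : d.wy - d.yref = a • (d₁.wy - d₁.yref) + b • (d₂.wy - d₂.yref))
    {v₁ v₁' v₂ v₂' : State ℓ r m} {f₁ f₂ : L2 ℓ r}
    (h₁ : P.ClosedLoopAt ki Ki d₁ v₁ f₁ v₁') (h₂ : P.ClosedLoopAt ki Ki d₂ v₂ f₂ v₂') :
    P.ClosedLoopAt ki Ki d (a • v₁ + b • v₂) (a • f₁ + b • f₂) (a • v₁' + b • v₂') := by
  obtain ⟨c₁, hc₁, hb₁, he₁, hz₁⟩ := h₁
  obtain ⟨c₂, hc₂, hb₂, he₂, hz₂⟩ := h₂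
  refine ⟨fun s => a • c₁ s + b • c₂ s, hc₁.combine a b hc₂, ?_, ?_, ?_⟩
  · unfold BoundaryCondition at *
    rw [incoming_combine, outgoing_combine, hb₁, hb₂, hwb]
    simp only [Prod.snd_add, Prod.smul_snd, WithLp.ofLp_add, WithLp.ofLp_smul,
      Matrix.mulVec_add, Matrix.mulVec_smul]
    module
  · have e1 : (a • v₁' + b • v₂').1 = a • v₁'.1 + b • v₂'.1 := rfl
    have e2 : (a • v₁ + b • v₂).1 = a • v₁.1 + b • v₂.1 := rfl
    rw [e1, e2]
    filter_upwards [L2.coe_combine a b v₁'.1 v₂'.1, L2.coe_combine a b f₁ f₂,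
      L2.coe_combine a b v₁.1 v₂.1, he₁, he₂] with s h1 h2 h3 h4 h5
    rw [h1, h2, h3]
    have : a • ((v₁'.1 s).ofLp + (P.Lam0 s).mulVec (f₁ s).ofLp + (P.Lam1 s).mulVec (v₁.1 s).ofLp)
      + b • ((v₂'.1 s).ofLp + (P.Lam0 s).mulVec (f₂ s).ofLp + (P.Lam1 s).mulVec (v₂.1 s).ofLp)
      = 0 := by rw [h4, h5]; simp
    rw [← this]
    simp only [Matrix.mulVec_add, Matrix.mulVec_smul]
    module
  · have e : (a • v₁' + b • v₂').2.ofLp = a • v₁'.2.ofLp + b • v₂'.2.ofLp := rfl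
    rw [e, hz₁, hz₂]
    unfold output
    rw [incoming_combine, outgoing_combine]
    simp only [Matrix.mulVec_add, Matrix.mulVec_smul]
    have e3 : ∀ x y : Fin m → ℝ, x + y + d.wy - d.yref = x + y + (d.wy - d.yref) :=
      fun x y => by abel
    rw [e3, hwy]
    module

/-- The graph of the generator of the homogeneous closed loop. -/
def genGraph (P : Plant ℓ r m) (ki : ℝ) (Ki : Matrix (Fin m) (Fin m) ℝ) :
    Submodule ℝ (State ℓ r m × State ℓ r m) where
  carrier := {p | ∃ f, P.ClosedLoopAt ki Ki zeroExo p.1 f p.2}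
  add_mem' := by
    rintro p q ⟨f, hf⟩ ⟨g, hg⟩
    have := ClosedLoopAt.combine (d := zeroExo) 1 1 (by simp [zeroExo]) (by simp [zeroExo]) hf hg
    simp only [one_smul] at this
    exact ⟨_, this⟩
  zero_mem' := by
    refine ⟨0, fun _ => 0, isH1_iff.mpr ⟨fun i => ?_, L2.coe_zero⟩, ?_, ?_, ?_⟩
    · refine (IsPrim.const 0).congr (fun _ _ => rfl) ?_
      filter_upwards [L2.coe_zero (ℓ := ℓ) (r := r)] with s hs
      rw [hs]; rfl
    · have h1 : incoming (fun _ => (0 : Idx ℓ r → ℝ)) = 0 := by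
        funext i; rcases i with i | i <;> rfl
      have h2 : outgoing (fun _ => (0 : Idx ℓ r → ℝ)) = 0 := by
        funext i; rcases i with i | i <;> rfl
      simp [BoundaryCondition, h1, h2, zeroExo]
    · filter_upwards [L2.coe_zero (ℓ := ℓ) (r := r)] with s hs
      have e : ((0 : State ℓ r m × State ℓ r m).2).1 = 0 := rfl
      have e' : ((0 : State ℓ r m × State ℓ r m).1).1 = 0 := rfl
      rw [e, e', hs]; simp
    · have h1 : incoming (fun _ => (0 : Idx ℓ r → ℝ)) = 0 := by
        funext i; rcases i with i | i <;> rfl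
      have h2 : outgoing (fun _ => (0 : Idx ℓ r → ℝ)) = 0 := by
        funext i; rcases i with i | i <;> rfl
      simp [output, h1, h2, zeroExo]
  smul_mem' := by
    rintro a p ⟨f, hf⟩
    have := ClosedLoopAt.combine (d := zeroExo) a 0 (by simp [zeroExo]) (by simp [zeroExo]) hf hf
    simp only [zero_smul, add_zero] at this
    exact ⟨_, this⟩

/-! ### Energy estimate -/

/-- Sign of the speeds. -/
def sgn : Idx ℓ r → ℝ := Sum.elim (fun _ => 1) (fun _ => -1)

theorem sgn_mul_self (i : Idx ℓ r) : sgn i * sgn i = 1 := by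
  rcases i with i | i <;> simp [sgn]

theorem sgn_mul_lam_pos (i : Idx ℓ r) {s : ℝ} (hs : s ∈ Icc (0 : ℝ) 1) :
    0 < sgn i * P.lam i s := by
  rcases i with i | i
  · simpa [sgn] using P.lam_pos i s hs
  · simpa [sgn] using P.lam_neg i s hs

theorem lam_ne_zero (i : Idx ℓ r) {s : ℝ} (hs : s ∈ Icc (0 : ℝ) 1) : P.lam i s ≠ 0 := by
  have := P.sgn_mul_lam_pos i hs
  intro h; rw [h, mul_zero] at this; exact lt_irrefl _ this

theorem abs_lam (i : Idx ℓ r) {s : ℝ} (hs : s ∈ Icc (0 : ℝ) 1) :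
    |P.lam i s| = sgn i * P.lam i s := by
  rcases i with i | i
  · simp [sgn, abs_of_pos (P.lam_pos i s hs)]
  · simp [sgn, abs_of_neg (P.lam_neg i s hs)]

/-- Affine weight, `ε` at the incoming and `1` at the outgoing end. -/
def weight (ε : ℝ) : Idx ℓ r → ℝ → ℝ :=
  Sum.elim (fun _ s => ε + (1 - ε) * s) (fun _ s => 1 - (1 - ε) * s)

theorem isPrim_weight (ε : ℝ) (i : Idx ℓ r) :
    IsPrim (weight ε i) (fun _ => sgn i * (1 - ε)) := by
  refine IsPrim.of_hasDerivWithinAt (fun s _ => HasDerivAt.hasDerivWithinAt ?_) continuousOn_const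
  rcases i with i | i
  · simpa [weight, sgn] using ((hasDerivAt_id s).const_mul (1 - ε)).const_add ε
  · simpa [weight, sgn] using ((hasDerivAt_id s).const_mul (1 - ε)).const_sub 1

theorem weight_pos {ε : ℝ} (h0 : 0 < ε) (h1 : ε ≤ 1) (i : Idx ℓ r) {s : ℝ}
    (hs : s ∈ Icc (0 : ℝ) 1) : 0 < weight ε i s := by
  rcases i with i | i
  · simp only [weight, Sum.elim_inl]; nlinarith [hs.1]
  · simp only [weight, Sum.elim_inr]; nlinarith [hs.2]

/-- Diagonal density of the energy. -/
def energyWeight (ε : ℝ) (s : ℝ) : Matrix (Idx ℓ r) (Idx ℓ r) ℝ :=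
  -- Division by `|λᵢ|` turns the product with `Λ₀` into `sgn i` times the affine weight, so no
  -- coefficient survives in the boundary terms.
  Matrix.diagonal fun i => weight ε i s / (sgn i * P.lam i s)

theorem continuousOn_lam (i : Idx ℓ r) : ContinuousOn (P.lam i) (Icc 0 1) :=
  (P.lam_C1 i).continuousOn

theorem continuousOn_Lam1 (i j : Idx ℓ r) : ContinuousOn (fun s => P.Lam1 s i j) (Icc 0 1) :=
  (P.Lam1_C1 i j).continuousOn

theorem continuousOn_diagonal {q : Idx ℓ r → ℝ → ℝ} (hq : ∀ i, ContinuousOn (q i) (Icc 0 1))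
    (i j : Idx ℓ r) :
    ContinuousOn (fun s => Matrix.diagonal (fun i => q i s) i j) (Icc 0 1) := by
  by_cases h : i = j
  · subst h; simpa using hq i
  · simpa [Matrix.diagonal_apply_ne _ h] using continuousOn_const

theorem continuousOn_weight_div (ε : ℝ) (i : Idx ℓ r) :
    ContinuousOn (fun s => weight ε i s / (sgn i * P.lam i s)) (Icc 0 1) :=
  (isPrim_weight ε i).continuousOn.div (continuousOn_const.mul (P.continuousOn_lam i))
    fun _ hs => (P.sgn_mul_lam_pos i hs).ne'

theorem energyWeight_coe (ε : ℝ) (f : L2 ℓ r) :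
    ∀ᵐ s ∂(volume.restrict (Ioo (0 : ℝ) 1)), ∀ i,
      mulOp (P.energyWeight ε) f s i = weight ε i s / (sgn i * P.lam i s) * f s i := by
  filter_upwards [mulOp_coe (M := P.energyWeight ε)
    (continuousOn_diagonal (P.continuousOn_weight_div ε)) f] with s hs i
  rw [hs, energyWeight, Matrix.mulVec_diagonal]

theorem energy_symm (ε : ℝ) (f g : L2 ℓ r) :
    ⟪mulOp (P.energyWeight ε) f, g⟫ = ⟪mulOp (P.energyWeight ε) g, f⟫ := by
  rw [L2.inner_eq, L2.inner_eq]
  refine integral_congr_ae ?_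
  filter_upwards [P.energyWeight_coe ε f, P.energyWeight_coe ε g] with s h1 h2
  simp only [dotProduct, h1, h2]
  exact Finset.sum_congr rfl fun i _ => by ring

theorem exists_energy_lower {ε : ℝ} (h0 : 0 < ε) (h1 : ε ≤ 1) :
    ∃ κ > 0, ∀ f : L2 ℓ r, κ * ‖f‖ ^ 2 ≤ ⟪mulOp (P.energyWeight ε) f, f⟫ := by
  have hpos : ∀ i : Idx ℓ r, ∀ s ∈ Icc (0 : ℝ) 1, 0 < weight ε i s / (sgn i * P.lam i s) :=
    fun i s hs => div_pos (weight_pos h0 h1 i hs) (P.sgn_mul_lam_pos i hs)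
  have hmin : ∀ i : Idx ℓ r, ∃ κ > 0, ∀ s ∈ Icc (0 : ℝ) 1,
      κ ≤ weight ε i s / (sgn i * P.lam i s) := by
    intro i
    obtain ⟨s₀, hs₀, hm⟩ := isCompact_Icc.exists_isMinOn (nonempty_Icc.mpr zero_le_one)
      (P.continuousOn_weight_div ε i)
    exact ⟨_, hpos i s₀ hs₀, fun s hs => hm hs⟩
  choose κ hκ hκle using hmin
  obtain ⟨k, hk, hkle⟩ : ∃ k > 0, ∀ i, k ≤ κ i := by
    -- For `ℓ + r = 0` there is no smallest `κ i`, but any constant serves.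
    rcases isEmpty_or_nonempty (Idx ℓ r) with he | hne
    · exact ⟨1, one_pos, fun i => he.elim i⟩
    · obtain ⟨i₀, hi₀⟩ := Finite.exists_min κ
      exact ⟨κ i₀, hκ i₀, hi₀⟩
  refine ⟨k, hk, fun f => ?_⟩
  rw [← real_inner_self_eq_norm_sq, ← real_inner_smul_left, L2.inner_eq_sum, L2.inner_eq_sum]
  refine Finset.sum_le_sum fun i _ => ?_
  refine integral_mono_ae (L2.integrable_eval_mul _ _ _ _) (L2.integrable_eval_mul _ _ _ _) ?_
  filter_upwards [P.energyWeight_coe ε f, L2.coe_smul k f,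
    ae_restrict_mem measurableSet_Ioo] with s h2 h3 hs
  rw [h2, h3]
  have := (hkle i).trans (hκle i s (Ioo_subset_Icc_self hs))
  simp only [Pi.smul_apply, smul_eq_mul]
  nlinarith [mul_self_nonneg (f s i)]

/-- Integration by parts in the energy. -/
theorem energy_identity (ε : ℝ) {v v' : State ℓ r m} {f : L2 ℓ r} {c : ℝ → Idx ℓ r → ℝ}
    (hc : IsH1 v.1 f c)
    (he : ∀ᵐ s ∂(volume.restrict (Ioo (0 : ℝ) 1)),
      (v'.1 s).ofLp + (P.Lam0 s).mulVec (f s).ofLp + (P.Lam1 s).mulVec (v.1 s).ofLp = 0) :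
    ⟪mulOp (P.energyWeight ε) v.1, v'.1⟫
      = (ε * (incoming c ⬝ᵥ incoming c) - outgoing c ⬝ᵥ outgoing c) / 2
        + (1 - ε) / 2 * ‖v.1‖ ^ 2
        - ⟪mulOp (P.energyWeight ε) v.1, mulOp P.Lam1 v.1⟫ := by
  obtain ⟨hp, hcv⟩ := isH1_iff.mp hc
  have hg : ∀ i, IsPrim (fun s => weight ε i s * (c s i * c s i))
      (fun s => sgn i * (1 - ε) * (c s i * c s i)
        + weight ε i s * (f s i * c s i + c s i * f s i)) :=
    fun i => (isPrim_weight ε i).mul ((hp i).mul (hp i))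
  have hbd : ∀ i, ∫ s in Ioo (0 : ℝ) 1,
      (mulOp (P.energyWeight ε) v.1 s i * (v'.1 + mulOp P.Lam1 v.1 : L2 ℓ r) s i
        - (1 - ε) / 2 * (v.1 s i * v.1 s i))
      = (ε * (incoming c i * incoming c i) - outgoing c i * outgoing c i) / 2 := by
    intro i
    have h1 : ∫ s in Ioo (0 : ℝ) 1,
      (mulOp (P.energyWeight ε) v.1 s i * (v'.1 + mulOp P.Lam1 v.1 : L2 ℓ r) s i
        - (1 - ε) / 2 * (v.1 s i * v.1 s i))
        -- The factor `-sgn i / 2` matches the derivative of `weight * c²` with the energy density.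
        -- The derivative of the weight produces the term with `(1 - ε) / 2`.
        = ∫ s in Ioo (0 : ℝ) 1, (-(sgn i) / 2) * (sgn i * (1 - ε) * (c s i * c s i)
        + weight ε i s * (f s i * c s i + c s i * f s i)) := by
      refine integral_congr_ae ?_
      filter_upwards [P.energyWeight_coe ε v.1, L2.coe_add v'.1 (mulOp P.Lam1 v.1),
        mulOp_coe P.continuousOn_Lam1 v.1, he, hcv, ae_restrict_mem measurableSet_Ioo]
        with s h2 h3 h4 h5 h6 hs
      have h7 := congrFun h5 i
      simp only [Pi.add_apply, Pi.zero_apply] at h7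
      rw [Lam0, Matrix.mulVec_diagonal] at h7
      rw [h2, h3, Pi.add_apply, h4]
      have h8 : v'.1 s i + (P.Lam1 s).mulVec (v.1 s).ofLp i = -(P.lam i s * f s i) := by
        linarith
      rw [h8, h6]
      have hs' := Ioo_subset_Icc_self hs
      have hl := P.lam_ne_zero i hs'
      have hsg := sgn_mul_self i
      have hsn : sgn i ≠ 0 := fun h => by rw [h] at hsg; simp at hsg
      have hinv : (sgn i)⁻¹ = sgn i := inv_eq_of_mul_eq_one_left hsg
      have : weight ε i s / (sgn i * P.lam i s) * c s i * -(P.lam i s * f s i)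
          = -(sgn i * weight ε i s * c s i * f s i) := by
        rw [div_eq_mul_inv, mul_inv, hinv]
        field_simp
      rw [this]
      linear_combination (-(1 - ε) / 2 * (c s i * c s i)) * (-1 : ℝ) * hsg
    rw [h1, integral_const_mul, (hg i).eq_sub]
    rcases i with i | i
    · simp [sgn, weight, incoming, outgoing]; ring
    · simp [sgn, weight, incoming, outgoing]; ring
  have hsplit : ⟪mulOp (P.energyWeight ε) v.1, v'.1 + mulOp P.Lam1 v.1⟫
      - (1 - ε) / 2 * ‖v.1‖ ^ 2
      = (ε * (incoming c ⬝ᵥ incoming c) - outgoing c ⬝ᵥ outgoing c) / 2 := by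
    rw [← real_inner_self_eq_norm_sq, L2.inner_eq_sum, L2.inner_eq_sum, Finset.mul_sum,
      ← Finset.sum_sub_distrib]
    have : ∀ i, (∫ s in Ioo (0 : ℝ) 1,
        mulOp (P.energyWeight ε) v.1 s i * (v'.1 + mulOp P.Lam1 v.1 : L2 ℓ r) s i)
        - (1 - ε) / 2 * ∫ s in Ioo (0 : ℝ) 1, v.1 s i * v.1 s i
        = (ε * (incoming c i * incoming c i) - outgoing c i * outgoing c i) / 2 := by
      intro i
      rw [← hbd i, integral_sub (L2.integrable_eval_mul _ _ _ _)
        ((L2.integrable_eval_mul _ _ _ _).const_mul _), integral_const_mul]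
    rw [Finset.sum_congr rfl fun i _ => this i]
    simp only [dotProduct, Finset.mul_sum, ← Finset.sum_sub_distrib, ← Finset.sum_div]
  rw [inner_add_right] at hsplit
  linarith

end Plant

/-- Cauchy–Schwarz in each row; the constant is the squared Hilbert–Schmidt norm. -/
theorem mulVec_dotProduct_self_le {n p : Type*} [Fintype n] [Fintype p] (A : Matrix n p ℝ)
    (x : p → ℝ) : A.mulVec x ⬝ᵥ A.mulVec x ≤ (∑ i, ∑ j, A i j ^ 2) * (x ⬝ᵥ x) := by
  simp only [dotProduct, Finset.sum_mul]
  refine Finset.sum_le_sum fun i _ => ?_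
  have := Finset.sum_mul_sq_le_sq_mul_sq Finset.univ (A i) x
  simp only [Matrix.mulVec, dotProduct]
  rw [← sq]
  refine this.trans (le_of_eq ?_)
  rw [Finset.sum_mul]
  exact Finset.sum_congr rfl fun j _ => by simp [sq]

theorem exists_mulVec_add_bound {n p q : Type*} [Fintype n] [Fintype p] [Fintype q]
    (A : Matrix n p ℝ) (B : Matrix n q ℝ) : ∃ C, 0 ≤ C ∧ ∀ x y,
      (A.mulVec x + B.mulVec y) ⬝ᵥ (A.mulVec x + B.mulVec y) ≤ C * (x ⬝ᵥ x + y ⬝ᵥ y) := by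
  set a := ∑ i, ∑ j, A i j ^ 2
  set b := ∑ i, ∑ j, B i j ^ 2
  have ha : 0 ≤ a := by positivity
  have hb : 0 ≤ b := by positivity
  refine ⟨2 * (a + b), by positivity, fun x y => ?_⟩
  have h1 := mulVec_dotProduct_self_le A x
  have h2 := mulVec_dotProduct_self_le B y
  have h3 : (A.mulVec x + B.mulVec y) ⬝ᵥ (A.mulVec x + B.mulVec y)
      ≤ 2 * (A.mulVec x ⬝ᵥ A.mulVec x) + 2 * (B.mulVec y ⬝ᵥ B.mulVec y) := by
    simp only [dotProduct, Finset.mul_sum, ← Finset.sum_add_distrib]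
    refine Finset.sum_le_sum fun i _ => ?_
    simp only [Pi.add_apply]
    nlinarith [sq_nonneg (A.mulVec x i - B.mulVec y i)]
  have hx : 0 ≤ x ⬝ᵥ x := Finset.sum_nonneg fun i _ => mul_self_nonneg _
  have hy : 0 ≤ y ⬝ᵥ y := Finset.sum_nonneg fun i _ => mul_self_nonneg _
  nlinarith [mul_nonneg ha hy, mul_nonneg hb hx]

/-! ## Energy -/

theorem euclidean_inner_eq {k : ℕ} (x y : EuclideanSpace ℝ (Fin k)) :
    ⟪x, y⟫ = x.ofLp ⬝ᵥ y.ofLp := by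
  simp [PiLp.inner_apply, dotProduct, mul_comm]

/-- The energy form with density `Q`. -/
def energyForm (Q : L2 ℓ r →L[ℝ] L2 ℓ r) (x y : State ℓ r m) : ℝ := ⟪Q x.1, y.1⟫ + ⟪x.2, y.2⟫

/-- `Q` is a symmetric coercive density for which the homogeneous closed loop is dissipative up to
the shift `ω`. -/
structure IsEnergy (G : Submodule ℝ (State ℓ r m × State ℓ r m)) (Q : L2 ℓ r →L[ℝ] L2 ℓ r)
    (κ ω : ℝ) : Prop where
  κ_pos : 0 < κ
  ω_pos : 0 < ω
  symm : ∀ f g, ⟪Q f, g⟫ = ⟪Q g, f⟫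
  lower : ∀ f, κ * ‖f‖ ^ 2 ≤ ⟪Q f, f⟫
  dissipative : ∀ p ∈ G, energyForm Q p.1 p.2 ≤ ω * energyForm Q p.1 p.1

/-- Write `ι`, `o`, `z`, `z'` for the squared norms of incoming trace, outgoing trace, `z` and
`z_t`. The boundary contribution is `(ε ι - o) / 2`, and `ι ≤ C₁ (o + z)`. For small `ε` it is at
most `(z - o) / 4`, and the remaining `-o / 4` absorbs the trace part of the product of `z` and
`z_t`. What is left is bounded by the energy. -/
theorem Plant.exists_isEnergy (P : Plant ℓ r m) (ki : ℝ) (Ki : Matrix (Fin m) (Fin m) ℝ) :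
    ∃ Q κ ω, IsEnergy (P.genGraph ki Ki) Q κ ω := by
  obtain ⟨C₁, hC₁, hb₁⟩ := exists_mulVec_add_bound P.K (P.B * (ki • Ki))
  obtain ⟨C₂, hC₂, hb₂⟩ := exists_mulVec_add_bound P.L₁ P.L₂
  -- Chosen so that `ε C₁ ≤ 1/2`.
  set ε : ℝ := 1 / (2 * (C₁ + 1)) with hε
  have hε0 : 0 < ε := by positivity
  have hε1 : ε ≤ 1 := by
    rw [hε, div_le_one (by positivity)]; linarith
  obtain ⟨κ, hκ, hlow⟩ := P.exists_energy_lower hε0 hε1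
  set Q := mulOp (P.energyWeight ε)
  -- Since `ι + o ≤ (C₁ + 1)(o + z)`, the output satisfies `z' ≤ D (o + z)`.
  set D : ℝ := C₂ * (C₁ + 1)
  have hD : 0 ≤ D := by positivity
  set N : ℝ := 1 / 2 + ‖Q‖ * ‖mulOp P.Lam1‖
  have hN : 0 < N := by positivity
  refine ⟨Q, κ, D + 2 + N / κ, hκ, by positivity, P.energy_symm ε, hlow, ?_⟩
  rintro ⟨v, v'⟩ ⟨f, c, hc, hbc, he, hz⟩
  simp only at hc hbc he hz
  have hid := P.energy_identity ε hc he
  have hin : incoming c ⬝ᵥ incoming c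
      ≤ C₁ * (outgoing c ⬝ᵥ outgoing c + v.2.ofLp ⬝ᵥ v.2.ofLp) := by
    have := hb₁ (outgoing c) v.2.ofLp
    rw [← Matrix.mulVec_mulVec, Matrix.smul_mulVec] at this
    have e : incoming c = P.K.mulVec (outgoing c) + P.B.mulVec (ki • Ki.mulVec v.2.ofLp) := by
      have := hbc
      simp only [BoundaryCondition, zeroExo, add_zero] at this
      exact this
    rwa [← e] at this
  have hz' : v'.2.ofLp ⬝ᵥ v'.2.ofLp
      ≤ C₂ * (incoming c ⬝ᵥ incoming c + outgoing c ⬝ᵥ outgoing c) := by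
    have e : v'.2.ofLp = P.L₁.mulVec (incoming c) + P.L₂.mulVec (outgoing c) := by
      simpa [output, zeroExo] using hz
    rw [e]; exact hb₂ _ _
  -- Young's inequality, weighted so that the part with `z'` costs at most `(o + z) / 4`, exactly
  -- what the boundary term pays for.
  have hzz : ⟪v.2, v'.2⟫ ≤ (1 / (2 * (2 * (D + 1)))) * (v'.2.ofLp ⬝ᵥ v'.2.ofLp)
      + (D + 1) * (v.2.ofLp ⬝ᵥ v.2.ofLp) := by
    rw [euclidean_inner_eq]
    simp only [dotProduct, Finset.mul_sum, ← Finset.sum_add_distrib]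
    refine Finset.sum_le_sum fun i _ => ?_
    set a := v.2.ofLp i
    set b := v'.2.ofLp i
    have hp : (0 : ℝ) < 2 * (D + 1) := by positivity
    have h2 := div_nonneg (sq_nonneg (b - 2 * (D + 1) * a))
      (show (0 : ℝ) ≤ 2 * (2 * (D + 1)) by positivity)
    have : (b - 2 * (D + 1) * a) ^ 2 / (2 * (2 * (D + 1)))
        = 1 / (2 * (2 * (D + 1))) * (b * b) + (D + 1) * (a * a) - a * b := by
      field_simp; ring
    linarith
  have hout : 0 ≤ outgoing c ⬝ᵥ outgoing c := Finset.sum_nonneg fun i _ => mul_self_nonneg _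
  have hzn : 0 ≤ v.2.ofLp ⬝ᵥ v.2.ofLp := Finset.sum_nonneg fun i _ => mul_self_nonneg _
  set o := outgoing c ⬝ᵥ outgoing c
  set ι := incoming c ⬝ᵥ incoming c
  set z := v.2.ofLp ⬝ᵥ v.2.ofLp with hzdef
  set z' := v'.2.ofLp ⬝ᵥ v'.2.ofLp
  have b1 : ε * ι ≤ (o + z) / 2 := by
    have : ε * ι ≤ ε * (C₁ * (o + z)) := mul_le_mul_of_nonneg_left hin hε0.le
    have h2 : ε * C₁ ≤ 1 / 2 := by
      rw [hε, div_mul_eq_mul_div, div_le_div_iff₀ (by positivity) (by norm_num)]; linarith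
    nlinarith
  have b2 : 1 / (2 * (2 * (D + 1))) * z' ≤ (o + z) / 4 := by
    have h1 : z' ≤ (D + 1) * (o + z) := by
      have h3 : C₂ * (ι + o) ≤ C₂ * ((C₁ + 1) * (o + z)) :=
        mul_le_mul_of_nonneg_left (by nlinarith) hC₂
      have h4 : C₂ * ((C₁ + 1) * (o + z)) = D * (o + z) := by simp only [D]; ring
      nlinarith
    calc 1 / (2 * (2 * (D + 1))) * z' ≤ 1 / (2 * (2 * (D + 1))) * ((D + 1) * (o + z)) := by
          gcongr
      _ = (o + z) / 4 := by field_simp; ring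
  have b3 : -⟪Q v.1, mulOp P.Lam1 v.1⟫ ≤ ‖Q‖ * ‖mulOp P.Lam1‖ * ‖v.1‖ ^ 2 := by
    have h1 := abs_real_inner_le_norm (Q v.1) (mulOp P.Lam1 v.1)
    have h2 : ‖Q v.1‖ * ‖mulOp P.Lam1 v.1‖ ≤ (‖Q‖ * ‖v.1‖) * (‖mulOp P.Lam1‖ * ‖v.1‖) := by
      gcongr
      · exact Q.le_opNorm _
      · exact (mulOp P.Lam1).le_opNorm _
    have h3 := neg_abs_le ⟪Q v.1, mulOp P.Lam1 v.1⟫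
    nlinarith
  have b4 : (1 - ε) / 2 * ‖v.1‖ ^ 2 ≤ 1 / 2 * ‖v.1‖ ^ 2 := by
    gcongr; linarith
  have b5 := hlow v.1
  have hfin : energyForm Q v v = ⟪Q v.1, v.1⟫ + z := by
    rw [energyForm, euclidean_inner_eq]
  have hn : 0 ≤ ‖v.1‖ ^ 2 := by positivity
  have b6 : N * ‖v.1‖ ^ 2 ≤ N / κ * ⟪Q v.1, v.1⟫ := by
    calc N * ‖v.1‖ ^ 2 = N / κ * (κ * ‖v.1‖ ^ 2) := by field_simp
      _ ≤ _ := by gcongr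
  have b7 : 0 ≤ ⟪Q v.1, v.1⟫ := le_trans (by positivity) b5
  have b8 : energyForm Q v v' ≤ N * ‖v.1‖ ^ 2 + (D + 2) * z := by
    rw [energyForm, hid]
    have : N * ‖v.1‖ ^ 2 = 1 / 2 * ‖v.1‖ ^ 2 + ‖Q‖ * ‖mulOp P.Lam1‖ * ‖v.1‖ ^ 2 := by
      simp only [N]; ring
    linarith
  have hNκ : 0 ≤ N / κ := by positivity
  simp only
  rw [hfin]
  nlinarith [mul_nonneg hNκ hzn, mul_nonneg hD b7]

/-! ### Consequences of dissipativity in the energy -/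

namespace IsEnergy

variable {G : Submodule ℝ (State ℓ r m × State ℓ r m)} {Q : L2 ℓ r →L[ℝ] L2 ℓ r} {κ ω : ℝ}

theorem form_symm (h : IsEnergy G Q κ ω) (x y : State ℓ r m) :
    energyForm Q x y = energyForm Q y x := by
  rw [energyForm, energyForm, h.symm, real_inner_comm x.2]

theorem form_nonneg (h : IsEnergy G Q κ ω) (x : State ℓ r m) : 0 ≤ energyForm Q x x := by
  have h1 := h.lower x.1
  have h2 : 0 ≤ κ * ‖x.1‖ ^ 2 := mul_nonneg h.κ_pos.le (by positivity)
  have h3 : 0 ≤ ⟪x.2, x.2⟫ := real_inner_self_nonneg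
  rw [energyForm]; linarith

/-- The state space carries the maximum norm of the product, which is not Hilbertian. The energy is
therefore kept as a separate form and compared with the norm from both sides. -/
theorem norm_sq_le_form (h : IsEnergy G Q κ ω) (x : State ℓ r m) :
    min κ 1 * ‖x‖ ^ 2 ≤ energyForm Q x x := by
  have h1 := h.lower x.1
  have h3 : ⟪x.2, x.2⟫ = ‖x.2‖ ^ 2 := real_inner_self_eq_norm_sq _
  rw [energyForm, h3]
  have hm : 0 < min κ 1 := lt_min h.κ_pos one_pos
  have h4 := sq_nonneg ‖x.1‖
  have h5 := sq_nonneg ‖x.2‖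
  rw [Prod.norm_def]
  rcases max_cases ‖x.1‖ ‖x.2‖ with ⟨e, _⟩ | ⟨e, _⟩ <;> rw [e]
  · nlinarith [min_le_left κ 1]
  · nlinarith [min_le_right κ 1, mul_nonneg h.κ_pos.le h4]

theorem form_le (x : State ℓ r m) : energyForm Q x x ≤ (‖Q‖ + 1) * ‖x‖ ^ 2 := by
  have h1 : ⟪Q x.1, x.1⟫ ≤ ‖Q‖ * ‖x‖ ^ 2 := by
    have a1 := real_inner_le_norm (Q x.1) x.1
    have a2 : ‖x.1‖ ≤ ‖x‖ := norm_fst_le x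
    have a3 : ‖Q x.1‖ * ‖x.1‖ ≤ (‖Q‖ * ‖x‖) * ‖x‖ := by
      gcongr
      exact (Q.le_opNorm _).trans (by gcongr)
    nlinarith
  have h2 : ⟪x.2, x.2⟫ ≤ ‖x‖ ^ 2 := by
    rw [real_inner_self_eq_norm_sq]
    have : ‖x.2‖ ≤ ‖x‖ := norm_snd_le x
    gcongr
  rw [energyForm]; linarith

theorem eq_zero_of_form (h : IsEnergy G Q κ ω) {x : State ℓ r m}
    (hx : energyForm Q x x ≤ 0) : x = 0 := by
  have h1 := h.norm_sq_le_form x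
  have hm : 0 < min κ 1 := lt_min h.κ_pos one_pos
  have h2 : ‖x‖ ^ 2 ≤ 0 := by
    by_contra hc
    push Not at hc
    nlinarith [mul_pos hm hc]
  have h3 : ‖x‖ = 0 := by nlinarith [norm_nonneg x]
  exact norm_eq_zero.mp h3

/-- The expansivity of `λ - A` in the energy. -/
theorem form_resolvent_le (h : IsEnergy G Q κ ω) {x y : State ℓ r m} (hxy : (x, y) ∈ G) {a : ℝ}
    (ha : 0 ≤ a) :
    a ^ 2 * energyForm Q x x ≤ energyForm Q ((a + ω) • x - y) ((a + ω) • x - y) := by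
  have h1 := h.dissipative _ hxy
  simp only at h1
  -- With `(a + ω) x - y = a x + (ω x - y)`, the square of the second summand is nonnegative and the
  -- cross term is nonnegative by dissipativity.
  have h2 := h.form_nonneg (ω • x - y)
  have e1 : energyForm Q ((a + ω) • x - y) ((a + ω) • x - y)
      = (a + ω) ^ 2 * energyForm Q x x - (a + ω) * energyForm Q x y
        - (a + ω) * energyForm Q y x + energyForm Q y y := by
    simp only [energyForm, Prod.fst_sub, Prod.snd_sub, Prod.smul_fst, Prod.smul_snd, map_sub,
      map_smul, inner_sub_left, inner_sub_right, real_inner_smul_left, real_inner_smul_right]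
    ring
  have e2 : energyForm Q (ω • x - y) (ω • x - y)
      = ω ^ 2 * energyForm Q x x - ω * energyForm Q x y
        - ω * energyForm Q y x + energyForm Q y y := by
    simp only [energyForm, Prod.fst_sub, Prod.snd_sub, Prod.smul_fst, Prod.smul_snd, map_sub,
      map_smul, inner_sub_left, inner_sub_right, real_inner_smul_left, real_inner_smul_right]
    ring
  rw [e2] at h2
  rw [e1]
  have e3 := h.form_symm x y
  rw [← e3] at h2 ⊢
  nlinarith [mul_nonneg ha (sub_nonneg.mpr h1)]

/-- A solution of the homogeneous equation that vanishes initially vanishes. -/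
theorem eq_zero_of_solution (h : IsEnergy G Q κ ω) {V V' : ℝ → State ℓ r m} (h0 : V 0 = 0)
    (hd : ∀ t ∈ Ici (0 : ℝ), HasDerivWithinAt V (V' t) (Ici 0) t)
    (hG : ∀ t ∈ Ici (0 : ℝ), (V t, V' t) ∈ G) : ∀ t ∈ Ici (0 : ℝ), V t = 0 := by
  have hE : ∀ t ∈ Ici (0 : ℝ), HasDerivWithinAt (fun t => energyForm Q (V t) (V t))
      (2 * energyForm Q (V t) (V' t)) (Ici 0) t := by
    intro t ht
    have h1 : HasDerivWithinAt (fun t => (V t).1) (V' t).1 (Ici 0) t :=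
      (ContinuousLinearMap.fst ℝ (L2 ℓ r) (EuclideanSpace ℝ (Fin m))).hasFDerivAt.comp_hasDerivWithinAt
        t (hd t ht)
    have h2 : HasDerivWithinAt (fun t => (V t).2) (V' t).2 (Ici 0) t :=
      (ContinuousLinearMap.snd ℝ (L2 ℓ r) (EuclideanSpace ℝ (Fin m))).hasFDerivAt.comp_hasDerivWithinAt
        t (hd t ht)
    have h3 : HasDerivWithinAt (fun t => Q (V t).1) (Q (V' t).1) (Ici 0) t :=
      Q.hasFDerivAt.comp_hasDerivWithinAt t h1
    have h4 := (h3.inner ℝ h1).add (h2.inner ℝ h2)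
    refine h4.congr_deriv ?_
    have := h.form_symm (V t) (V' t)
    simp only [energyForm] at this ⊢
    linarith
  -- By dissipativity, `exp(-2ωt)` times the energy is nonincreasing; it starts at zero and is
  -- nonnegative.
  have hF : ∀ t ∈ Ici (0 : ℝ), HasDerivWithinAt
      (fun t => Real.exp (-(2 * ω) * t) * energyForm Q (V t) (V t))
      (Real.exp (-(2 * ω) * t) * (2 * energyForm Q (V t) (V' t)
        - 2 * ω * energyForm Q (V t) (V t))) (Ici 0) t := by
    intro t ht
    have h1 : HasDerivAt (fun t : ℝ => Real.exp (-(2 * ω) * t))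
        (Real.exp (-(2 * ω) * t) * (-(2 * ω))) t := by
      simpa using ((hasDerivAt_id t).const_mul (-(2 * ω))).exp
    refine (h1.hasDerivWithinAt.mul (hE t ht)).congr_deriv ?_
    ring
  have hanti : AntitoneOn (fun t => Real.exp (-(2 * ω) * t) * energyForm Q (V t) (V t))
      (Ici 0) := by
    refine antitoneOn_of_deriv_nonpos (convex_Ici 0) (fun t ht => (hF t ht).continuousWithinAt)
      ?_ ?_
    · intro t ht
      rw [interior_Ici] at ht
      rw [interior_Ici]
      exact ((hF t (Ioi_subset_Ici_self ht)).mono Ioi_subset_Ici_self).differentiableWithinAt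
    · intro t ht
      rw [interior_Ici] at ht
      have := (hF t (Ioi_subset_Ici_self ht)).hasDerivAt (Ici_mem_nhds ht)
      rw [this.deriv]
      have h1 := h.dissipative _ (hG t (Ioi_subset_Ici_self ht))
      simp only at h1
      exact mul_nonpos_of_nonneg_of_nonpos (Real.exp_pos _).le (by linarith)
  intro t ht
  refine h.eq_zero_of_form ?_
  have := hanti (mem_Ici.mpr le_rfl) ht ht
  simp only [h0] at this
  have e : energyForm Q (0 : State ℓ r m) 0 = 0 := by simp [energyForm]
  rw [e, mul_zero] at this
  exact nonpos_of_mul_nonpos_right this (Real.exp_pos _)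

end IsEnergy

/-! ## Stationary profiles -/

/-! ### Linear integral equations -/

theorem exists_mulVec_lipschitz {M : ℝ → Matrix (Idx ℓ r) (Idx ℓ r) ℝ}
    (hM : ∀ i j, ContinuousOn (fun s => M s i j) (Icc 0 1)) :
    ∃ C, 0 ≤ C ∧ ∀ x ∈ Icc (0 : ℝ) 1, ∀ u v : Idx ℓ r → ℝ,
      ‖(M x).mulVec u - (M x).mulVec v‖ ≤ C * ‖u - v‖ := by
  have hb : ∀ i j, ∃ C, ∀ x ∈ Icc (0 : ℝ) 1, ‖M x i j‖ ≤ C := fun i j =>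
    isCompact_Icc.exists_bound_of_continuousOn (hM i j)
  choose C hC using hb
  refine ⟨∑ i, ∑ j, |C i j|, by positivity, fun x hx u v => ?_⟩
  rw [← Matrix.mulVec_sub, pi_norm_le_iff_of_nonneg (by positivity)]
  intro i
  have h1 : ‖(M x).mulVec (u - v) i‖ ≤ ∑ j, |C i j| * ‖u - v‖ := by
    simp only [Matrix.mulVec, dotProduct]
    refine norm_sum_le_of_le _ fun j _ => ?_
    rw [norm_mul]
    exact mul_le_mul ((hC i j x hx).trans (le_abs_self _)) (norm_le_pi_norm _ j)
      (norm_nonneg _) (abs_nonneg _)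
  refine h1.trans ?_
  rw [← Finset.sum_mul]
  refine mul_le_mul_of_nonneg_right ?_ (norm_nonneg _)
  exact Finset.single_le_sum (f := fun i => ∑ j, |C i j|) (fun i _ => by positivity)
    (Finset.mem_univ i)

theorem continuousOn_mulVec {M : ℝ → Matrix (Idx ℓ r) (Idx ℓ r) ℝ}
    (hM : ∀ i j, ContinuousOn (fun s => M s i j) (Icc 0 1)) {c : ℝ → Idx ℓ r → ℝ}
    (hc : ∀ i, ContinuousOn (fun s => c s i) (Icc 0 1)) (i : Idx ℓ r) :
    ContinuousOn (fun s => (M s).mulVec (c s) i) (Icc 0 1) := by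
  simp only [Matrix.mulVec, dotProduct]
  exact continuousOn_finsetSum _ fun j _ => (hM i j).mul (hc j)

theorem intervalIntegral_apply {f : ℝ → Idx ℓ r → ℝ} {s : ℝ}
    (hf : IntervalIntegrable f volume 0 s) (i : Idx ℓ r) :
    (∫ x in (0 : ℝ)..s, f x) i = ∫ x in (0 : ℝ)..s, f x i :=
  ((ContinuousLinearMap.proj (R := ℝ) (φ := fun _ : Idx ℓ r => ℝ) i).intervalIntegral_comp_comm
    hf).symm

/-- The forcing is only a primitive of an integrable function because the right-hand side of the
resolvent equation is merely in `L²`; hence an integral equation and not a classical ODE. -/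
theorem exists_linear_integral_eq {M : ℝ → Matrix (Idx ℓ r) (Idx ℓ r) ℝ}
    (hM : ∀ i j, ContinuousOn (fun s => M s i j) (Icc 0 1)) {F g : ℝ → Idx ℓ r → ℝ}
    (hF : ∀ i, IsPrim (fun s => F s i) (fun s => g s i)) :
    ∃ c : ℝ → Idx ℓ r → ℝ, c 0 = F 0 ∧
      ∀ i, IsPrim (fun s => c s i) (fun s => g s i + (M s).mulVec (c s) i) := by
  have h01 : (0 : ℝ) ≤ 1 := zero_le_one
  -- Projection onto `[0,1]` extends the data continuously to `ℝ`, as `exists_integral_eq` requires.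
  let M' : ℝ → Matrix (Idx ℓ r) (Idx ℓ r) ℝ := fun s => M (projIcc 0 1 h01 s)
  let F' : ℝ → Idx ℓ r → ℝ := fun s => F (projIcc 0 1 h01 s)
  have hpc : Continuous fun s : ℝ => ((projIcc 0 1 h01 s : Icc (0 : ℝ) 1) : ℝ) :=
    continuous_subtype_val.comp continuous_projIcc
  have hpe : ∀ s ∈ Icc (0 : ℝ) 1, ((projIcc 0 1 h01 s : Icc (0 : ℝ) 1) : ℝ) = s := fun s hs => by
    rw [projIcc_of_mem h01 hs]
  have hM' : Continuous M' := by
    refine continuous_pi fun i => continuous_pi fun j => ?_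
    exact (hM i j).comp_continuous hpc fun s => (projIcc 0 1 h01 s).2
  have hF' : Continuous F' := continuous_pi fun i =>
    (hF i).continuousOn.comp_continuous hpc fun s => (projIcc 0 1 h01 s).2
  obtain ⟨C, hC, hL⟩ := exists_mulVec_lipschitz hM
  have hf : Continuous fun p : ℝ × (Idx ℓ r → ℝ) => (M' p.1).mulVec p.2 :=
    (hM'.comp continuous_fst).matrix_mulVec continuous_snd
  obtain ⟨c, hc, hce⟩ := exists_integral_eq (f := fun s u => (M' s).mulVec u) hf hC
    (fun x hx u v => by simp only [M', hpe x hx]; exact hL x hx u v) hF'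
  have hMc : Continuous fun x => (M' x).mulVec (c x) := hf.comp (continuous_id.prodMk hc)
  have hce' : ∀ s ∈ Icc (0 : ℝ) 1, ∀ i,
      c s i = F s i + ∫ x in (0 : ℝ)..s, (M x).mulVec (c x) i := by
    intro s hs i
    rw [hce s hs, Pi.add_apply, intervalIntegral_apply (hMc.intervalIntegrable _ _)]
    simp only [F', hpe s hs]
    congr 1
    refine intervalIntegral.integral_congr fun x hx => ?_
    rw [uIcc_of_le hs.1] at hx
    simp only [M', hpe x ⟨hx.1, hx.2.trans hs.2⟩]
  have h0 : c 0 = F 0 := by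
    funext i
    rw [hce' 0 ⟨le_rfl, zero_le_one⟩ i]; simp
  refine ⟨c, h0, fun i => ?_⟩
  have hi : IntervalIntegrable (fun s => (M s).mulVec (c s) i) volume 0 1 := by
    refine ContinuousOn.intervalIntegrable ?_
    rw [uIcc_of_le zero_le_one]
    exact continuousOn_mulVec hM (fun i => ((continuous_apply i).comp hc).continuousOn) i
  refine ⟨(hF i).1.add hi, fun s hs => ?_⟩
  rw [intervalIntegral.integral_add (IsPrim.mono_integrable (hF i).1 hs)
    (IsPrim.mono_integrable hi hs)]
  have h1 := (hF i).2 s hs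
  beta_reduce at h1 ⊢
  rw [hce' s hs i, h0, h1]
  ring

theorem linear_ode_unique {M : ℝ → Matrix (Idx ℓ r) (Idx ℓ r) ℝ}
    (hM : ∀ i j, ContinuousOn (fun s => M s i j) (Icc 0 1)) {c d : ℝ → Idx ℓ r → ℝ}
    (hc : ∀ i, IsPrim (fun s => c s i) (fun s => (M s).mulVec (c s) i))
    (hd : ∀ i, IsPrim (fun s => d s i) (fun s => (M s).mulVec (d s) i))
    (h0 : c 0 = d 0) : EqOn c d (Icc 0 1) := by
  obtain ⟨C, hC, hL⟩ := exists_mulVec_lipschitz hM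
  have hcont : ∀ {c : ℝ → Idx ℓ r → ℝ},
      (∀ i, IsPrim (fun s => c s i) (fun s => (M s).mulVec (c s) i)) →
      ContinuousOn (fun x => (M x).mulVec (c x)) (Icc 0 1) := fun hc =>
    continuousOn_pi.mpr fun i => continuousOn_mulVec hM (fun j => (hc j).continuousOn) i
  have heq : ∀ {c : ℝ → Idx ℓ r → ℝ},
      (∀ i, IsPrim (fun s => c s i) (fun s => (M s).mulVec (c s) i)) →
      ∀ s ∈ Icc (0 : ℝ) 1, c s = c 0 + ∫ x in (0 : ℝ)..s, (M x).mulVec (c x) := by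
    intro c hc s hs
    funext i
    rw [Pi.add_apply, intervalIntegral_apply]
    · exact (hc i).2 s hs
    refine ContinuousOn.intervalIntegrable ((hcont hc).mono ?_)
    rw [uIcc_of_le hs.1]; exact Icc_subset_Icc le_rfl hs.2
  refine eqOn_of_integral_eq (f := fun s u => (M s).mulVec u) (F := fun _ => c 0) hL
    (hcont hc) (hcont hd) (heq hc) ?_
  rw [h0]; exact heq hd

theorem IsPrim.hasDerivWithinAt {u f : ℝ → ℝ} (h : IsPrim u f)
    (hf : ContinuousOn f (Icc 0 1)) {s : ℝ} (hs : s ∈ Icc (0 : ℝ) 1) :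
    HasDerivWithinAt u (f s) (Icc 0 1) s := by
  have : Fact (s ∈ Icc (0 : ℝ) 1) := ⟨hs⟩
  have h1 := intervalIntegral.integral_hasDerivWithinAt_right (s := Icc (0 : ℝ) 1)
    (t := Icc (0 : ℝ) 1) (IsPrim.mono_integrable h.1 hs)
    (hf.stronglyMeasurableAtFilter_nhdsWithin measurableSet_Icc s) (hf s hs)
  exact (h1.const_add (u 0)).congr h.2 (h.2 s hs)

/-- Fundamental matrix of `c' = M c`. -/
theorem exists_fundamental {M : ℝ → Matrix (Idx ℓ r) (Idx ℓ r) ℝ}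
    (hM : ∀ i j, ContinuousOn (fun s => M s i j) (Icc 0 1)) :
    ∃ Φ : ℝ → Matrix (Idx ℓ r) (Idx ℓ r) ℝ, Φ 0 = 1 ∧
      ∀ i j, IsPrim (fun s => Φ s i j) (fun s => (M s * Φ s) i j) := by
  -- The columns solve the system with unit initial vectors.
  have : ∀ j : Idx ℓ r, ∃ c : ℝ → Idx ℓ r → ℝ, c 0 = Pi.single j 1 ∧
      ∀ i, IsPrim (fun s => c s i) (fun s => (M s).mulVec (c s) i) := by
    intro j
    obtain ⟨c, h0, hc⟩ := exists_linear_integral_eq hM (F := fun _ => Pi.single j 1)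
      (g := fun _ => 0) (fun i => IsPrim.const _)
    refine ⟨c, h0, fun i => ?_⟩
    simpa using hc i
  choose c h0 hc using this
  refine ⟨fun s => Matrix.of fun i j => c j s i, ?_, fun i j => ?_⟩
  · ext i j
    beta_reduce
    rw [Matrix.of_apply, h0, Matrix.one_apply, Pi.single_apply]
  · exact hc j i

theorem isPrim_mulVec {M Φ : ℝ → Matrix (Idx ℓ r) (Idx ℓ r) ℝ}
    (hΦ : ∀ i j, IsPrim (fun s => Φ s i j) (fun s => (M s * Φ s) i j)) (a : Idx ℓ r → ℝ)
    (i : Idx ℓ r) :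
    IsPrim (fun s => (Φ s).mulVec a i) (fun s => (M s).mulVec ((Φ s).mulVec a) i) := by
  have hsum : ∀ t : Finset (Idx ℓ r), IsPrim (fun s => ∑ j ∈ t, a j * Φ s i j)
      (fun s => ∑ j ∈ t, a j * (M s * Φ s) i j) := by
    intro t
    induction t using Finset.induction_on with
    | empty => simpa using IsPrim.const 0
    | insert j t hj ih =>
      simp only [Finset.sum_insert hj]
      exact ((hΦ i j).const_mul (a j)).add ih
  have := hsum Finset.univ
  have e1 : (fun s => (Φ s).mulVec a i) = fun s => ∑ j, a j * Φ s i j := by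
    funext s; simp [Matrix.mulVec, dotProduct, mul_comm]
  have e2 : (fun s => (M s).mulVec ((Φ s).mulVec a) i)
      = fun s => ∑ j, a j * (M s * Φ s) i j := by
    funext s; rw [Matrix.mulVec_mulVec]; simp [Matrix.mulVec, dotProduct, mul_comm]
  rw [e1, e2]; exact this

/-- The identity block of `phiMinus` is the value `Φ 0 = 1` at the left end; the other block row is
read at the right end. -/
theorem incoming_mulVec {Φ : ℝ → Matrix (Idx ℓ r) (Idx ℓ r) ℝ} (h0 : Φ 0 = 1)
    (a : Idx ℓ r → ℝ) : incoming (fun s => (Φ s).mulVec a) = (phiMinus Φ).mulVec a := by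
  funext i
  rcases i with i | i
  · simp [incoming, phiMinus, h0, Matrix.mulVec, dotProduct, Fintype.sum_sum_type,
      Matrix.one_apply]
  · simp [incoming, phiMinus, Matrix.mulVec, dotProduct, Fintype.sum_sum_type,
      Matrix.toBlocks₂₁, Matrix.toBlocks₂₂]

theorem outgoing_mulVec {Φ : ℝ → Matrix (Idx ℓ r) (Idx ℓ r) ℝ} (h0 : Φ 0 = 1)
    (a : Idx ℓ r → ℝ) : outgoing (fun s => (Φ s).mulVec a) = (phiPlus Φ).mulVec a := by
  funext i
  rcases i with i | i
  · simp [outgoing, phiPlus, Matrix.mulVec, dotProduct, Fintype.sum_sum_type,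
      Matrix.toBlocks₁₁, Matrix.toBlocks₁₂]
  · simp [outgoing, phiPlus, h0, Matrix.mulVec, dotProduct, Fintype.sum_sum_type,
      Matrix.one_apply]

theorem isH1_toL2 {c h : ℝ → Idx ℓ r → ℝ}
    (hc : ∀ i, IsPrim (fun s => c s i) (fun s => h s i))
    (hh : ∀ i, MemLp (fun s => h s i) 2 (volume.restrict (Ioo (0 : ℝ) 1))) :
    IsH1 (toL2 c) (toL2 h) c := by
  refine isH1_iff.mpr ⟨fun i => ?_, toL2_coe fun i => (hc i).continuousOn⟩
  refine (hc i).congr (fun _ _ => rfl) ?_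
  filter_upwards [toL2_coe_of_memLp hh] with s hs
  rw [hs]

namespace Plant

variable (P : Plant ℓ r m)

/-- The matrix of the stationary equation `μ φ + Λ₀ φ_s + Λ₁ φ = 0`. -/
def statMat (μ : ℝ) (s : ℝ) : Matrix (Idx ℓ r) (Idx ℓ r) ℝ :=
  Matrix.of fun i j => -((P.lam i s)⁻¹ * (μ * (1 : Matrix (Idx ℓ r) (Idx ℓ r) ℝ) i j
    + P.Lam1 s i j))

theorem continuousOn_inv_lam (i : Idx ℓ r) : ContinuousOn (fun s => (P.lam i s)⁻¹) (Icc 0 1) :=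
  (P.continuousOn_lam i).inv₀ fun _ hs => P.lam_ne_zero i hs

theorem continuousOn_statMat (μ : ℝ) (i j : Idx ℓ r) :
    ContinuousOn (fun s => P.statMat μ s i j) (Icc 0 1) :=
  ((P.continuousOn_inv_lam i).mul (continuousOn_const.add (P.continuousOn_Lam1 i j))).neg

theorem statMat_mulVec (μ s : ℝ) (c : Idx ℓ r → ℝ) (i : Idx ℓ r) :
    (P.statMat μ s).mulVec c i = -((P.lam i s)⁻¹ * (μ * c i + (P.Lam1 s).mulVec c i)) := by
  have h1 : (P.statMat μ s).mulVec c i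
      = -((P.lam i s)⁻¹ * ((μ • (1 : Matrix (Idx ℓ r) (Idx ℓ r) ℝ) + P.Lam1 s).mulVec c i)) := by
    simp only [statMat, Matrix.mulVec, dotProduct, Matrix.of_apply, Matrix.add_apply,
      Matrix.smul_apply, smul_eq_mul, Finset.mul_sum, ← Finset.sum_neg_distrib]
    exact Finset.sum_congr rfl fun j _ => by ring
  rw [h1, Matrix.add_mulVec, Matrix.smul_mulVec, Matrix.one_mulVec]
  simp

theorem lam_mul_statMat_mulVec (μ : ℝ) {s : ℝ} (hs : s ∈ Icc (0 : ℝ) 1) (c : Idx ℓ r → ℝ)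
    (i : Idx ℓ r) :
    P.lam i s * (P.statMat μ s).mulVec c i = -(μ * c i + (P.Lam1 s).mulVec c i) := by
  rw [statMat_mulVec]
  have := P.lam_ne_zero i hs
  field_simp

end Plant

/-! ## The semigroup -/

theorem memLp_add_mul {f : L2 ℓ r} {a b : ℝ → ℝ} {i : Idx ℓ r} (ha : ContinuousOn a (Icc 0 1))
    (hb : ContinuousOn b (Icc 0 1)) :
    MemLp (fun s => a s * f s i + b s) 2 (volume.restrict (Ioo (0 : ℝ) 1)) := by
  refine MemLp.add ?_ (memLp_of_continuousOn hb)
  obtain ⟨C, hC⟩ := isCompact_Icc.exists_bound_of_continuousOn ha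
  refine MemLp.of_le_mul (c := C) (f.memLp_eval i)
    (((ha.mono Ioo_subset_Icc_self).aestronglyMeasurable measurableSet_Ioo).mul
      (f.memLp_eval i).1) ?_
  filter_upwards [ae_restrict_mem measurableSet_Ioo] with s hs
  rw [norm_mul]
  exact mul_le_mul_of_nonneg_right (hC s (Ioo_subset_Icc_self hs)) (norm_nonneg _)

theorem isPrim_primitive {f : ℝ → ℝ} (hf : IntervalIntegrable f volume 0 1) :
    IsPrim (fun s => ∫ x in (0 : ℝ)..s, f x) f :=
  ⟨hf, fun s _ => by simp⟩

/-! ### Resolvent of the generator -/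

namespace Plant

variable (P : Plant ℓ r m) {ki : ℝ} {Ki : Matrix (Fin m) (Fin m) ℝ}

/-- Profiles that solve the differential equation are `Φ b` plus a particular solution. The boundary
condition and the equation for `z` then form a square linear system for `(b, z)`, so injectivity of
its matrix is enough. -/
theorem exists_resolvent_solution {Q : L2 ℓ r →L[ℝ] L2 ℓ r} {κ ω : ℝ}
    (hE : IsEnergy (P.genGraph ki Ki) Q κ ω) {a : ℝ} (ha : 0 < a) (y : State ℓ r m) :
    ∃ x, (x, (a + ω) • x - y) ∈ P.genGraph ki Ki := by
  set μ : ℝ := a + ω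
  have hM := P.continuousOn_statMat μ
  obtain ⟨Φ, hΦ0, hΦ⟩ := exists_fundamental hM
  have hΦc : ∀ b : Idx ℓ r → ℝ, ∀ i, ContinuousOn (fun s => (Φ s).mulVec b i) (Icc 0 1) :=
    fun b i => (isPrim_mulVec hΦ b i).continuousOn
  let LL : (Idx ℓ r → ℝ) × (Fin m → ℝ) →ₗ[ℝ] (Idx ℓ r → ℝ) × (Fin m → ℝ) :=
    { toFun := fun p =>
        ((phiMinus Φ).mulVec p.1 - P.K.mulVec ((phiPlus Φ).mulVec p.1)
            - P.B.mulVec (ki • Ki.mulVec p.2),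
          μ • p.2 - P.L₁.mulVec ((phiMinus Φ).mulVec p.1)
            - P.L₂.mulVec ((phiPlus Φ).mulVec p.1))
      map_add' := fun p q => by
        ext1
        · simp only [Prod.fst_add, Prod.snd_add, Matrix.mulVec_add, smul_add]; abel
        · simp only [Prod.fst_add, Prod.snd_add, Matrix.mulVec_add, smul_add]; abel
      map_smul' := fun b p => by
        ext1
        · simp only [Prod.smul_fst, Prod.smul_snd, Matrix.mulVec_smul, RingHom.id_apply]; module
        · simp only [Prod.smul_fst, Prod.smul_snd, Matrix.mulVec_smul, RingHom.id_apply]; module }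
  -- A kernel vector gives an eigenvector of `A` with eigenvalue `a + ω`, which expansivity in the
  -- energy excludes.
  have hinj : Function.Injective LL := by
    rw [← LinearMap.ker_eq_bot, LinearMap.ker_eq_bot']
    rintro ⟨b, z⟩ hbz
    have h1 : (phiMinus Φ).mulVec b - P.K.mulVec ((phiPlus Φ).mulVec b)
            - P.B.mulVec (ki • Ki.mulVec z) = 0 := congrArg Prod.fst hbz
    have h2 : μ • z - P.L₁.mulVec ((phiMinus Φ).mulVec b)
            - P.L₂.mulVec ((phiPlus Φ).mulVec b) = 0 := congrArg Prod.snd hbz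
    set c : ℝ → Idx ℓ r → ℝ := fun s => (Φ s).mulVec b
    set x : State ℓ r m := (toL2 c, WithLp.toLp 2 z)
    have hx : (x, μ • x) ∈ P.genGraph ki Ki := by
      have hmem : ∀ i, MemLp (fun s => (P.statMat μ s).mulVec (c s) i) 2
          (volume.restrict (Ioo (0 : ℝ) 1)) := fun i =>
        memLp_of_continuousOn (continuousOn_mulVec hM (hΦc b) i)
      refine ⟨toL2 fun s => (P.statMat μ s).mulVec (c s), c,
        isH1_toL2 (fun i => isPrim_mulVec hΦ b i) hmem, ?_, ?_, ?_⟩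
      · have e1 := incoming_mulVec hΦ0 b
        have e2 := outgoing_mulVec hΦ0 b
        simp only [BoundaryCondition, zeroExo, add_zero, x]
        rw [e1, e2]
        rw [sub_sub, sub_eq_zero] at h1
        exact h1
      · have e : (μ • x).1 = μ • toL2 c := rfl
        simp only [e]
        filter_upwards [L2.coe_smul μ (toL2 c), toL2_coe (hΦc b),
          toL2_coe_of_memLp hmem, ae_restrict_mem measurableSet_Ioo] with s h3 h4 h5 hs
        have h4' : (toL2 c s).ofLp = c s := h4
        show ((μ • toL2 c : L2 ℓ r) s).ofLp + _ + (P.Lam1 s).mulVec (toL2 c s).ofLp = 0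
        rw [h3, h4', h5]
        funext i
        simp only [Pi.add_apply, Pi.smul_apply, Pi.zero_apply, smul_eq_mul]
        rw [Lam0, Matrix.mulVec_diagonal,
          P.lam_mul_statMat_mulVec μ (Ioo_subset_Icc_self hs)]
        ring
      · have e1 := incoming_mulVec hΦ0 b
        have e2 := outgoing_mulVec hΦ0 b
        have e : (μ • x).2.ofLp = μ • z := rfl
        simp only [e, output, zeroExo, add_zero, sub_zero]
        rw [e1, e2]
        rw [sub_sub, sub_eq_zero] at h2
        exact h2
    have h3 := hE.form_resolvent_le hx ha.le
    rw [sub_self] at h3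
    have e0 : energyForm Q (0 : State ℓ r m) 0 = 0 := by simp [energyForm]
    rw [e0] at h3
    have hx0 : x = 0 := hE.eq_zero_of_form (nonpos_of_mul_nonpos_right h3 (by positivity))
    have hz : z = 0 := by
      have : x.2 = 0 := by rw [hx0]; rfl
      exact congrArg WithLp.ofLp this
    have hc0 : toL2 c = 0 := by
      have : x.1 = 0 := by rw [hx0]; rfl
      exact this
    have hae : ∀ᵐ s ∂(volume.restrict (Ioo (0 : ℝ) 1)), c s = 0 := by
      filter_upwards [toL2_coe (hΦc b), L2.coe_zero (ℓ := ℓ) (r := r)] with s h4 h5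
      have h4' : (toL2 c s).ofLp = c s := h4
      rw [← h4', hc0, h5]
    -- The profile is known to vanish only almost everywhere; by continuity it vanishes at `0`,
    -- where its value is `b`.
    have hb : b = 0 := by
      have hcc : ContinuousOn c (Icc 0 1) := continuousOn_pi.mpr (hΦc b)
      have hEq : EqOn c 0 (Ioo 0 1) :=
        Measure.eqOn_open_of_ae_eq hae isOpen_Ioo (hcc.mono Ioo_subset_Icc_self)
          continuousOn_const
      have hEq' : EqOn c 0 (Icc 0 1) :=
        hEq.of_subset_closure hcc continuousOn_const Ioo_subset_Icc_self
          (by rw [closure_Ioo zero_ne_one])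
      have := hEq' (show (0 : ℝ) ∈ Icc (0 : ℝ) 1 from ⟨le_rfl, zero_le_one⟩)
      simpa [c, hΦ0] using this
    rw [hz, hb]; rfl
  have hsurj : Function.Surjective LL := LinearMap.injective_iff_surjective.mp hinj
  -- The inhomogeneity after division by `λᵢ`; it is integrable but need not be continuous.
  set g : ℝ → Idx ℓ r → ℝ := fun s i => (P.lam i s)⁻¹ * y.1 s i
  have hgI : ∀ i, IntervalIntegrable (fun s => g s i) volume 0 1 := by
    intro i
    have := memLp_add_mul (f := y.1) (i := i) (P.continuousOn_inv_lam i)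
      (continuousOn_const (c := (0 : ℝ)))
    simp only [add_zero] at this
    exact intervalIntegrable_of_integrable_Ioo (this.integrable (by norm_num))
  obtain ⟨cp, -, hcp⟩ := exists_linear_integral_eq hM
    (F := fun s i => ∫ x in (0 : ℝ)..s, g x i) (fun i => isPrim_primitive (hgI i))
  obtain ⟨⟨b, z⟩, hbz⟩ := hsurj (P.K.mulVec (outgoing cp) - incoming cp,
    y.2.ofLp + P.L₁.mulVec (incoming cp) + P.L₂.mulVec (outgoing cp))
  have h1 : (phiMinus Φ).mulVec b - P.K.mulVec ((phiPlus Φ).mulVec b)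
      - P.B.mulVec (ki • Ki.mulVec z) = P.K.mulVec (outgoing cp) - incoming cp :=
    congrArg Prod.fst hbz
  have h2 : μ • z - P.L₁.mulVec ((phiMinus Φ).mulVec b)
      - P.L₂.mulVec ((phiPlus Φ).mulVec b)
      = y.2.ofLp + P.L₁.mulVec (incoming cp) + P.L₂.mulVec (outgoing cp) :=
    congrArg Prod.snd hbz
  set c : ℝ → Idx ℓ r → ℝ := fun s => (1 : ℝ) • (Φ s).mulVec b + (1 : ℝ) • cp s with hcdef
  have hin : incoming c = (phiMinus Φ).mulVec b + incoming cp := by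
    rw [hcdef, incoming_combine, incoming_mulVec hΦ0, one_smul, one_smul]
  have hout : outgoing c = (phiPlus Φ).mulVec b + outgoing cp := by
    rw [hcdef, outgoing_combine, outgoing_mulVec hΦ0, one_smul, one_smul]
  set h : ℝ → Idx ℓ r → ℝ := fun s i => g s i + (P.statMat μ s).mulVec (c s) i
  have hc : ∀ i, IsPrim (fun s => c s i) (fun s => h s i) := by
    intro i
    refine ((isPrim_mulVec hΦ b i).add (hcp i)).congr (fun s _ => by simp [c])
      (Eventually.of_forall fun s => ?_)
    simp only [h, c, one_smul, Matrix.mulVec_add, Pi.add_apply]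
    ring
  have hcc : ∀ i, ContinuousOn (fun s => c s i) (Icc 0 1) := fun i => (hc i).continuousOn
  have hmem : ∀ i, MemLp (fun s => h s i) 2 (volume.restrict (Ioo (0 : ℝ) 1)) := fun i =>
    memLp_add_mul (P.continuousOn_inv_lam i) (continuousOn_mulVec hM hcc i)
  refine ⟨(toL2 c, WithLp.toLp 2 z), toL2 h, c, isH1_toL2 hc hmem, ?_, ?_, ?_⟩
  · simp only [BoundaryCondition, zeroExo, add_zero]
    rw [hin, hout, Matrix.mulVec_add]
    rw [sub_sub, sub_eq_iff_eq_add] at h1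
    rw [h1]; abel
  · have e : (μ • ((toL2 c, WithLp.toLp 2 z) : State ℓ r m) - y).1 = μ • toL2 c - y.1 := rfl
    simp only [e]
    filter_upwards [L2.coe_sub (μ • toL2 c) y.1, L2.coe_smul μ (toL2 c), toL2_coe hcc,
      toL2_coe_of_memLp hmem, ae_restrict_mem measurableSet_Ioo] with s h3 h4 h5 h6 hs
    rw [h3, h4, h5, h6]
    funext i
    simp only [Pi.add_apply, Pi.sub_apply, Pi.smul_apply, Pi.zero_apply, smul_eq_mul]
    have hs' := Ioo_subset_Icc_self hs
    rw [Lam0, Matrix.mulVec_diagonal]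
    simp only [h]
    rw [mul_add, P.lam_mul_statMat_mulVec μ hs']
    have hl := P.lam_ne_zero i hs'
    simp only [g]
    field_simp
    ring
  · have e : (μ • ((toL2 c, WithLp.toLp 2 z) : State ℓ r m) - y).2.ofLp
        = μ • z - y.2.ofLp := rfl
    simp only [e, output, zeroExo, add_zero, sub_zero]
    rw [hin, hout, Matrix.mulVec_add, Matrix.mulVec_add]
    rw [sub_sub, sub_eq_iff_eq_add] at h2
    rw [h2]; abel

theorem resolvent_unique {Q : L2 ℓ r →L[ℝ] L2 ℓ r} {κ ω : ℝ}
    {G : Submodule ℝ (State ℓ r m × State ℓ r m)} (hE : IsEnergy G Q κ ω) {a : ℝ} (ha : 0 < a)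
    {x x' y : State ℓ r m} (h : (x, (a + ω) • x - y) ∈ G) (h' : (x', (a + ω) • x' - y) ∈ G) :
    x = x' := by
  have h1 := G.sub_mem h h'
  have e : (x, (a + ω) • x - y) - (x', (a + ω) • x' - y) = (x - x', (a + ω) • (x - x')) := by
    ext1
    · rfl
    · simp only [Prod.snd_sub, smul_sub]; abel
  rw [e] at h1
  have h3 := hE.form_resolvent_le h1 ha.le
  rw [sub_self] at h3
  have e0 : energyForm Q (0 : State ℓ r m) 0 = 0 := by simp [energyForm]
  rw [e0] at h3
  exact sub_eq_zero.mp (hE.eq_zero_of_form (nonpos_of_mul_nonpos_right h3 (by positivity)))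

theorem exists_resolvent {Q : L2 ℓ r →L[ℝ] L2 ℓ r} {κ ω : ℝ}
    (hE : IsEnergy (P.genGraph ki Ki) Q κ ω) {a : ℝ} (ha : 0 < a) :
    ∃ R : State ℓ r m →L[ℝ] State ℓ r m,
      (∀ y, (R y, (a + ω) • R y - y) ∈ P.genGraph ki Ki) ∧
      ∀ y, energyForm Q (a • R y) (a • R y) ≤ energyForm Q y y := by
  choose R hR using P.exists_resolvent_solution hE ha
  have hb : ∀ y, energyForm Q (a • R y) (a • R y) ≤ energyForm Q y y := by
    intro y
    have h1 := hE.form_resolvent_le (hR y) ha.le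
    rw [sub_sub_cancel] at h1
    have e : energyForm Q (a • R y) (a • R y) = a ^ 2 * energyForm Q (R y) (R y) := by
      simp only [energyForm, Prod.smul_fst, Prod.smul_snd, map_smul, real_inner_smul_left,
        real_inner_smul_right]
      ring
    rw [e]; exact h1
  have hm : 0 < min κ 1 := lt_min hE.κ_pos one_pos
  -- Linearity of the chosen solution map follows from uniqueness.
  let RL : State ℓ r m →ₗ[ℝ] State ℓ r m :=
    { toFun := R
      map_add' := fun y y' => by
        refine resolvent_unique hE ha (hR (y + y')) ?_
        have := (P.genGraph ki Ki).add_mem (hR y) (hR y')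
        convert this using 1
        ext1
        · rfl
        · simp only [Prod.snd_add, smul_add]; abel
      map_smul' := fun b y => by
        refine resolvent_unique hE ha (hR (b • y)) ?_
        have := (P.genGraph ki Ki).smul_mem b (hR y)
        convert this using 1
        ext1
        · rfl
        · simp only [Prod.smul_snd, RingHom.id_apply]; module }
  refine ⟨RL.mkContinuous (Real.sqrt ((‖Q‖ + 1) / min κ 1) / a) fun y => ?_, hR, hb⟩
  have h1 := hE.norm_sq_le_form (a • R y)
  have h2 := (h1.trans (hb y)).trans (IsEnergy.form_le y)
  rw [norm_smul, Real.norm_of_nonneg ha.le] at h2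
  have h3 : (a * ‖R y‖) ^ 2 ≤ (‖Q‖ + 1) / min κ 1 * ‖y‖ ^ 2 := by
    rw [div_mul_eq_mul_div, le_div_iff₀ hm]; linarith
  have h4 : a * ‖R y‖ ≤ Real.sqrt ((‖Q‖ + 1) / min κ 1) * ‖y‖ := by
    refine le_of_sq_le_sq ?_ (by positivity)
    rw [mul_pow (Real.sqrt _), Real.sq_sqrt (by positivity)]
    exact h3
  show ‖R y‖ ≤ _
  rw [div_mul_eq_mul_div, le_div_iff₀ ha]
  linarith

/-! ### Density of the domain -/

/-- Membership in the domain is only `H¹` regularity and the boundary condition: the differential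
equation and the output then define the image. -/
theorem exists_mem_genGraph {c h : ℝ → Idx ℓ r → ℝ} {z : Fin m → ℝ}
    (hc : ∀ i, IsPrim (fun s => c s i) (fun s => h s i))
    (hh : ∀ i, MemLp (fun s => h s i) 2 (volume.restrict (Ioo (0 : ℝ) 1)))
    (hbc : P.BoundaryCondition ki Ki zeroExo c z) :
    ∃ y, (((toL2 c, WithLp.toLp 2 z) : State ℓ r m), y) ∈ P.genGraph ki Ki := by
  refine ⟨(-mulOp P.Lam0 (toL2 h) - mulOp P.Lam1 (toL2 c),
    WithLp.toLp 2 (P.output zeroExo c)), toL2 h, c, isH1_toL2 hc hh, hbc, ?_, ?_⟩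
  · simp only
    filter_upwards [L2.coe_sub (-mulOp P.Lam0 (toL2 h)) (mulOp P.Lam1 (toL2 c)),
      L2.coe_smul (-1) (mulOp P.Lam0 (toL2 h)),
      mulOp_coe (M := P.Lam0) (continuousOn_diagonal P.continuousOn_lam) (toL2 h),
      mulOp_coe P.continuousOn_Lam1 (toL2 c)] with s h1 h2 h3 h4
    rw [neg_one_smul] at h2
    rw [h1, h2, h3, h4, neg_one_smul]
    abel
  · simp [zeroExo]

/-- Smooth profiles with compact support in `(0,1)`, paired with `z = 0`, are in the domain and
their profiles are dense in `L²`. For general `z` one fixed affine profile lifts the boundary value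
`B kᵢ Kᵢ z`, and density is used after subtracting it. -/
theorem dense_domain : Dense {x | ∃ y, (x, y) ∈ P.genGraph ki Ki} := by
  let D : Submodule ℝ (State ℓ r m) := (P.genGraph ki Ki).map (LinearMap.fst ℝ _ _)
  have hD : ∀ x, x ∈ D ↔ ∃ y, (x, y) ∈ P.genGraph ki Ki := by
    intro x
    constructor
    · rintro ⟨⟨x', y⟩, hy, rfl⟩; exact ⟨y, hy⟩
    · rintro ⟨y, hy⟩; exact ⟨_, hy, rfl⟩
  let D₀ : Submodule ℝ (L2 ℓ r) := D.comap (LinearMap.inl ℝ _ _)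
  have hD₀ : D₀.topologicalClosure = ⊤ := by
    rw [Submodule.topologicalClosure_eq_top_iff, Submodule.eq_bot_iff]
    intro φ hφ
    -- A profile orthogonal to all such functions, placed in one component at a time, vanishes by
    -- the fundamental lemma of the calculus of variations.
    have key : ∀ i, ∀ᵐ s ∂(volume : Measure ℝ), s ∈ Ioo (0 : ℝ) 1 → φ s i = 0 := by
      intro i
      refine isOpen_Ioo.ae_eq_zero_of_integral_contDiff_smul_eq_zero
        (f := fun s => φ s i) ?_ fun g hg _ hsupp => ?_
      · exact (show IntegrableOn (fun s => φ s i) (Ioo 0 1) volume from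
          φ.integrable_eval i).locallyIntegrableOn
      · have hg0 : g 0 = 0 := by
          by_contra hne
          exact lt_irrefl _ (hsupp (subset_tsupport _ hne)).1
        have hg1 : g 1 = 0 := by
          by_contra hne
          exact lt_irrefl _ (hsupp (subset_tsupport _ hne)).2
        set c : ℝ → Idx ℓ r → ℝ := fun s => Pi.single i (g s)
        have hgd : ContDiff ℝ 1 g := hg.of_le (by exact_mod_cast le_top)
        have hp : IsPrim g (deriv g) := IsPrim.of_hasDerivWithinAt
          (fun s _ => (hgd.differentiable one_ne_zero s).hasDerivAt.hasDerivWithinAt)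
          (hgd.continuous_deriv le_rfl).continuousOn
        have hc : ∀ j, IsPrim (fun s => c s j)
            (fun s => (Pi.single i (deriv g s) : Idx ℓ r → ℝ) j) := by
          intro j
          by_cases hj : j = i
          · subst hj; simpa [c] using hp
          · simpa [c, Pi.single_eq_of_ne hj] using IsPrim.const 0
        have hmem : ∀ j, MemLp (fun s => (Pi.single i (deriv g s) : Idx ℓ r → ℝ) j) 2
            (volume.restrict (Ioo (0 : ℝ) 1)) := by
          intro j
          refine memLp_of_continuousOn ?_
          by_cases hj : j = i
          · subst hj; simpa using (hgd.continuous_deriv le_rfl).continuousOn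
          · simpa [Pi.single_eq_of_ne hj] using continuousOn_const
        have hin : incoming c = 0 := by
          funext j; rcases j with j | j <;> simp [incoming, c, hg0, hg1]
        have hout : outgoing c = 0 := by
          funext j; rcases j with j | j <;> simp [outgoing, c, hg0, hg1]
        have hbc : P.BoundaryCondition ki Ki zeroExo c (0 : Fin m → ℝ) := by
          simp [BoundaryCondition, hin, hout, zeroExo]
        have hmemD : toL2 c ∈ D₀ := (hD _).mpr (P.exists_mem_genGraph hc hmem hbc)
        have h0 := (Submodule.mem_orthogonal _ _).mp hφ _ hmemD
        rw [L2.inner_eq] at h0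
        rw [← setIntegral_eq_integral_of_forall_compl_eq_zero (s := Ioo (0 : ℝ) 1)
          (fun s hs => by
            rw [image_eq_zero_of_notMem_tsupport fun hh => hs (hsupp hh), zero_smul])]
        refine Eq.trans (integral_congr_ae ?_) h0
        filter_upwards [toL2_coe fun j => (hc j).continuousOn] with s hs
        rw [hs]
        simp [c]
    refine L2.ext_ae ?_
    have key' : ∀ᵐ s ∂(volume.restrict (Ioo (0 : ℝ) 1)), ∀ i, φ s i = 0 := by
      rw [ae_all_iff]
      exact fun i => (ae_restrict_iff' measurableSet_Ioo).mpr (key i)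
    filter_upwards [key', L2.coe_zero (ℓ := ℓ) (r := r)] with s h1 h2
    rw [h2]
    exact funext h1
  rw [Metric.dense_iff]
  rintro ⟨f, z⟩ ε hε
  set b : Idx ℓ r → ℝ := P.B.mulVec (ki • Ki.mulVec z.ofLp)
  set c : ℝ → Idx ℓ r → ℝ := fun s =>
    Sum.elim (fun i => (1 - s) * b (Sum.inl i)) (fun j => s * b (Sum.inr j))
  have hc : ∀ i, IsPrim (fun s => c s i) (fun _ => -(sgn i * b i)) := by
    intro i
    refine IsPrim.of_hasDerivWithinAt (fun s _ => HasDerivAt.hasDerivWithinAt ?_)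
      continuousOn_const
    rcases i with i | i
    · simpa [c, sgn] using ((hasDerivAt_id s).const_sub 1).mul_const (b (Sum.inl i))
    · simpa [c, sgn] using (hasDerivAt_id s).mul_const (b (Sum.inr i))
  have hin : incoming c = b := by
    funext j; rcases j with j | j <;> simp [incoming, c]
  have hout : outgoing c = 0 := by
    funext j; rcases j with j | j <;> simp [outgoing, c]
  have hbc : P.BoundaryCondition ki Ki zeroExo c z.ofLp := by
    simp [BoundaryCondition, hin, hout, zeroExo, b]
  have hz : ((toL2 c, z) : State ℓ r m) ∈ D := (hD _).mpr
    (P.exists_mem_genGraph hc (fun i => memLp_const _) hbc)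
  have hdense : Dense (D₀ : Set (L2 ℓ r)) := by
    rw [dense_iff_closure_eq, ← Submodule.topologicalClosure_coe, hD₀]; rfl
  obtain ⟨φ, hφ, hdist⟩ := hdense.exists_dist_lt (f - toL2 c) hε
  refine ⟨(φ + toL2 c, z), ?_, ?_⟩
  · rw [Metric.mem_ball, Prod.dist_eq, max_lt_iff]
    constructor
    · rw [dist_eq_norm] at hdist ⊢
      rw [← norm_neg]
      have e : -((φ + toL2 c) - f) = f - toL2 c - φ := by abel
      show ‖-((φ + toL2 c) - f)‖ < ε
      rwa [e]
    · simpa using hε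
  · refine (hD _).mp ?_
    have := D.add_mem (show ((φ, 0) : State ℓ r m) ∈ D from hφ) hz
    simpa using this

/-! ### The semigroup of the homogeneous closed loop -/

/-- The theorem of Hille and Yosida is applied to `A - ω`, and the semigroup is multiplied by
`exp(ωt)`. -/
theorem exists_semigroup (ki : ℝ) (Ki : Matrix (Fin m) (Fin m) ℝ) :
    ∃ T : ℝ → State ℓ r m →L[ℝ] State ℓ r m, T 0 = 1 ∧
      (∀ τ, ∃ C, ∀ t ∈ Icc (0 : ℝ) τ, ‖T t‖ ≤ C) ∧ (∀ x, Continuous fun t => T t x) ∧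
      ∀ x y, (x, y) ∈ P.genGraph ki Ki → ∀ t ∈ Ici (0 : ℝ),
        HasDerivWithinAt (fun t => T t x) (T t y) (Ici 0) t ∧
        (T t x, T t y) ∈ P.genGraph ki Ki := by
  obtain ⟨Q, κ, ω, hE⟩ := P.exists_isEnergy ki Ki
  have hn : ∀ n : ℕ, (0 : ℝ) < (n : ℝ) + 1 := fun n => by positivity
  choose R hR hRb using fun n => P.exists_resolvent hE (hn n)
  let G' : Submodule ℝ (State ℓ r m × State ℓ r m) :=
    (P.genGraph ki Ki).comap ((LinearMap.fst ℝ _ _).prod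
      (LinearMap.snd ℝ _ _ + ω • LinearMap.fst ℝ _ _))
  have hG' : ∀ x y, (x, y) ∈ G' ↔ (x, y + ω • x) ∈ P.genGraph ki Ki := fun x y => Iff.rfl
  have hm : 0 < min κ 1 := lt_min hE.κ_pos one_pos
  have hHY : IsHilleYosida G' R (Real.sqrt ((‖Q‖ + 1) / min κ 1)) := by
    refine ⟨fun n y => ?_, ?_, fun n k => ?_, ?_⟩
    · rw [hG']
      have := hR n y
      convert this using 2
      module
    · rintro n ⟨x, y⟩ hxy
      rw [hG'] at hxy
      refine resolvent_unique hE (hn n) (hR n _) ?_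
      convert hxy using 2
      simp only
      module
    · refine ContinuousLinearMap.opNorm_le_bound _ (Real.sqrt_nonneg _) fun y => ?_
      -- Each factor contracts the energy, so all powers do. The comparison of energy and norm is
      -- paid only once, whatever the power.
      have h1 : ∀ k : ℕ, energyForm Q (((((n : ℝ) + 1) • R n) ^ k) y)
          (((((n : ℝ) + 1) • R n) ^ k) y) ≤ energyForm Q y y := by
        intro k
        induction k with
        | zero => simp
        | succ k ih =>
          rw [pow_succ']
          exact (hRb n _).trans ih
      have h2 := ((hE.norm_sq_le_form _).trans (h1 k)).trans (IsEnergy.form_le y)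
      refine le_of_sq_le_sq ?_ (by positivity)
      rw [mul_pow, Real.sq_sqrt (by positivity), div_mul_eq_mul_div, le_div_iff₀ hm]
      linarith
    · refine (P.dense_domain (ki := ki) (Ki := Ki)).mono ?_
      rintro x ⟨y, hy⟩
      refine ⟨y - ω • x, ?_⟩
      rw [hG']; simpa using hy
  obtain ⟨T, hT0, hTb, hTc, hT⟩ := hHY.exists_semigroup
  refine ⟨fun t => Real.exp (ω * t) • T t, by simp [hT0], fun τ => ?_, fun x => ?_, ?_⟩
  · refine ⟨Real.exp (ω * τ) * Real.sqrt ((‖Q‖ + 1) / min κ 1), fun t ht => ?_⟩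
    rw [norm_smul, Real.norm_of_nonneg (Real.exp_pos _).le]
    refine mul_le_mul ?_ (hTb t) (norm_nonneg _) (Real.exp_pos _).le
    exact Real.exp_le_exp.mpr (mul_le_mul_of_nonneg_left ht.2 hE.ω_pos.le)
  · exact (by fun_prop : Continuous fun t : ℝ => Real.exp (ω * t)).smul (hTc x)
  · intro x y hxy t ht
    have hxy' : (x, y - ω • x) ∈ G' := by rw [hG']; simpa using hxy
    obtain ⟨h1, h2⟩ := hT _ _ hxy' t ht
    constructor
    · have h3 : HasDerivAt (fun t : ℝ => Real.exp (ω * t)) (Real.exp (ω * t) * ω) t := by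
        simpa using ((hasDerivAt_id t).const_mul ω).exp
      refine (h3.hasDerivWithinAt.smul h1).congr_deriv ?_
      simp only [map_sub, map_smul]
      show _ = Real.exp (ω * t) • T t y
      module
    · rw [hG'] at h2
      have := (P.genGraph ki Ki).smul_mem (Real.exp (ω * t)) h2
      simp only [map_sub, map_smul, sub_add_cancel] at this
      exact this

end Plant

/-! ## Test functions -/

theorem inner_toL2 {f : ℝ → Idx ℓ r → ℝ} (hf : ∀ i, ContinuousOn (fun s => f s i) (Icc 0 1))
    (g : L2 ℓ r) : ⟪toL2 f, g⟫ = ∫ s in Ioo (0 : ℝ) 1, f s ⬝ᵥ (g s).ofLp := by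
  rw [L2.inner_eq]
  refine integral_congr_ae ?_
  filter_upwards [toL2_coe hf] with s hs
  rw [hs]

theorem toL2_add {f g : ℝ → Idx ℓ r → ℝ} (hf : ∀ i, ContinuousOn (fun s => f s i) (Icc 0 1))
    (hg : ∀ i, ContinuousOn (fun s => g s i) (Icc 0 1)) :
    toL2 (fun s => f s + g s) = toL2 f + toL2 g := by
  refine L2.ext_ae ?_
  filter_upwards [toL2_coe hf, toL2_coe hg, L2.coe_add (toL2 f) (toL2 g),
    toL2_coe (f := fun s => f s + g s) (fun i => (hf i).add (hg i))] with s h1 h2 h3 h4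
  rw [h4, h3, h1, h2]

theorem toL2_smul {f : ℝ → Idx ℓ r → ℝ} (hf : ∀ i, ContinuousOn (fun s => f s i) (Icc 0 1))
    (a : ℝ) : toL2 (fun s => a • f s) = a • toL2 f := by
  refine L2.ext_ae ?_
  filter_upwards [toL2_coe hf, L2.coe_smul a (toL2 f),
    toL2_coe (f := fun s => a • f s) (fun i => continuousOn_const.mul (hf i))] with s h1 h3 h4
  rw [h4, h3, h1]

theorem toL2_sub {f g : ℝ → Idx ℓ r → ℝ} (hf : ∀ i, ContinuousOn (fun s => f s i) (Icc 0 1))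
    (hg : ∀ i, ContinuousOn (fun s => g s i) (Icc 0 1)) :
    toL2 (fun s => f s - g s) = toL2 f - toL2 g := by
  refine L2.ext_ae ?_
  filter_upwards [toL2_coe hf, toL2_coe hg, L2.coe_sub (toL2 f) (toL2 g),
    toL2_coe (f := fun s => f s - g s) (fun i => (hf i).sub (hg i))] with s h1 h2 h3 h4
  rw [h4, h3, h1, h2]

theorem norm_toL2_le {f : ℝ → Idx ℓ r → ℝ} (hf : ∀ i, ContinuousOn (fun s => f s i) (Icc 0 1))
    {ε : ℝ} (hε : 0 ≤ ε) (hb : ∀ s ∈ Icc (0 : ℝ) 1, ‖f s‖ ≤ ε) :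
    ‖toL2 f‖ ≤ Real.sqrt (Fintype.card (Idx ℓ r)) * ε := by
  have hC : 0 ≤ Real.sqrt (Fintype.card (Idx ℓ r)) * ε := by positivity
  have h1 := Lp.norm_le_of_ae_bound (f := toL2 f) hC (by
    filter_upwards [toL2_coe hf, ae_restrict_mem measurableSet_Ioo] with s h1 hs
    rw [EuclideanSpace.norm_eq, h1]
    refine Real.sqrt_le_iff.mpr ⟨hC, ?_⟩
    rw [mul_pow, Real.sq_sqrt (by positivity)]
    refine (Finset.sum_le_card_nsmul _ _ (ε ^ 2) fun i _ => ?_).trans (le_of_eq ?_)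
    · exact pow_le_pow_left₀ (norm_nonneg _)
        ((norm_le_pi_norm _ i).trans (hb s (Ioo_subset_Icc_self hs))) 2
    · simp)
  refine h1.trans (le_of_eq ?_)
  simp [measureUnivNNReal]

/-- Compactness of `[0,1]` makes continuity in time uniform in space. The hypothesis is confined to
the strip because the coefficients are controlled only on `[0,1]`. -/
theorem eventually_norm_sub_le {g : ℝ → ℝ → Idx ℓ r → ℝ}
    (hg : ContinuousOn (fun p : ℝ × ℝ => g p.1 p.2) (univ ×ˢ Icc 0 1)) (t : ℝ) {ε : ℝ}
    (hε : 0 < ε) : ∀ᶠ τ in 𝓝 t, ∀ s ∈ Icc (0 : ℝ) 1, ‖g τ s - g t s‖ ≤ ε := by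
  obtain ⟨v, hv, hvu⟩ := isCompact_Icc.mem_uniformity_of_prod (f := g) (s := univ) hg
    (mem_univ t) (Metric.dist_mem_uniformity hε)
  rw [nhdsWithin_univ] at hv
  filter_upwards [hv] with τ hτ s hs
  have := hvu τ hτ s hs
  rw [mem_ofPred_eq, dist_eq_norm] at this
  exact this.le

theorem continuousOn_slice {g : ℝ → ℝ → Idx ℓ r → ℝ}
    (hg : ContinuousOn (fun p : ℝ × ℝ => g p.1 p.2) (univ ×ˢ Icc 0 1)) (t : ℝ) (i : Idx ℓ r) :
    ContinuousOn (fun s => g t s i) (Icc 0 1) := by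
  have h1 : ContinuousOn (fun s => g t s) (Icc 0 1) :=
    hg.comp (f := fun s : ℝ => (t, s)) (by fun_prop) fun s hs => ⟨mem_univ _, hs⟩
  exact (continuous_apply i).comp_continuousOn h1

theorem continuous_toL2 {g : ℝ → ℝ → Idx ℓ r → ℝ}
    (hg : ContinuousOn (fun p : ℝ × ℝ => g p.1 p.2) (univ ×ˢ Icc 0 1)) :
    Continuous fun t => toL2 (g t) := by
  rw [Metric.continuous_iff']
  intro t ε hε
  set C := Real.sqrt (Fintype.card (Idx ℓ r))
  have hC : 0 ≤ C := Real.sqrt_nonneg _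
  filter_upwards [eventually_norm_sub_le hg t (show 0 < ε / (2 * (C + 1)) by positivity)]
    with τ hτ
  rw [dist_eq_norm, ← toL2_sub (continuousOn_slice hg τ) (continuousOn_slice hg t)]
  refine (norm_toL2_le (fun i => (continuousOn_slice hg τ i).sub (continuousOn_slice hg t i))
    (by positivity) hτ).trans_lt ?_
  calc C * (ε / (2 * (C + 1))) ≤ (C + 1) * (ε / (2 * (C + 1))) := by gcongr; linarith
    _ = ε / 2 := by field_simp
    _ < ε := by linarith

/-- The mean value inequality for `σ ↦ g σ s - σ g' t s` bounds the remainder uniformly in `s`. A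
sup bound on `[0,1]` is an `L²` bound up to a constant. -/
theorem hasDerivAt_toL2 {g g' : ℝ → ℝ → Idx ℓ r → ℝ}
    (hg : ContinuousOn (fun p : ℝ × ℝ => g p.1 p.2) (univ ×ˢ Icc 0 1))
    (hg' : ContinuousOn (fun p : ℝ × ℝ => g' p.1 p.2) (univ ×ˢ Icc 0 1))
    (hd : ∀ t, ∀ s ∈ Icc (0 : ℝ) 1, HasDerivAt (fun τ => g τ s) (g' t s) t) (t : ℝ) :
    HasDerivAt (fun t => toL2 (g t)) (toL2 (g' t)) t := by
  rw [hasDerivAt_iff_isLittleO, Asymptotics.isLittleO_iff]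
  intro ε hε
  set C := Real.sqrt (Fintype.card (Idx ℓ r))
  have hC : 0 ≤ C := Real.sqrt_nonneg _
  set δ := ε / (C + 1)
  have hδ : 0 < δ := by positivity
  obtain ⟨ρ, hρ, hball⟩ := Metric.eventually_nhds_iff_ball.mp (eventually_norm_sub_le hg' t hδ)
  filter_upwards [Metric.ball_mem_nhds t hρ] with τ hτ
  have hb : ∀ s ∈ Icc (0 : ℝ) 1, ‖g τ s - g t s - (τ - t) • g' t s‖ ≤ δ * |τ - t| := by
    intro s hs
    have := (convex_ball t ρ).norm_image_sub_le_of_norm_hasDerivWithin_le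
      (f := fun σ => g σ s - σ • g' t s) (f' := fun σ => g' σ s - g' t s) (C := δ)
      (fun σ _ => ((hd σ s hs).sub (by
        simpa using (hasDerivAt_id σ).smul_const (g' t s))).hasDerivWithinAt)
      (fun σ hσ => hball σ hσ s hs) (Metric.mem_ball_self hρ) hτ
    rw [Real.norm_eq_abs] at this
    have e : g τ s - g t s - (τ - t) • g' t s
        = g τ s - τ • g' t s - (g t s - t • g' t s) := by module
    rw [e]
    exact this
  have c1 := continuousOn_slice hg τ
  have c2 := continuousOn_slice hg t
  have c3 := continuousOn_slice hg' t
  have c4 : ∀ i, ContinuousOn (fun s => ((τ - t) • g' t s) i) (Icc 0 1) :=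
    fun i => continuousOn_const.mul (c3 i)
  have c5 : ∀ i, ContinuousOn (fun s => (g τ s - g t s) i) (Icc 0 1) :=
    fun i => (c1 i).sub (c2 i)
  rw [← toL2_sub c1 c2, ← toL2_smul c3, ← toL2_sub c5 c4]
  refine (norm_toL2_le (fun i => (c5 i).sub (c4 i)) (by positivity) hb).trans ?_
  rw [Real.norm_eq_abs, ← mul_assoc]
  gcongr
  simp only [δ]
  rw [mul_div_assoc', div_le_iff₀ (by positivity)]
  nlinarith

/-! ### Test functions -/

theorem hasDerivAt_time {ψ : ℝ → ℝ → Idx ℓ r → ℝ}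
    (hψ : ContDiff ℝ 1 fun p : ℝ × ℝ => ψ p.1 p.2) (t s : ℝ) :
    HasDerivAt (fun τ => ψ τ s) (fderiv ℝ (fun p : ℝ × ℝ => ψ p.1 p.2) (t, s) (1, 0)) t := by
  have h1 := ((hψ.differentiable one_ne_zero) (t, s)).hasFDerivAt
  have h2 : HasDerivAt (fun τ : ℝ => (τ, s)) ((1 : ℝ), (0 : ℝ)) t :=
    (hasDerivAt_id t).prodMk (hasDerivAt_const t s)
  exact h1.comp_hasDerivAt t h2

theorem hasDerivAt_space {ψ : ℝ → ℝ → Idx ℓ r → ℝ}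
    (hψ : ContDiff ℝ 1 fun p : ℝ × ℝ => ψ p.1 p.2) (t s : ℝ) :
    HasDerivAt (fun x => ψ t x) (fderiv ℝ (fun p : ℝ × ℝ => ψ p.1 p.2) (t, s) (0, 1)) s := by
  have h1 := ((hψ.differentiable one_ne_zero) (t, s)).hasFDerivAt
  have h2 : HasDerivAt (fun x : ℝ => (t, x)) ((0 : ℝ), (1 : ℝ)) s :=
    (hasDerivAt_const s t).prodMk (hasDerivAt_id s)
  exact h1.comp_hasDerivAt s h2

theorem continuous_fderiv_apply {ψ : ℝ → ℝ → Idx ℓ r → ℝ}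
    (hψ : ContDiff ℝ 1 fun p : ℝ × ℝ => ψ p.1 p.2) (e : ℝ × ℝ) :
    Continuous fun p : ℝ × ℝ => fderiv ℝ (fun p : ℝ × ℝ => ψ p.1 p.2) p e :=
  (hψ.continuous_fderiv one_ne_zero).clm_apply continuous_const

namespace Plant

variable (P : Plant ℓ r m) {ki : ℝ} {Ki : Matrix (Fin m) (Fin m) ℝ}

/-- The spatial part `(Λ₀ ψ)_s - Λ₁ᵀ ψ` of the formal adjoint. -/
def statAdjoint (ψ : ℝ → Idx ℓ r → ℝ) (s : ℝ) : Idx ℓ r → ℝ := fun i =>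
  derivWithin (fun x => P.lam i x * ψ x i) (Icc 0 1) s - (P.Lam1 s).transpose.mulVec (ψ s) i

theorem continuousOn_transpose_mulVec {ψ : ℝ → Idx ℓ r → ℝ}
    (hψ : ∀ i, ContinuousOn (fun s => ψ s i) (Icc 0 1)) (i : Idx ℓ r) :
    ContinuousOn (fun s => (P.Lam1 s).transpose.mulVec (ψ s) i) (Icc 0 1) :=
  continuousOn_mulVec (M := fun s => (P.Lam1 s).transpose)
    (fun i j => P.continuousOn_Lam1 j i) hψ i

theorem continuousOn_statAdjoint {ψ : ℝ → Idx ℓ r → ℝ}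
    (hψ : ∀ i, ContDiffOn ℝ 1 (fun s => ψ s i) (Icc 0 1)) (i : Idx ℓ r) :
    ContinuousOn (fun s => P.statAdjoint ψ s i) (Icc 0 1) :=
  (((P.lam_C1 i).mul (hψ i)).continuousOn_derivWithin (uniqueDiffOn_Icc zero_lt_one) le_rfl).sub
    (P.continuousOn_transpose_mulVec (fun i => (hψ i).continuousOn) i)

/-- Integration by parts in space. -/
theorem inner_test_eq {ψ : ℝ → Idx ℓ r → ℝ}
    (hψ : ∀ i, ContDiffOn ℝ 1 (fun s => ψ s i) (Icc 0 1))
    {v v' : State ℓ r m} {f : L2 ℓ r} {c : ℝ → Idx ℓ r → ℝ} (hc : IsH1 v.1 f c)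
    (he : ∀ᵐ s ∂(volume.restrict (Ioo (0 : ℝ) 1)),
      (v'.1 s).ofLp + (P.Lam0 s).mulVec (f s).ofLp + (P.Lam1 s).mulVec (v.1 s).ofLp = 0) :
    ⟪toL2 ψ, v'.1⟫ = ⟪toL2 (P.statAdjoint ψ), v.1⟫
      - outgoing (fun s i => |P.lam i s| * ψ s i) ⬝ᵥ outgoing c
      + incoming (fun s i => |P.lam i s| * ψ s i) ⬝ᵥ incoming c := by
  obtain ⟨hp, hcv⟩ := isH1_iff.mp hc
  have hψc : ∀ i, ContinuousOn (fun s => ψ s i) (Icc 0 1) := fun i => (hψ i).continuousOn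
  have hg : ∀ i, IsPrim (fun s => P.lam i s * ψ s i * c s i)
      (fun s => derivWithin (fun x => P.lam i x * ψ x i) (Icc 0 1) s * c s i
        + P.lam i s * ψ s i * f s i) :=
    fun i => (IsPrim.of_contDiffOn ((P.lam_C1 i).mul (hψ i))).mul (hp i)
  have hsum : ⟪toL2 (P.statAdjoint ψ), v.1⟫ - ⟪toL2 ψ, v'.1⟫
      = ∑ i, (P.lam i 1 * ψ 1 i * c 1 i - P.lam i 0 * ψ 0 i * c 0 i) := by
    have hint1 : Integrable (fun s => P.statAdjoint ψ s ⬝ᵥ (v.1 s).ofLp)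
        (volume.restrict (Ioo (0 : ℝ) 1)) := by
      have : Integrable (fun s => (toL2 (P.statAdjoint ψ) s).ofLp ⬝ᵥ (v.1 s).ofLp)
          (volume.restrict (Ioo (0 : ℝ) 1)) :=
        integrable_finsetSum _ fun i _ => L2.integrable_eval_mul _ _ i i
      refine this.congr ?_
      filter_upwards [toL2_coe (P.continuousOn_statAdjoint hψ)] with s hs
      rw [hs]
    have hint2 : Integrable (fun s => ψ s ⬝ᵥ (v'.1 s).ofLp)
        (volume.restrict (Ioo (0 : ℝ) 1)) := by
      have : Integrable (fun s => (toL2 ψ s).ofLp ⬝ᵥ (v'.1 s).ofLp)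
          (volume.restrict (Ioo (0 : ℝ) 1)) :=
        integrable_finsetSum _ fun i _ => L2.integrable_eval_mul _ _ i i
      refine this.congr ?_
      filter_upwards [toL2_coe hψc] with s hs
      rw [hs]
    rw [inner_toL2 (P.continuousOn_statAdjoint hψ), inner_toL2 hψc, ← integral_sub hint1 hint2]
    have e : ∀ i, P.lam i 1 * ψ 1 i * c 1 i - P.lam i 0 * ψ 0 i * c 0 i
        = ∫ s in Ioo (0 : ℝ) 1, (derivWithin (fun x => P.lam i x * ψ x i) (Icc 0 1) s * c s i
        + P.lam i s * ψ s i * f s i) := fun i => (hg i).eq_sub.symm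
    simp only [e]
    rw [← integral_finsetSum _ fun i _ => ((intervalIntegrable_iff_integrableOn_Ioo_of_le
      zero_le_one).mp (hg i).1)]
    refine integral_congr_ae ?_
    filter_upwards [he, hcv] with s h1 h2
    have h3 : (v'.1 s).ofLp = -((P.Lam0 s).mulVec (f s).ofLp) - (P.Lam1 s).mulVec (c s) := by
      rw [h2] at h1
      rw [← sub_eq_zero, ← h1]; abel
    rw [h2, h3, dotProduct_sub, dotProduct_neg, Matrix.dotProduct_mulVec, Matrix.dotProduct_mulVec,
      ← Matrix.mulVec_transpose (P.Lam1 s)]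
    simp only [dotProduct, statAdjoint, Lam0, Matrix.vecMul_diagonal]
    rw [← Finset.sum_neg_distrib, ← Finset.sum_sub_distrib, ← Finset.sum_sub_distrib]
    refine Finset.sum_congr rfl fun i _ => by ring
  -- The sign of `λᵢ` decides which end is outgoing, so with `|λᵢ|` the boundary term becomes
  -- outgoing minus incoming.
  have hbd : outgoing (fun s i => |P.lam i s| * ψ s i) ⬝ᵥ outgoing c
      - incoming (fun s i => |P.lam i s| * ψ s i) ⬝ᵥ incoming c
      = ∑ i, (P.lam i 1 * ψ 1 i * c 1 i - P.lam i 0 * ψ 0 i * c 0 i) := by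
    have m0 : (0 : ℝ) ∈ Icc (0 : ℝ) 1 := ⟨le_rfl, zero_le_one⟩
    have m1 : (1 : ℝ) ∈ Icc (0 : ℝ) 1 := ⟨zero_le_one, le_rfl⟩
    simp only [dotProduct]
    rw [← Finset.sum_sub_distrib]
    refine Finset.sum_congr rfl fun i _ => ?_
    rcases i with i | i
    · simp only [outgoing, incoming, Sum.elim_inl, P.abs_lam _ m0, P.abs_lam _ m1, sgn]; ring
    · simp only [outgoing, incoming, Sum.elim_inr, P.abs_lam _ m0, P.abs_lam _ m1, sgn]; ring
  linarith

theorem contDiffOn_slice {ψ : ℝ → ℝ → Idx ℓ r → ℝ}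
    (hψ : ContDiff ℝ 1 fun p : ℝ × ℝ => ψ p.1 p.2) (t : ℝ) (i : Idx ℓ r) :
    ContDiffOn ℝ 1 (fun s => ψ t s i) (Icc 0 1) := by
  have : ContDiff ℝ 1 fun s => ψ t s := hψ.comp (contDiff_prodMk_right t)
  exact (contDiff_pi.mp this i).contDiffOn

theorem adjointExpr_eq {ψ : ℝ → ℝ → Idx ℓ r → ℝ}
    (hψ : ContDiff ℝ 1 fun p : ℝ × ℝ => ψ p.1 p.2) (t s : ℝ) :
    P.adjointExpr ψ t s = fderiv ℝ (fun p : ℝ × ℝ => ψ p.1 p.2) (t, s) (1, 0)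
      + P.statAdjoint (ψ t) s := by
  funext i
  have h := (hasDerivAt_pi.mp (hasDerivAt_time hψ t s) i).deriv
  simp only [adjointExpr, statAdjoint, Pi.add_apply, h]
  ring

/-- The space derivative is defined separately for each `t`; expanding it by the product rule makes
joint continuity visible. -/
theorem continuousOn_adjoint {ψ : ℝ → ℝ → Idx ℓ r → ℝ}
    (hψ : ContDiff ℝ 1 fun p : ℝ × ℝ => ψ p.1 p.2) :
    ContinuousOn (fun p : ℝ × ℝ => P.adjointExpr ψ p.1 p.2) (univ ×ˢ Icc 0 1) := by
  simp only [P.adjointExpr_eq hψ]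
  refine ((continuous_fderiv_apply hψ (1, 0)).continuousOn).add ?_
  refine continuousOn_pi.mpr fun i => ?_
  have h2 : ∀ {u : ℝ → ℝ}, ContinuousOn u (Icc 0 1) →
      ContinuousOn (fun p : ℝ × ℝ => u p.2) (univ ×ˢ Icc 0 1) := fun hu =>
    hu.comp continuousOn_snd fun p hp => hp.2
  have hψi : ∀ j, Continuous fun p : ℝ × ℝ => ψ p.1 p.2 j := fun j =>
    (continuous_apply j).comp hψ.continuous
  have h3 : ContinuousOn (fun p : ℝ × ℝ => derivWithin (P.lam i) (Icc 0 1) p.2 * ψ p.1 p.2 i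
      + P.lam i p.2 * fderiv ℝ (fun p : ℝ × ℝ => ψ p.1 p.2) p (0, 1) i
      - (P.Lam1 p.2).transpose.mulVec (ψ p.1 p.2) i) (univ ×ˢ Icc 0 1) := by
    refine ((ContinuousOn.mul ?_ (hψi i).continuousOn).add (ContinuousOn.mul ?_ ?_)).sub ?_
    · exact h2 ((P.lam_C1 i).continuousOn_derivWithin (uniqueDiffOn_Icc zero_lt_one) le_rfl)
    · exact h2 (P.continuousOn_lam i)
    · exact ((continuous_apply i).comp (continuous_fderiv_apply hψ (0, 1))).continuousOn
    · simp only [Matrix.mulVec, dotProduct, Matrix.transpose_apply]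
      exact continuousOn_finsetSum _ fun j _ =>
        (h2 (P.continuousOn_Lam1 j i)).mul (hψi j).continuousOn
  refine h3.congr fun p hp => ?_
  obtain ⟨t, s⟩ := p
  have hs : s ∈ Icc (0 : ℝ) 1 := hp.2
  have hl := ((P.lam_C1 i).differentiableOn one_ne_zero s hs).hasDerivWithinAt
  have hp' := (hasDerivAt_pi.mp (hasDerivAt_space hψ t s) i).hasDerivWithinAt (s := Icc 0 1)
  have := (hl.mul hp').derivWithin (uniqueDiffOn_Icc zero_lt_one s hs)
  simp only [statAdjoint]
  congr 1

end Plant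

/-! ## Weak solutions -/

namespace Plant

variable (P : Plant ℓ r m) {ki : ℝ} {Ki : Matrix (Fin m) (Fin m) ℝ}

/-- Incoming flux of a test function, with the contribution of the output. -/
def testFlux (ψ : ℝ → ℝ → Idx ℓ r → ℝ) (η : ℝ → Fin m → ℝ) (t : ℝ) : Idx ℓ r → ℝ :=
  incoming (fun s i => |P.lam i s| * ψ t s i) + P.L₁.transpose.mulVec (η t)

/-- The integrand of the weak formulation. -/
def weakRate (ki : ℝ) (Ki : Matrix (Fin m) (Fin m) ℝ) (d : Exo ℓ r m)
    (ψ : ℝ → ℝ → Idx ℓ r → ℝ) (η : ℝ → Fin m → ℝ) (t : ℝ) (x : State ℓ r m) : ℝ :=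
  ⟪toL2 (P.adjointExpr ψ t), x.1⟫ + deriv η t ⬝ᵥ x.2.ofLp
    + P.testFlux ψ η t ⬝ᵥ (P.B.mulVec (ki • Ki.mulVec x.2.ofLp) + d.wb)
    + η t ⬝ᵥ (d.wy - d.yref)

/-- Pairing with a test function. -/
def testPair (ψ : ℝ → ℝ → Idx ℓ r → ℝ) (η : ℝ → Fin m → ℝ) (t : ℝ) (x : State ℓ r m) : ℝ :=
  ⟪toL2 (ψ t), x.1⟫ + η t ⬝ᵥ x.2.ofLp

/-- Writing the space integrals as inner products in `L²` makes continuity and linearity in the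
state available. -/
theorem isWeakSolution_iff {d : Exo ℓ r m} {v₀ : State ℓ r m} {v : ℝ → State ℓ r m} :
    P.IsWeakSolution ki Ki d v₀ v ↔ v 0 = v₀ ∧ ContinuousOn v (Ici 0) ∧
      ∀ T : ℝ, 0 < T → ∀ (ψ : ℝ → ℝ → Idx ℓ r → ℝ) (η : ℝ → Fin m → ℝ), P.IsTest T ψ η →
        testPair ψ η T (v T) - testPair ψ η 0 v₀
          = ∫ t in (0 : ℝ)..T, P.weakRate ki Ki d ψ η t (v t) := by
  unfold IsWeakSolution
  refine and_congr_right fun _ => and_congr_right fun _ => forall_congr' fun T =>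
    forall_congr' fun hT => forall_congr' fun ψ => forall_congr' fun η =>
    forall_congr' fun hψ => ?_
  have h1 : ∀ t (x : State ℓ r m),
      ⟪toL2 (ψ t), x.1⟫ = ∫ s in Ioo (0 : ℝ) 1, ψ t s ⬝ᵥ (x.1 s).ofLp := fun t x =>
    inner_toL2 (fun i => (contDiffOn_slice hψ.1 t i).continuousOn) _
  have h2 : ∀ t (x : State ℓ r m), ⟪toL2 (P.adjointExpr ψ t), x.1⟫
      = ∫ s in Ioo (0 : ℝ) 1, P.adjointExpr ψ t s ⬝ᵥ (x.1 s).ofLp := fun t x =>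
    inner_toL2 (continuousOn_slice (P.continuousOn_adjoint hψ.1) t) _
  simp only [testPair, weakRate, testFlux, h1, h2]

theorem continuous_testFlux {T : ℝ} {ψ : ℝ → ℝ → Idx ℓ r → ℝ} {η : ℝ → Fin m → ℝ}
    (hψ : P.IsTest T ψ η) : Continuous (P.testFlux ψ η) := by
  have h1 : ∀ s i, Continuous fun t => ψ t s i := fun s i =>
    (continuous_apply i).comp (hψ.1.continuous.comp (by fun_prop : Continuous fun t : ℝ => (t, s)))
  refine Continuous.add (continuous_pi fun i => ?_) ?_
  · rcases i with i | i
    · exact continuous_const.mul (h1 0 _)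
    · exact continuous_const.mul (h1 1 _)
  · exact continuous_const.matrix_mulVec hψ.2.1.continuous

theorem continuousOn_weakRate {T : ℝ} {ψ : ℝ → ℝ → Idx ℓ r → ℝ} {η : ℝ → Fin m → ℝ}
    (hψ : P.IsTest T ψ η) (d : Exo ℓ r m) {v : ℝ → State ℓ r m} {S : Set ℝ}
    (hv : ContinuousOn v S) :
    ContinuousOn (fun t => P.weakRate ki Ki d ψ η t (v t)) S := by
  have hv1 : ContinuousOn (fun t => (v t).1) S := continuous_fst.comp_continuousOn hv
  have hv2 : ContinuousOn (fun t => (v t).2.ofLp) S :=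
    ((PiLp.continuous_ofLp 2 _).comp continuous_snd).comp_continuousOn hv
  have hdot : ∀ {k : Type} [Fintype k] {f g : ℝ → k → ℝ}, ContinuousOn f S → ContinuousOn g S →
      ContinuousOn (fun t => f t ⬝ᵥ g t) S := by
    intro k _ f g hf hg
    simp only [dotProduct]
    exact continuousOn_finsetSum _ fun i _ =>
      ((continuous_apply i).comp_continuousOn hf).mul ((continuous_apply i).comp_continuousOn hg)
  refine ContinuousOn.add (ContinuousOn.add (ContinuousOn.add ?_ ?_) ?_) ?_
  · exact (continuous_toL2 (P.continuousOn_adjoint hψ.1)).continuousOn.inner hv1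
  · exact hdot (hψ.2.1.continuous_deriv le_rfl).continuousOn hv2
  · refine hdot (P.continuous_testFlux hψ).continuousOn (ContinuousOn.add ?_ continuousOn_const)
    have : Continuous fun z : Fin m → ℝ => P.B.mulVec (ki • Ki.mulVec z) :=
      continuous_const.matrix_mulVec ((continuous_const.matrix_mulVec continuous_id).const_smul ki)
    exact this.comp_continuousOn hv2
  · exact hdot hψ.2.1.continuous.continuousOn continuousOn_const

/-- A strong solution is a weak solution. -/
theorem isWeakSolution_of_isStrongSolution {d : Exo ℓ r m} {v₀ : State ℓ r m}
    {v : ℝ → State ℓ r m} (hv : P.IsStrongSolution ki Ki d v₀ v) :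
    P.IsWeakSolution ki Ki d v₀ v := by
  obtain ⟨dφ, v', h0, hvc, -, -, hd, hcl⟩ := hv
  rw [isWeakSolution_iff]
  refine ⟨h0, hvc, fun T hT ψ η hψ => ?_⟩
  -- The time derivative of the pairing is the integrand of the weak formulation, so the identity is
  -- the fundamental theorem of calculus.
  have hder : ∀ t ∈ Icc (0 : ℝ) T, HasDerivWithinAt (fun t => testPair ψ η t (v t))
      (P.weakRate ki Ki d ψ η t (v t)) (Icc 0 T) t := by
    intro t ht
    have hvt := (hd t ht.1).mono (Icc_subset_Ici_self : Icc 0 T ⊆ Ici 0)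
    have hv1 : HasDerivWithinAt (fun t => (v t).1) (v' t).1 (Icc 0 T) t :=
      (ContinuousLinearMap.fst ℝ (L2 ℓ r)
        (EuclideanSpace ℝ (Fin m))).hasFDerivAt.comp_hasDerivWithinAt t hvt
    have hv2 : HasDerivWithinAt (fun t => (v t).2) (v' t).2 (Icc 0 T) t :=
      (ContinuousLinearMap.snd ℝ (L2 ℓ r)
        (EuclideanSpace ℝ (Fin m))).hasFDerivAt.comp_hasDerivWithinAt t hvt
    have hψt : HasDerivAt (fun t => toL2 (ψ t)) (toL2 fun s =>
        fderiv ℝ (fun p : ℝ × ℝ => ψ p.1 p.2) (t, s) (1, 0)) t :=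
      hasDerivAt_toL2 (g' := fun t s => fderiv ℝ (fun p : ℝ × ℝ => ψ p.1 p.2) (t, s) (1, 0))
        hψ.1.continuous.continuousOn (continuous_fderiv_apply hψ.1 _).continuousOn
        (fun t s _ => hasDerivAt_time hψ.1 t s) t
    have hη : HasDerivAt η (deriv η t) t :=
      (hψ.2.1.differentiable one_ne_zero t).hasDerivAt
    have hηt : HasDerivAt (fun t => WithLp.toLp 2 (η t) : ℝ → EuclideanSpace ℝ (Fin m))
        (WithLp.toLp 2 (deriv η t)) t :=
      ((PiLp.continuousLinearEquiv 2 ℝ (fun _ : Fin m => ℝ)).symm :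
        (Fin m → ℝ) →L[ℝ] EuclideanSpace ℝ (Fin m)).hasFDerivAt.comp_hasDerivAt t hη
    have h1 := (hψt.hasDerivWithinAt.inner ℝ hv1).add (hηt.hasDerivWithinAt.inner ℝ hv2)
    simp only [euclidean_inner_eq] at h1
    refine h1.congr_deriv ?_
    obtain ⟨c, hc, hbc, he, hz⟩ := hcl t ht.1
    have hibp := P.inner_test_eq (contDiffOn_slice hψ.1 t) hc he
    have hadj : toL2 (P.adjointExpr ψ t)
        = (toL2 fun s => fderiv ℝ (fun p : ℝ × ℝ => ψ p.1 p.2) (t, s) (1, 0))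
          + toL2 (P.statAdjoint (ψ t)) := by
      rw [← toL2_add (continuousOn_slice (g := fun t s =>
          fderiv ℝ (fun p : ℝ × ℝ => ψ p.1 p.2) (t, s) (1, 0))
          (continuous_fderiv_apply hψ.1 _).continuousOn t)
        (P.continuousOn_statAdjoint (contDiffOn_slice hψ.1 t))]
      congr 1
      funext s
      exact P.adjointExpr_eq hψ.1 t s
    have hadjbc := hψ.2.2 t ht
    rw [weakRate, hadj, inner_add_left, hibp, hadjbc, hz]
    unfold output
    have hin : incoming c = _ := hbc
    unfold testFlux
    set q := incoming fun s i => |P.lam i s| * ψ t s i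
    set o := outgoing c
    set u := P.B.mulVec (ki • Ki.mulVec (v t).2.ofLp)
    -- By the adjoint boundary condition the outgoing trace enters only through `K o` and `L₂ o`.
    -- These cancel against the boundary condition and the output.
    have e1 : (P.K.transpose.mulVec (q + P.L₁.transpose.mulVec (η t))
        + P.L₂.transpose.mulVec (η t)) ⬝ᵥ o
        = (q + P.L₁.transpose.mulVec (η t)) ⬝ᵥ P.K.mulVec o + η t ⬝ᵥ P.L₂.mulVec o := by
      rw [add_dotProduct, Matrix.mulVec_transpose, Matrix.mulVec_transpose P.L₂,
        ← Matrix.dotProduct_mulVec, ← Matrix.dotProduct_mulVec]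
    have e2 : η t ⬝ᵥ P.L₁.mulVec (incoming c)
        = P.L₁.transpose.mulVec (η t) ⬝ᵥ incoming c := by
      rw [Matrix.mulVec_transpose, Matrix.dotProduct_mulVec]
    rw [e1]
    simp only [dotProduct_sub, dotProduct_add] at e2 ⊢
    rw [e2, hin]
    simp only [dotProduct_add, add_dotProduct]
    simp only [dotProduct]
    ring
  have hcont : ContinuousOn (fun t => P.weakRate ki Ki d ψ η t (v t)) (Icc 0 T) :=
    P.continuousOn_weakRate hψ d (hvc.mono Icc_subset_Ici_self)
  rw [intervalIntegral.integral_eq_sub_of_hasDerivAt_of_le hT.le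
    (f := fun t => testPair ψ η t (v t)) (fun t ht => (hder t ht).continuousWithinAt)
    (fun t ht => (hder t (Ioo_subset_Icc_self ht)).hasDerivAt (Icc_mem_nhds ht.1 ht.2))
    (ContinuousOn.intervalIntegrable (by rwa [uIcc_of_le hT.le])), h0]

theorem continuous_testPair {T : ℝ} (ψ : ℝ → ℝ → Idx ℓ r → ℝ) (η : ℝ → Fin m → ℝ) :
    Continuous (testPair ψ η T) := by
  have e : testPair ψ η T = fun x : State ℓ r m =>
      ⟪toL2 (ψ T), x.1⟫ + ⟪(WithLp.toLp 2 (η T) : EuclideanSpace ℝ (Fin m)), x.2⟫ := by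
    funext x; rw [euclidean_inner_eq]; rfl
  rw [e]; fun_prop

/-- Limits of weak solutions that converge locally uniformly are weak solutions. -/
theorem isWeakSolution_of_tendsto {d : Exo ℓ r m} {v₀ : State ℓ r m} {v : ℝ → State ℓ r m}
    {x : ℕ → State ℓ r m} {w : ℕ → ℝ → State ℓ r m}
    (hw : ∀ n, P.IsWeakSolution ki Ki d (x n) (w n)) (h0 : v 0 = v₀) (hv : ContinuousOn v (Ici 0))
    (hx : Tendsto x atTop (𝓝 v₀)) (hlim : ∀ t ∈ Ici (0 : ℝ), Tendsto (fun n => w n t) atTop (𝓝 (v t)))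
    (hb : ∀ T : ℝ, ∃ C, ∀ n, ∀ t ∈ Icc (0 : ℝ) T, ‖w n t‖ ≤ C) :
    P.IsWeakSolution ki Ki d v₀ v := by
  simp only [isWeakSolution_iff] at hw ⊢
  refine ⟨h0, hv, fun T hT ψ η hψ => ?_⟩
  have h1 : Tendsto (fun n => testPair ψ η T (w n T) - testPair ψ η 0 (x n)) atTop
      (𝓝 (testPair ψ η T (v T) - testPair ψ η 0 v₀)) :=
    (((continuous_testPair ψ η).tendsto _).comp (hlim T hT.le)).sub
      (((continuous_testPair ψ η).tendsto _).comp hx)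
  refine tendsto_nhds_unique h1 ?_
  simp only [fun n => (hw n).2.2 T hT ψ η hψ]
  obtain ⟨C, hC⟩ := hb T
  -- The integrand is affine in the state, with representatives of its linear part that are
  -- continuous in time. They give the uniform bound for dominated convergence.
  have hlin : ∀ t, ∃ β : EuclideanSpace ℝ (Fin m), ∀ y : State ℓ r m,
      P.weakRate ki Ki d ψ η t y = ⟪toL2 (P.adjointExpr ψ t), y.1⟫ + ⟪β, y.2⟫
        + P.weakRate ki Ki d ψ η t 0 := by
    intro t
    refine ⟨WithLp.toLp 2 (deriv η t + (P.B * (ki • Ki)).transpose.mulVec (P.testFlux ψ η t)),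
      fun y => ?_⟩
    have e : P.testFlux ψ η t ⬝ᵥ P.B.mulVec (ki • Ki.mulVec y.2.ofLp)
        = (P.B * (ki • Ki)).transpose.mulVec (P.testFlux ψ η t) ⬝ᵥ y.2.ofLp := by
      rw [Matrix.mulVec_transpose, ← Matrix.dotProduct_mulVec, ← Matrix.mulVec_mulVec,
        Matrix.smul_mulVec]
    rw [euclidean_inner_eq]
    simp only [weakRate, dotProduct_add, add_dotProduct, e]
    simp
    ring
  choose β hβ using hlin
  have hcA : Continuous fun t => toL2 (P.adjointExpr ψ t) :=
    continuous_toL2 (P.continuousOn_adjoint hψ.1)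
  have hc0 : ContinuousOn (fun t => P.weakRate ki Ki d ψ η t 0) univ :=
    P.continuousOn_weakRate hψ d continuousOn_const
  have hcβ : Continuous β := by
    have : ∀ j, Continuous fun t => β t j := by
      intro j
      have e : ∀ t, β t j = P.weakRate ki Ki d ψ η t (0, EuclideanSpace.single j 1)
          - P.weakRate ki Ki d ψ η t 0 := by
        intro t
        rw [hβ t (0, EuclideanSpace.single j 1)]
        simp [EuclideanSpace.inner_single_right]
      simp only [e]
      exact (continuousOn_univ.mp (P.continuousOn_weakRate hψ d continuousOn_const)).sub
        (continuousOn_univ.mp hc0)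
    exact (PiLp.continuous_toLp 2 _).comp (continuous_pi this)
  obtain ⟨a₁, ha₁⟩ := isCompact_Icc.exists_bound_of_continuousOn (s := Icc 0 T) hcA.continuousOn
  obtain ⟨a₂, ha₂⟩ := isCompact_Icc.exists_bound_of_continuousOn (s := Icc 0 T) hcβ.continuousOn
  obtain ⟨a₃, ha₃⟩ := isCompact_Icc.exists_bound_of_continuousOn (s := Icc 0 T)
    (hc0.mono (subset_univ _))
  refine intervalIntegral.tendsto_integral_filter_of_dominated_convergence
    (fun _ => a₁ * C + a₂ * C + a₃) ?_ ?_ intervalIntegrable_const ?_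
  · refine Eventually.of_forall fun n => ?_
    rw [uIoc_of_le hT.le]
    exact (P.continuousOn_weakRate hψ d ((hw n).2.1.mono
      (fun t ht => le_of_lt ht.1 : Ioc 0 T ⊆ Ici 0))).aestronglyMeasurable measurableSet_Ioc
  · refine Eventually.of_forall fun n => Eventually.of_forall fun t ht => ?_
    rw [uIoc_of_le hT.le] at ht
    have ht' := Ioc_subset_Icc_self ht
    rw [hβ t]
    have hCn := hC n t ht'
    refine norm_add₃_le.trans (add_le_add (add_le_add ?_ ?_) (ha₃ t ht'))
    · refine (norm_inner_le_norm _ _).trans (mul_le_mul (ha₁ t ht') ((norm_fst_le _).trans hCn)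
        (norm_nonneg _) ((norm_nonneg _).trans (ha₁ t ht')))
    · refine (norm_inner_le_norm _ _).trans (mul_le_mul (ha₂ t ht') ((norm_snd_le _).trans hCn)
        (norm_nonneg _) ((norm_nonneg _).trans (ha₂ t ht')))
  · refine Eventually.of_forall fun t ht => ?_
    rw [uIoc_of_le hT.le] at ht
    have hl := hlim t ht.1.le
    have hc : Continuous fun y => P.weakRate ki Ki d ψ η t y := by
      rw [show (fun y => P.weakRate ki Ki d ψ η t y) = _ from funext (hβ t)]
      fun_prop
    exact (hc.tendsto _).comp hl

end Plant

/-! ## Regularity of the weak generator -/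

/-- Lemma of du Bois-Reymond. -/
theorem ae_eq_const_of_integral_mul_eq_zero {W : ℝ → ℝ}
    (hW : Integrable W (volume.restrict (Ioo (0 : ℝ) 1)))
    (h : ∀ g : ℝ → ℝ, Continuous g → ∫ s in (0 : ℝ)..1, g s = 0 →
      ∫ s in Ioo (0 : ℝ) 1, g s * W s = 0) :
    ∀ᵐ s ∂(volume.restrict (Ioo (0 : ℝ) 1)), W s = ∫ s in Ioo (0 : ℝ) 1, W s := by
  set k := ∫ s in Ioo (0 : ℝ) 1, W s
  have key : ∀ᵐ s ∂(volume : Measure ℝ), s ∈ Ioo (0 : ℝ) 1 → W s - k = 0 := by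
    refine isOpen_Ioo.ae_eq_zero_of_integral_contDiff_smul_eq_zero (f := fun s => W s - k)
      ?_ fun g hg _ hsupp => ?_
    · exact (show IntegrableOn (fun s => W s - k) (Ioo 0 1) volume from
        hW.sub (integrable_const k)).locallyIntegrableOn
    · have hgc := hg.continuous
      set a := ∫ s in (0 : ℝ)..1, g s
      have ha : ∫ s in Ioo (0 : ℝ) 1, g s = a := by
        rw [← integral_Ioc_eq_integral_Ioo, ← intervalIntegral.integral_of_le zero_le_one]
      obtain ⟨C, hC⟩ := isCompact_Icc.exists_bound_of_continuousOn
        (s := Icc (0 : ℝ) 1) hgc.continuousOn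
      have hgI : Integrable g (volume.restrict (Ioo (0 : ℝ) 1)) :=
        (memLp_of_continuousOn hgc.continuousOn).integrable (by norm_num)
      have hgW : Integrable (fun s => g s * W s) (volume.restrict (Ioo (0 : ℝ) 1)) := by
        refine hW.bdd_mul (c := C) hgc.aestronglyMeasurable ?_
        filter_upwards [ae_restrict_mem measurableSet_Ioo] with s hs
        exact hC s (Ioo_subset_Icc_self hs)
      -- An arbitrary test function becomes admissible after its mean is subtracted.
      have h1 := h (fun s => g s - a) (hgc.sub continuous_const) (by
        rw [intervalIntegral.integral_sub (hgc.intervalIntegrable _ _)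
          intervalIntegrable_const]
        simp [a])
      simp only [sub_mul] at h1
      rw [integral_sub hgW (hW.const_mul a), integral_const_mul] at h1
      rw [← setIntegral_eq_integral_of_forall_compl_eq_zero (s := Ioo (0 : ℝ) 1)
        (fun s hs => by
          rw [image_eq_zero_of_notMem_tsupport fun hh => hs (hsupp hh), zero_smul])]
      simp only [smul_eq_mul, mul_sub]
      rw [integral_sub hgW (hgI.mul_const k), integral_mul_const, ha]
      linarith
  filter_upwards [(ae_restrict_iff' measurableSet_Ioo).mpr key] with s hs
  linarith

theorem integrable_dotProduct {f : ℝ → Idx ℓ r → ℝ}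
    (hf : ∀ i, ContinuousOn (fun s => f s i) (Icc 0 1)) (g : L2 ℓ r) :
    Integrable (fun s => f s ⬝ᵥ (g s).ofLp) (volume.restrict (Ioo (0 : ℝ) 1)) := by
  have : Integrable (fun s => (toL2 f s).ofLp ⬝ᵥ (g s).ofLp)
      (volume.restrict (Ioo (0 : ℝ) 1)) :=
    integrable_finsetSum _ fun i _ => L2.integrable_eval_mul _ _ i i
  refine this.congr ?_
  filter_upwards [toL2_coe hf] with s hs
  rw [hs]

namespace Plant

variable (P : Plant ℓ r m) {ki : ℝ} {Ki : Matrix (Fin m) (Fin m) ℝ}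

/-- The adjoint boundary condition for a test function independent of time. -/
def StatTest (ψ : ℝ → Idx ℓ r → ℝ) (η : Fin m → ℝ) : Prop :=
  ContDiff ℝ 1 ψ ∧
    outgoing (fun s i => |P.lam i s| * ψ s i) =
      P.K.transpose.mulVec
        (incoming (fun s i => |P.lam i s| * ψ s i) + P.L₁.transpose.mulVec η)
      + P.L₂.transpose.mulVec η

/-- Weak form of `A x = y` for the generator `A` of the homogeneous closed loop. -/
def WeakGen (ki : ℝ) (Ki : Matrix (Fin m) (Fin m) ℝ) (x y : State ℓ r m) : Prop :=
  ∀ ψ η, P.StatTest ψ η → ⟪toL2 ψ, y.1⟫ + η ⬝ᵥ y.2.ofLp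
    = ⟪toL2 (P.statAdjoint ψ), x.1⟫
      + (incoming (fun s i => |P.lam i s| * ψ s i) + P.L₁.transpose.mulVec η)
        ⬝ᵥ P.B.mulVec (ki • Ki.mulVec x.2.ofLp)

/-- Test functions with one nonzero component isolate the equation for that component. -/
theorem statAdjoint_single_dotProduct {Ψ h : ℝ → ℝ} {s : ℝ} (hs : s ∈ Icc (0 : ℝ) 1)
    (hΨ : HasDerivAt Ψ (h s) s) (i : Idx ℓ r) (x : Idx ℓ r → ℝ) :
    P.statAdjoint (fun s => Pi.single i (Ψ s)) s ⬝ᵥ x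
      = (derivWithin (P.lam i) (Icc 0 1) s * Ψ s + P.lam i s * h s) * x i
        - Ψ s * (P.Lam1 s).mulVec x i := by
  have hu := uniqueDiffOn_Icc (zero_lt_one (α := ℝ)) s hs
  have h1 : P.statAdjoint (fun s => Pi.single i (Ψ s)) s
      = Pi.single i (derivWithin (P.lam i) (Icc 0 1) s * Ψ s + P.lam i s * h s)
        - (P.Lam1 s).transpose.mulVec (Pi.single i (Ψ s)) := by
    funext j
    simp only [statAdjoint, Pi.sub_apply]
    congr 1
    by_cases hj : j = i
    · subst hj
      simp only [Pi.single_eq_same]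
      have hl := ((P.lam_C1 j).differentiableOn one_ne_zero s hs).hasDerivWithinAt
      exact (hl.mul hΨ.hasDerivWithinAt).derivWithin hu
    · simp [Pi.single_eq_of_ne hj]
  rw [h1, sub_dotProduct, single_dotProduct, Matrix.mulVec_transpose, ← Matrix.dotProduct_mulVec,
    single_dotProduct]

/-- Regularity: the flux components of `x` are absolutely continuous. -/
theorem exists_isH1_of_weakGen {x y : State ℓ r m} (hxy : P.WeakGen ki Ki x y) :
    ∃ (f : L2 ℓ r) (c : ℝ → Idx ℓ r → ℝ), IsH1 x.1 f c ∧
      ∀ᵐ s ∂(volume.restrict (Ioo (0 : ℝ) 1)),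
        (y.1 s).ofLp + (P.Lam0 s).mulVec (f s).ofLp + (P.Lam1 s).mulVec (x.1 s).ofLp = 0 := by
  set Z : L2 ℓ r := y.1 + mulOp P.Lam1 x.1
  have hZ : ∀ᵐ s ∂(volume.restrict (Ioo (0 : ℝ) 1)),
      (Z s).ofLp = (y.1 s).ofLp + (P.Lam1 s).mulVec (x.1 s).ofLp := by
    filter_upwards [L2.coe_add y.1 (mulOp P.Lam1 x.1), mulOp_coe P.continuousOn_Lam1 x.1]
      with s h1 h2
    rw [h1, h2]
  have hlam' : ∀ i, ContinuousOn (derivWithin (P.lam i) (Icc 0 1)) (Icc 0 1) := fun i =>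
    (P.lam_C1 i).continuousOn_derivWithin (uniqueDiffOn_Icc zero_lt_one) le_rfl
  -- The equation `λ x' = -Z` means `(λ x)' = λ' x - Z = -g`, so the claim becomes that `λ x + ∫ g`
  -- is constant.
  set g : Idx ℓ r → ℝ → ℝ := fun i s => Z s i - derivWithin (P.lam i) (Icc 0 1) s * x.1 s i
  have hgm : ∀ i, MemLp (g i) 2 (volume.restrict (Ioo (0 : ℝ) 1)) := by
    intro i
    have := memLp_add_mul (f := x.1) (i := i) (hlam' i) (continuousOn_const (c := (0 : ℝ)))
    simp only [add_zero] at this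
    exact (Z.memLp_eval i).sub this
  have hG : ∀ i, IsPrim (fun s => ∫ t in (0 : ℝ)..s, g i t) (g i) := fun i =>
    isPrim_primitive (intervalIntegrable_of_integrable_Ioo ((hgm i).integrable (by norm_num)))
  set G : Idx ℓ r → ℝ → ℝ := fun i s => ∫ t in (0 : ℝ)..s, g i t
  have hW : ∀ i, Integrable (fun s => P.lam i s * x.1 s i + G i s)
      (volume.restrict (Ioo (0 : ℝ) 1)) := fun i =>
    (memLp_add_mul (P.continuousOn_lam i) (hG i).continuousOn).integrable (by norm_num)
  have hconst : ∀ i, ∀ᵐ s ∂(volume.restrict (Ioo (0 : ℝ) 1)),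
      P.lam i s * x.1 s i + G i s
        = ∫ s in Ioo (0 : ℝ) 1, (P.lam i s * x.1 s i + G i s) := by
    intro i
    refine ae_eq_const_of_integral_mul_eq_zero (hW i) fun h hh hh0 => ?_
    -- The primitive of a mean-zero function vanishes at both ends, so with `η = 0` it meets the
    -- adjoint boundary condition trivially.
    set Ψ : ℝ → ℝ := fun s => ∫ t in (0 : ℝ)..s, h t
    have hΨd : ∀ s, HasDerivAt Ψ (h s) s := fun s =>
      intervalIntegral.integral_hasDerivAt_right (hh.intervalIntegrable _ _)
        (hh.stronglyMeasurableAtFilter _ _) hh.continuousAt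
    have hΨ1 : ContDiff ℝ 1 Ψ := by
      rw [contDiff_one_iff_deriv]
      refine ⟨fun s => (hΨd s).differentiableAt, ?_⟩
      rw [show deriv Ψ = h from funext fun s => (hΨd s).deriv]
      exact hh
    have hΨz : Ψ 0 = 0 := by simp [Ψ]
    have hΨo : Ψ 1 = 0 := hh0
    set ψ : ℝ → Idx ℓ r → ℝ := fun s => Pi.single i (Ψ s)
    have hψ : ContDiff ℝ 1 ψ := by
      rw [contDiff_pi]
      intro j
      by_cases hj : j = i
      · subst hj; simpa [ψ] using hΨ1
      · simpa [ψ, Pi.single_eq_of_ne hj] using contDiff_const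
    have hψc : ∀ j, ContinuousOn (fun s => ψ s j) (Icc 0 1) := fun j =>
      (contDiff_pi.mp hψ j).continuous.continuousOn
    have hin : incoming (fun s i => |P.lam i s| * ψ s i) = 0 := by
      funext j; rcases j with j | j <;> simp [incoming, ψ, hΨz, hΨo]
    have hout : outgoing (fun s i => |P.lam i s| * ψ s i) = 0 := by
      funext j; rcases j with j | j <;> simp [outgoing, ψ, hΨz, hΨo]
    have htest : P.StatTest ψ 0 := ⟨hψ, by rw [hin, hout]; simp⟩
    have hw := hxy ψ 0 htest
    rw [hin] at hw
    simp only [zero_dotProduct, Matrix.mulVec_zero, add_zero] at hw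
    have hac := P.continuousOn_statAdjoint (ψ := ψ) fun j => (contDiff_pi.mp hψ j).contDiffOn
    rw [inner_toL2 hψc, inner_toL2 hac] at hw
    have hpr : IsPrim (fun s => Ψ s * G i s) (fun s => h s * G i s + Ψ s * g i s) :=
      (IsPrim.of_hasDerivWithinAt (fun s _ => (hΨd s).hasDerivWithinAt) hh.continuousOn).mul (hG i)
    have hpr0 := hpr.eq_sub
    rw [hΨz, hΨo] at hpr0
    simp only [zero_mul, sub_self] at hpr0
    have hprI : Integrable (fun s => h s * G i s + Ψ s * g i s)
        (volume.restrict (Ioo (0 : ℝ) 1)) :=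
      (intervalIntegrable_iff_integrableOn_Ioo_of_le zero_le_one).mp hpr.1
    have hsplit : ∫ s in Ioo (0 : ℝ) 1, h s * (P.lam i s * x.1 s i + G i s)
        = ∫ s in Ioo (0 : ℝ) 1, ((h s * G i s + Ψ s * g i s)
          + (P.statAdjoint ψ s ⬝ᵥ (x.1 s).ofLp - ψ s ⬝ᵥ (y.1 s).ofLp)) := by
      refine integral_congr_ae ?_
      filter_upwards [hZ, ae_restrict_mem measurableSet_Ioo] with s h1 hs
      rw [P.statAdjoint_single_dotProduct (Ioo_subset_Icc_self hs) (hΨd s), single_dotProduct]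
      simp only [g, h1, Pi.add_apply]
      ring
    have hI : Integrable (fun s => P.statAdjoint ψ s ⬝ᵥ (x.1 s).ofLp - ψ s ⬝ᵥ (y.1 s).ofLp)
        (volume.restrict (Ioo (0 : ℝ) 1)) :=
      (integrable_dotProduct hac _).sub (integrable_dotProduct hψc _)
    rw [hsplit, integral_add hprI hI, hpr0,
      integral_sub (integrable_dotProduct hac _) (integrable_dotProduct hψc _), hw]
    simp
  set k : Idx ℓ r → ℝ := fun i => ∫ s in Ioo (0 : ℝ) 1, (P.lam i s * x.1 s i + G i s)
  -- Dividing by `λᵢ`, which is `C¹` and nowhere zero on `[0,1]`, gives an absolutely continuous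
  -- representative.
  set c : ℝ → Idx ℓ r → ℝ := fun s i => (P.lam i s)⁻¹ * (k i - G i s)
  have hcx : ∀ᵐ s ∂(volume.restrict (Ioo (0 : ℝ) 1)), ∀ i, P.lam i s * x.1 s i = k i - G i s := by
    rw [ae_all_iff]
    intro i
    filter_upwards [hconst i] with s hs
    have : P.lam i s * x.1 s i + G i s = k i := hs
    linarith
  have hLinv : ∀ i j, ContinuousOn
      (fun s => Matrix.diagonal (fun i => (P.lam i s)⁻¹) i j) (Icc 0 1) :=
    continuousOn_diagonal P.continuousOn_inv_lam
  set f : L2 ℓ r := -mulOp (fun s => Matrix.diagonal fun i => (P.lam i s)⁻¹) Z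
  have hf : ∀ᵐ s ∂(volume.restrict (Ioo (0 : ℝ) 1)), ∀ i, f s i = -((P.lam i s)⁻¹ * Z s i) := by
    filter_upwards [mulOp_coe hLinv Z, L2.coe_smul (-1)
      (mulOp (fun s => Matrix.diagonal fun i => (P.lam i s)⁻¹) Z)] with s h1 h2 i
    rw [neg_one_smul] at h2
    rw [h2, h1, Pi.smul_apply, Matrix.mulVec_diagonal]
    simp
  refine ⟨f, c, isH1_iff.mpr ⟨fun i => ?_, ?_⟩, ?_⟩
  · have hinv : IsPrim (fun s => (P.lam i s)⁻¹)
        (fun s => -derivWithin (P.lam i) (Icc 0 1) s / P.lam i s ^ 2) := by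
      refine IsPrim.of_hasDerivWithinAt (fun s hs => ?_) ?_
      · exact ((P.lam_C1 i).differentiableOn one_ne_zero s hs).hasDerivWithinAt.fun_inv
          (P.lam_ne_zero i hs)
      · exact (hlam' i).neg.div ((P.continuousOn_lam i).pow 2)
          fun s hs => pow_ne_zero 2 (P.lam_ne_zero i hs)
    refine (hinv.mul ((IsPrim.const (k i)).add ((hG i).const_mul (-1)))).congr
      (fun s _ => by simp only [c, G]; ring) ?_
    filter_upwards [hcx, hf, ae_restrict_mem measurableSet_Ioo] with s h1 h2 hs
    have hl := P.lam_ne_zero i (Ioo_subset_Icc_self hs)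
    have h3 : k i + -1 * G i s = P.lam i s * x.1 s i := by rw [h1 i]; ring
    rw [h2 i]
    have h3' : k i + -1 * ∫ t in (0 : ℝ)..s, g i t = P.lam i s * x.1 s i := h3
    rw [h3']
    simp only [g]
    field_simp
    ring
  · filter_upwards [hcx, ae_restrict_mem measurableSet_Ioo] with s h1 hs
    funext i
    have hl := P.lam_ne_zero i (Ioo_subset_Icc_self hs)
    simp only [c]
    rw [← h1 i]
    field_simp
  · filter_upwards [hf, hZ, ae_restrict_mem measurableSet_Ioo] with s h1 h2 hs
    funext i
    have hl := P.lam_ne_zero i (Ioo_subset_Icc_self hs)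
    simp only [Pi.add_apply, Pi.zero_apply]
    rw [Lam0, Matrix.mulVec_diagonal, h1 i, h2, Pi.add_apply]
    field_simp
    ring

/-- The incoming flux `q` is free and the outgoing one is forced. Affine interpolation between the
end values realises both, so traces can be tested against arbitrary `q` and `η`. -/
theorem exists_statTest (q : Idx ℓ r → ℝ) (η : Fin m → ℝ) :
    ∃ ψ, P.StatTest ψ η ∧ incoming (fun s i => |P.lam i s| * ψ s i) = q := by
  set p := P.K.transpose.mulVec (q + P.L₁.transpose.mulVec η) + P.L₂.transpose.mulVec η
  let ψ : ℝ → Idx ℓ r → ℝ := fun s =>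
    Sum.elim
      (fun i => (1 - s) * (|P.lam (Sum.inl i) 0|⁻¹ * q (Sum.inl i))
        + s * (|P.lam (Sum.inl i) 1|⁻¹ * p (Sum.inl i)))
      (fun i => (1 - s) * (|P.lam (Sum.inr i) 0|⁻¹ * p (Sum.inr i))
        + s * (|P.lam (Sum.inr i) 1|⁻¹ * q (Sum.inr i)))
  have m0 : (0 : ℝ) ∈ Icc (0 : ℝ) 1 := ⟨le_rfl, zero_le_one⟩
  have m1 : (1 : ℝ) ∈ Icc (0 : ℝ) 1 := ⟨zero_le_one, le_rfl⟩
  have n0 : ∀ i, |P.lam i 0| ≠ 0 := fun i => abs_ne_zero.mpr (P.lam_ne_zero i m0)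
  have n1 : ∀ i, |P.lam i 1| ≠ 0 := fun i => abs_ne_zero.mpr (P.lam_ne_zero i m1)
  have hin : incoming (fun s i => |P.lam i s| * ψ s i) = q := by
    funext j
    rcases j with j | j
    · simp [incoming, ψ, mul_inv_cancel_left₀ (n0 _)]
    · simp [incoming, ψ, mul_inv_cancel_left₀ (n1 _)]
  have hout : outgoing (fun s i => |P.lam i s| * ψ s i) = p := by
    funext j
    rcases j with j | j
    · simp [outgoing, ψ, mul_inv_cancel_left₀ (n1 _)]
    · simp [outgoing, ψ, mul_inv_cancel_left₀ (n0 _)]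
  refine ⟨ψ, ⟨?_, ?_⟩, hin⟩
  · rw [contDiff_pi]
    rintro (j | j)
    · simp only [ψ, Sum.elim_inl]; fun_prop
    · simp only [ψ, Sum.elim_inr]; fun_prop
  · rw [hin, hout]

/-- The weak form of `A x = y` implies `A x = y`. -/
theorem mem_genGraph_of_weakGen {x y : State ℓ r m} (hxy : P.WeakGen ki Ki x y) :
    (x, y) ∈ P.genGraph ki Ki := by
  obtain ⟨f, c, hc, he⟩ := P.exists_isH1_of_weakGen hxy
  set u := P.B.mulVec (ki • Ki.mulVec x.2.ofLp)
  -- Comparing the weak form with integration by parts removes all interior terms. Then `η = 0`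
  -- yields the boundary condition and `q = 0` the output equation.
  have key : ∀ q η, η ⬝ᵥ y.2.ofLp = (q + P.L₁.transpose.mulVec η)
      ⬝ᵥ (P.K.mulVec (outgoing c) + u) + η ⬝ᵥ P.L₂.mulVec (outgoing c) - q ⬝ᵥ incoming c := by
    intro q η
    obtain ⟨ψ, hψ, hq⟩ := P.exists_statTest q η
    have h1 := hxy ψ η hψ
    have h2 := P.inner_test_eq (fun i => (contDiff_pi.mp hψ.1 i).contDiffOn) hc he
    rw [hψ.2] at h2
    rw [h2, hq] at h1
    have e1 : (P.K.transpose.mulVec (q + P.L₁.transpose.mulVec η)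
        + P.L₂.transpose.mulVec η) ⬝ᵥ outgoing c
        = (q + P.L₁.transpose.mulVec η) ⬝ᵥ P.K.mulVec (outgoing c)
          + η ⬝ᵥ P.L₂.mulVec (outgoing c) := by
      rw [add_dotProduct, Matrix.mulVec_transpose, Matrix.mulVec_transpose P.L₂,
        ← Matrix.dotProduct_mulVec, ← Matrix.dotProduct_mulVec]
    rw [e1] at h1
    rw [dotProduct_add]
    linarith
  have hbc : incoming c = P.K.mulVec (outgoing c) + u := by
    refine dotProduct_eq _ _ fun q => ?_
    have h := key q 0
    simp only [Matrix.mulVec_zero, zero_dotProduct, add_zero] at h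
    rw [dotProduct_comm, dotProduct_comm _ q]
    linarith
  refine ⟨f, c, hc, ?_, he, ?_⟩
  · simp only [BoundaryCondition, zeroExo, add_zero]
    exact hbc
  · refine dotProduct_eq _ _ fun η => ?_
    have h := key 0 η
    rw [← hbc, zero_add, zero_dotProduct, sub_zero, Matrix.mulVec_transpose,
      ← Matrix.dotProduct_mulVec] at h
    rw [dotProduct_comm, dotProduct_comm _ η, h]
    simp only [output, zeroExo, add_zero, sub_zero, dotProduct_add]

end Plant

/-! ## Well-posedness -/

namespace Plant

variable (P : Plant ℓ r m) {ki : ℝ} {Ki : Matrix (Fin m) (Fin m) ℝ}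

/-- Being continuous and linear in the state, the functional can be exchanged with the time integral
in `weakGen_integral`. -/
theorem exists_continuousLinearMap_weakRate (ψ : ℝ → Idx ℓ r → ℝ) (q : Idx ℓ r → ℝ) :
    ∃ F : State ℓ r m →L[ℝ] ℝ, ∀ x, F x = ⟪toL2 (P.statAdjoint ψ), x.1⟫
      + q ⬝ᵥ P.B.mulVec (ki • Ki.mulVec x.2.ofLp) := by
  let β : EuclideanSpace ℝ (Fin m) := WithLp.toLp 2 ((P.B * (ki • Ki)).transpose.mulVec q)
  refine ⟨(innerSL ℝ (toL2 (P.statAdjoint ψ))).comp (ContinuousLinearMap.fst ℝ _ _)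
    + (innerSL ℝ β).comp (ContinuousLinearMap.snd ℝ _ _), fun x => ?_⟩
  have e : q ⬝ᵥ P.B.mulVec (ki • Ki.mulVec x.2.ofLp) = ⟪β, x.2⟫ := by
    rw [euclidean_inner_eq]
    change _ = (P.B * (ki • Ki)).transpose.mulVec q ⬝ᵥ x.2.ofLp
    rw [Matrix.mulVec_transpose, ← Matrix.dotProduct_mulVec,
      ← Matrix.mulVec_mulVec, Matrix.smul_mulVec]
  rw [e]
  rfl

theorem isTest_const {ψ : ℝ → Idx ℓ r → ℝ} {η : Fin m → ℝ} (h : P.StatTest ψ η) (T : ℝ) :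
    P.IsTest T (fun _ => ψ) (fun _ => η) :=
  ⟨h.1.comp contDiff_snd, contDiff_const, fun _ _ => h.2⟩

/-- The time integral of the difference of two weak solutions is in the domain of the generator,
in the weak sense. -/
theorem weakGen_integral {d : Exo ℓ r m} {v₀ : State ℓ r m} {v₁ v₂ : ℝ → State ℓ r m}
    (h₁ : P.IsWeakSolution ki Ki d v₀ v₁) (h₂ : P.IsWeakSolution ki Ki d v₀ v₂)
    {T : ℝ} (hT : 0 < T) :
    P.WeakGen ki Ki (∫ t in (0 : ℝ)..T, (v₁ t - v₂ t)) (v₁ T - v₂ T) := by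
  rw [isWeakSolution_iff] at h₁ h₂
  intro ψ η hψ
  have ht := P.isTest_const hψ T
  have hsub : Icc 0 T ⊆ Ici (0 : ℝ) := Icc_subset_Ici_self
  obtain ⟨F, hF⟩ := P.exists_continuousLinearMap_weakRate (ki := ki) (Ki := Ki) ψ
    (incoming (fun s i => |P.lam i s| * ψ s i) + P.L₁.transpose.mulVec η)
  have hi : ∀ {w : ℝ → State ℓ r m}, ContinuousOn w (Ici 0) →
      IntervalIntegrable w volume 0 T := fun hw =>
    ContinuousOn.intervalIntegrable (by rw [uIcc_of_le hT.le]; exact hw.mono hsub)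
  have hri : ∀ {w : ℝ → State ℓ r m}, ContinuousOn w (Ici 0) → IntervalIntegrable
      (fun t => P.weakRate ki Ki d (fun _ => ψ) (fun _ => η) t (w t)) volume 0 T := fun hw =>
    ContinuousOn.intervalIntegrable (by
      rw [uIcc_of_le hT.le]; exact P.continuousOn_weakRate ht d (hw.mono hsub))
  have hadj : ∀ t, P.adjointExpr (fun _ => ψ) t = P.statAdjoint ψ := fun t => by
    funext s i
    simp [adjointExpr, statAdjoint]
  have e1 := h₁.2.2 T hT _ _ ht
  have e2 := h₂.2.2 T hT _ _ ht
  rw [← hF, ← F.intervalIntegral_comp_comm ((hi h₁.2.1).sub (hi h₂.2.1))]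
  -- The exogenous terms cancel in the difference, and a constant test function has no time
  -- derivative.
  have e3 : ∀ t, F (v₁ t - v₂ t) = P.weakRate ki Ki d (fun _ => ψ) (fun _ => η) t (v₁ t)
      - P.weakRate ki Ki d (fun _ => ψ) (fun _ => η) t (v₂ t) := by
    intro t
    rw [map_sub, hF, hF]
    simp only [weakRate, hadj, testFlux, deriv_const, dotProduct_add, zero_dotProduct]
    ring
  simp only [e3]
  rw [intervalIntegral.integral_sub (hri h₁.2.1) (hri h₂.2.1), ← e1, ← e2]
  simp only [testPair, Prod.fst_sub, Prod.snd_sub, inner_sub_right, WithLp.ofLp_sub,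
    dotProduct_sub]
  ring

/-- Weak solutions are unique. -/
theorem IsWeakSolution.eqOn {P : Plant ℓ r m} {d : Exo ℓ r m} {v₀ : State ℓ r m}
    {v₁ v₂ : ℝ → State ℓ r m} (h₁ : P.IsWeakSolution ki Ki d v₀ v₁)
    (h₂ : P.IsWeakSolution ki Ki d v₀ v₂) : EqOn v₁ v₂ (Ici 0) := by
  set w : ℝ → State ℓ r m := fun t => v₁ (max t 0) - v₂ (max t 0)
  have hmax : ∀ t ∈ Ici (0 : ℝ), max t 0 = t := fun t ht => max_eq_left ht
  have hw : Continuous w := by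
    have hm : Continuous fun t : ℝ => max t 0 := by fun_prop
    exact (h₁.2.1.comp_continuous hm fun t => mem_Ici.mpr (le_max_right _ _)).sub
      (h₂.2.1.comp_continuous hm fun t => mem_Ici.mpr (le_max_right _ _))
  have hw' : ∀ t ∈ Ici (0 : ℝ), w t = v₁ t - v₂ t := fun t ht => by simp only [w, hmax t ht]
  obtain ⟨Q, κ, ω, hE⟩ := P.exists_isEnergy ki Ki
  have hd : ∀ t : ℝ, HasDerivAt (fun t => ∫ τ in (0 : ℝ)..t, w τ) (w t) t := fun t =>
    intervalIntegral.integral_hasDerivAt_right (hw.intervalIntegrable _ _)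
      (hw.stronglyMeasurableAtFilter _ _) hw.continuousAt
  -- The integral of `w` is a solution with values in the domain even though `w` itself is only
  -- continuous. At `t = 0`, where `weakGen_integral` does not apply, `w` vanishes because the
  -- initial states agree.
  have hV := hE.eq_zero_of_solution (V := fun t => ∫ τ in (0 : ℝ)..t, w τ) (V' := w)
    (by simp) (fun t _ => (hd t).hasDerivWithinAt) (fun t ht => by
      rcases eq_or_lt_of_le (mem_Ici.mp ht) with h0 | h0
      · subst h0
        have e : w 0 = 0 := by rw [hw' 0 ht, h₁.1, h₂.1, sub_self]
        rw [intervalIntegral.integral_same, e]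
        exact Submodule.zero_mem _
      · rw [hw' t ht, intervalIntegral.integral_congr (g := fun t => v₁ t - v₂ t) (fun τ hτ => by
          rw [uIcc_of_le h0.le] at hτ
          exact hw' τ hτ.1)]
        exact P.mem_genGraph_of_weakGen (P.weakGen_integral h₁ h₂ h0))
  intro t ht
  have h1 : HasDerivWithinAt (fun _ => (0 : State ℓ r m)) (w t) (Ici 0) t :=
    (hd t).hasDerivWithinAt.congr (fun τ hτ => (hV τ hτ).symm) (hV t ht).symm
  have h2 := (uniqueDiffOn_Ici (0 : ℝ) t ht).eq_deriv _ h1 (hasDerivWithinAt_const t (Ici 0) _)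
  rw [hw' t ht] at h2
  exact sub_eq_zero.mp h2

theorem exists_closedLoopAt_of_isCompatible {d : Exo ℓ r m} {v : State ℓ r m}
    (h : P.IsCompatible ki Ki d v) : ∃ f v', P.ClosedLoopAt ki Ki d v f v' := by
  obtain ⟨f, c, hc, hb⟩ := h
  refine ⟨f, (-mulOp P.Lam0 f - mulOp P.Lam1 v.1, WithLp.toLp 2 (P.output d c - d.yref)),
    c, hc, hb, ?_, rfl⟩
  simp only
  filter_upwards [L2.coe_sub (-mulOp P.Lam0 f) (mulOp P.Lam1 v.1),
    L2.coe_smul (-1) (mulOp P.Lam0 f),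
    mulOp_coe (M := P.Lam0) (continuousOn_diagonal P.continuousOn_lam) f,
    mulOp_coe P.continuousOn_Lam1 v.1] with s h1 h2 h3 h4
  rw [neg_one_smul] at h2
  rw [h1, h2, h3, h4, neg_one_smul]
  abel

/-- The space derivative as a function of the state and its time derivative. -/
theorem ClosedLoopAt.space_deriv_eq {P : Plant ℓ r m} {d : Exo ℓ r m} {v v' : State ℓ r m}
    {f : L2 ℓ r} (h : P.ClosedLoopAt ki Ki d v f v') :
    f = -mulOp (fun s => Matrix.diagonal fun i => (P.lam i s)⁻¹) (v'.1 + mulOp P.Lam1 v.1) := by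
  obtain ⟨c, -, -, he, -⟩ := h
  refine L2.ext_ae ?_
  filter_upwards [he, L2.coe_smul (-1) (mulOp (fun s => Matrix.diagonal fun i => (P.lam i s)⁻¹)
      (v'.1 + mulOp P.Lam1 v.1)),
    mulOp_coe (continuousOn_diagonal P.continuousOn_inv_lam) (v'.1 + mulOp P.Lam1 v.1),
    L2.coe_add v'.1 (mulOp P.Lam1 v.1), mulOp_coe P.continuousOn_Lam1 v.1,
    ae_restrict_mem measurableSet_Ioo] with s h1 h2 h3 h4 h5 hs
  rw [neg_one_smul] at h2
  rw [h2, h3, h4, h5]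
  funext i
  have hl := P.lam_ne_zero i (Ioo_subset_Icc_self hs)
  have h6 := congrFun h1 i
  simp only [Pi.add_apply, Pi.zero_apply, Lam0, Matrix.mulVec_diagonal] at h6
  rw [Pi.smul_apply, Matrix.mulVec_diagonal, Pi.add_apply]
  simp only [smul_eq_mul]
  field_simp
  linarith

/-- Solutions starting in the domain of the generator are strong. -/
theorem isStrongSolution_of_mem_genGraph {T : ℝ → State ℓ r m →L[ℝ] State ℓ r m}
    (hT0 : T 0 = 1) (hTc : ∀ x, Continuous fun t => T t x)
    (hTd : ∀ x y, (x, y) ∈ P.genGraph ki Ki → ∀ t ∈ Ici (0 : ℝ),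
      HasDerivWithinAt (fun t => T t x) (T t y) (Ici 0) t ∧ (T t x, T t y) ∈ P.genGraph ki Ki)
    {d : Exo ℓ r m} {v x y : State ℓ r m} (hv : P.IsEquilibrium ki Ki d v)
    (hxy : (x, y) ∈ P.genGraph ki Ki) :
    P.IsStrongSolution ki Ki d (v + x) (fun t => v + T t x) := by
  obtain ⟨f, hf⟩ := hv
  have hcl : ∀ t ∈ Ici (0 : ℝ), ∃ g, P.ClosedLoopAt ki Ki d (v + T t x) g (T t y) := by
    intro t ht
    obtain ⟨g, hg⟩ := (hTd x y hxy t ht).2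
    have := ClosedLoopAt.combine (d := d) 1 1 (by simp [zeroExo]) (by simp [zeroExo]) hf hg
    simp only [one_smul, zero_add] at this
    exact ⟨_, this⟩
  -- The space derivative is given by a formula in the state and its time derivative, instead of
  -- being chosen for each `t`, so that it is continuous in time.
  refine ⟨fun t => -mulOp (fun s => Matrix.diagonal fun i => (P.lam i s)⁻¹)
    ((T t y).1 + mulOp P.Lam1 (v + T t x).1), fun t => T t y, by simp [hT0],
    (continuous_const.add (hTc x)).continuousOn, Continuous.continuousOn ?_,
    (hTc y).continuousOn, fun t ht => (hTd x y hxy t ht).1.const_add v, fun t ht => ?_⟩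
  · exact ((mulOp _).continuous.comp ((continuous_fst.comp (hTc y)).add ((mulOp _).continuous.comp
      (continuous_fst.comp (continuous_const.add (hTc x)))))).neg
  · obtain ⟨g, hg⟩ := hcl t ht
    have e := hg.space_deriv_eq
    rwa [e] at hg

/-- A closed loop with an equilibrium is well-posed. -/
theorem wellPosed_of_isEquilibrium {d : Exo ℓ r m} {v : State ℓ r m}
    (hv : P.IsEquilibrium ki Ki d v) : P.WellPosed ki Ki d := by
  obtain ⟨T, hT0, hTb, hTc, hTd⟩ := P.exists_semigroup ki Ki
  constructor
  · intro v₀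
    -- The orbit through `v₀ - v` is a limit of orbits that start in the domain; these are bounded
    -- on every `[0, τ]`.
    obtain ⟨x, hx, hlim⟩ := mem_closure_iff_seq_limit.mp
      (P.dense_domain (ki := ki) (Ki := Ki) (v₀ - v))
    choose y hy using hx
    have hweak : P.IsWeakSolution ki Ki d v₀ fun t => v + T t (v₀ - v) := by
      refine P.isWeakSolution_of_tendsto (x := fun n => v + x n) (w := fun n t => v + T t (x n))
        (fun n => P.isWeakSolution_of_isStrongSolution
          (P.isStrongSolution_of_mem_genGraph hT0 hTc hTd hv (hy n)))
        (by simp [hT0]) (continuous_const.add (hTc _)).continuousOn ?_ ?_ ?_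
      · simpa using (tendsto_const_nhds (x := v)).add hlim
      · intro t _
        exact tendsto_const_nhds.add (((T t).continuous.tendsto _).comp hlim)
      · intro τ
        obtain ⟨C, hC⟩ := hTb τ
        obtain ⟨R, hR⟩ := hlim.norm.bddAbove_range
        refine ⟨‖v‖ + C * R, fun n t ht => (norm_add_le _ _).trans ?_⟩
        have hRn : ‖x n‖ ≤ R := hR ⟨n, rfl⟩
        gcongr
        exact ((T t).le_opNorm _).trans
          (mul_le_mul (hC t ht) hRn (norm_nonneg _) ((norm_nonneg _).trans (hC t ht)))
    exact ⟨_, hweak, fun v₁ h₁ => h₁.eqOn hweak⟩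
  · intro v₀ hv₀
    obtain ⟨f₀, v₀', h₀⟩ := P.exists_closedLoopAt_of_isCompatible hv₀
    obtain ⟨f, hf⟩ := hv
    -- Subtracting the equilibrium removes the exogenous data, so compatibility becomes membership
    -- in the domain.
    have hmem : (v₀ - v, v₀') ∈ P.genGraph ki Ki := by
      have := ClosedLoopAt.combine (d := zeroExo) 1 (-1) (by simp [zeroExo]) (by simp [zeroExo])
        h₀ hf
      simp only [one_smul, neg_smul, neg_zero, add_zero, ← sub_eq_add_neg] at this
      exact ⟨_, this⟩
    have hs := P.isStrongSolution_of_mem_genGraph hT0 hTc hTd ⟨f, hf⟩ hmem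
    rw [add_sub_cancel] at hs
    have hweak := P.isWeakSolution_of_isStrongSolution hs
    exact ⟨_, hs, hweak, fun v₁ h₁ => (P.isWeakSolution_of_isStrongSolution h₁).eqOn hweak⟩

end Plant

/-! ## Fundamental matrix and equilibria -/

theorem isUnit_iff_rank_eq {n : Type*} [Fintype n] [DecidableEq n] {A : Matrix n n ℝ} :
    IsUnit A ↔ A.rank = Fintype.card n := by
  refine ⟨fun h => A.rank_of_isUnit h, fun h => ?_⟩
  rw [← Matrix.mulVec_surjective_iff_isUnit]
  have : LinearMap.range A.mulVecLin = ⊤ := Submodule.eq_top_of_finrank_eq (by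
    rw [Module.finrank_fintype_fun_eq_card, ← h]; rfl)
  exact LinearMap.range_eq_top.mp this

theorem incoming_congr {c d : ℝ → Idx ℓ r → ℝ} (h : EqOn c d (Icc 0 1)) :
    incoming c = incoming d := by
  simp only [incoming, h ⟨le_rfl, zero_le_one⟩, h ⟨zero_le_one, le_rfl⟩]

theorem outgoing_congr {c d : ℝ → Idx ℓ r → ℝ} (h : EqOn c d (Icc 0 1)) :
    outgoing c = outgoing d := by
  simp only [outgoing, h ⟨le_rfl, zero_le_one⟩, h ⟨zero_le_one, le_rfl⟩]

theorem IsPrim.sum {ι : Type*} (t : Finset ι) {u f : ι → ℝ → ℝ} (h : ∀ i, IsPrim (u i) (f i)) :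
    IsPrim (fun s => ∑ i ∈ t, u i s) (fun s => ∑ i ∈ t, f i s) := by
  classical
  induction t using Finset.induction_on with
  | empty => simpa using IsPrim.const 0
  | insert j t hj ih => simpa [Finset.sum_insert hj] using (h j).add ih

theorem quadForm_conj (A D E : Matrix (Idx ℓ r) (Idx ℓ r) ℝ) (x : Idx ℓ r → ℝ) :
    x ⬝ᵥ (A.transpose * D * E * A).mulVec x
      = A.mulVec x ⬝ᵥ (D * E).mulVec (A.mulVec x) := by
  rw [Matrix.mul_assoc A.transpose, Matrix.mul_assoc, ← Matrix.mulVec_mulVec,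
    ← Matrix.mulVec_mulVec, Matrix.dotProduct_mulVec, Matrix.vecMul_transpose]

namespace Plant

variable (P : Plant ℓ r m) {ki : ℝ} {Ki : Matrix (Fin m) (Fin m) ℝ}
  {Φ : ℝ → Matrix (Idx ℓ r) (Idx ℓ r) ℝ}

theorem neg_inv_Lam0_mul {s : ℝ} (hs : s ∈ Icc (0 : ℝ) 1) :
    -((P.Lam0 s)⁻¹ * P.Lam1 s * Φ s) = P.statMat 0 s * Φ s := by
  have hinv : (P.Lam0 s)⁻¹ = Matrix.diagonal fun i => (P.lam i s)⁻¹ := by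
    refine Matrix.inv_eq_right_inv ?_
    rw [Lam0, Matrix.diagonal_mul_diagonal, ← Matrix.diagonal_one]
    congr 1
    funext i
    exact mul_inv_cancel₀ (P.lam_ne_zero i hs)
  rw [hinv, ← Matrix.neg_mul]
  congr 1
  ext i j
  simp [statMat]

/-- The coefficients are continuous on `[0,1]`, so the differential and the integral form of the
system are equivalent. -/
theorem isFundamental_iff : P.IsFundamental Φ ↔
    Φ 0 = 1 ∧ ∀ i j, IsPrim (fun s => Φ s i j) (fun s => (P.statMat 0 s * Φ s) i j) := by
  have hcont : (∀ i j, ContinuousOn (fun s => Φ s i j) (Icc 0 1)) → ∀ i j,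
      ContinuousOn (fun s => (P.statMat 0 s * Φ s) i j) (Icc 0 1) := fun h i j => by
    simp only [Matrix.mul_apply]
    exact continuousOn_finsetSum _ fun k _ => (P.continuousOn_statMat 0 i k).mul (h k j)
  refine and_congr_right fun _ => ⟨fun h i j => ?_, fun h s hs i j => ?_⟩
  · refine IsPrim.of_hasDerivWithinAt (fun s hs => ?_)
      (hcont (fun i j s hs => (h s hs i j).continuousWithinAt) i j)
    rw [← P.neg_inv_Lam0_mul hs]
    exact h s hs i j
  · rw [P.neg_inv_Lam0_mul hs]
    exact (h i j).hasDerivWithinAt (hcont (fun i j => (h i j).continuousOn) i j) hs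

theorem exists_isFundamental : ∃ Φ, P.IsFundamental Φ := by
  obtain ⟨Φ, h⟩ := exists_fundamental (P.continuousOn_statMat 0)
  exact ⟨Φ, P.isFundamental_iff.mpr h⟩

/-- Stationary profiles are determined by their value at `0`. -/
theorem IsFundamental.eqOn_mulVec {P : Plant ℓ r m} (h : P.IsFundamental Φ)
    {c : ℝ → Idx ℓ r → ℝ}
    (hc : ∀ i, IsPrim (fun s => c s i) (fun s => (P.statMat 0 s).mulVec (c s) i)) :
    EqOn c (fun s => (Φ s).mulVec (c 0)) (Icc 0 1) := by
  rw [isFundamental_iff] at h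
  exact linear_ode_unique (P.continuousOn_statMat 0) hc (isPrim_mulVec h.2 _) (by simp [h.1])

theorem IsFundamental.eqOn {P : Plant ℓ r m} {Φ' : ℝ → Matrix (Idx ℓ r) (Idx ℓ r) ℝ}
    (h' : P.IsFundamental Φ') (h : P.IsFundamental Φ) : EqOn Φ' Φ (Icc 0 1) := by
  intro s hs
  rw [isFundamental_iff] at h'
  refine Matrix.ext_of_mulVec_single fun j => ?_
  have := h.eqOn_mulVec (isPrim_mulVec h'.2 (Pi.single j 1)) hs
  simp only [h'.1, Matrix.one_mulVec] at this
  exact this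

/-- Equilibria in terms of the value of the profile at `0`. -/
theorem isEquilibrium_iff (hΦ : P.IsFundamental Φ) {d : Exo ℓ r m} {v : State ℓ r m} :
    P.IsEquilibrium ki Ki d v ↔ ∃ a : Idx ℓ r → ℝ,
      (∀ᵐ s ∂(volume.restrict (Ioo (0 : ℝ) 1)), (v.1 s).ofLp = (Φ s).mulVec a) ∧
      (P.matN Φ).mulVec a = P.B.mulVec (ki • Ki.mulVec v.2.ofLp) + d.wb ∧
      (P.matG Φ).mulVec a = d.yref - d.wy := by
  have hΦ' := P.isFundamental_iff.mp hΦ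
  have hN : ∀ a, (P.matN Φ).mulVec a = (phiMinus Φ).mulVec a
      - P.K.mulVec ((phiPlus Φ).mulVec a) := fun a => by
    rw [matN, Matrix.sub_mulVec, Matrix.mulVec_mulVec]
  have hG : ∀ a, (P.matG Φ).mulVec a = P.L₁.mulVec ((phiMinus Φ).mulVec a)
      + P.L₂.mulVec ((phiPlus Φ).mulVec a) := fun a => by
    rw [matG, Matrix.add_mulVec, Matrix.mulVec_mulVec, Matrix.mulVec_mulVec]
  constructor
  · rintro ⟨f, c, hc, hb, he, hz⟩
    rw [isH1_iff] at hc
    -- With zero time derivative the equation is `Λ₀ c' = -Λ₁ c` almost everywhere, so the profile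
    -- is `Φ(s) c(0)`.
    have hcs : ∀ i, IsPrim (fun s => c s i) (fun s => (P.statMat 0 s).mulVec (c s) i) := by
      intro i
      refine (hc.1 i).congr (fun _ _ => rfl) ?_
      filter_upwards [he, hc.2, L2.coe_zero (ℓ := ℓ) (r := r),
        ae_restrict_mem measurableSet_Ioo] with s h1 h2 h3 hs
      have h4 := congrFun h1 i
      rw [show ((0 : State ℓ r m).1 s).ofLp = 0 from h3, h2, zero_add, Lam0, Pi.add_apply,
        Matrix.mulVec_diagonal, Pi.zero_apply] at h4
      have hl := P.lam_ne_zero i (Ioo_subset_Icc_self hs)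
      refine mul_left_cancel₀ hl ?_
      rw [P.lam_mul_statMat_mulVec 0 (Ioo_subset_Icc_self hs)]
      linarith
    have heq := hΦ.eqOn_mulVec hcs
    unfold BoundaryCondition at hb
    unfold output at hz
    rw [incoming_congr heq, outgoing_congr heq, incoming_mulVec hΦ'.1,
      outgoing_mulVec hΦ'.1] at hb hz
    refine ⟨c 0, ?_, ?_, ?_⟩
    · filter_upwards [hc.2, ae_restrict_mem measurableSet_Ioo] with s h1 hs
      rw [h1, heq (Ioo_subset_Icc_self hs)]
    · rw [hN, hb]; abel
    · rw [hG, eq_sub_iff_add_eq]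
      exact (sub_eq_zero.mp hz.symm)
  · rintro ⟨a, hv, h1, h2⟩
    set c : ℝ → Idx ℓ r → ℝ := fun s => (Φ s).mulVec a
    have hcp : ∀ i, IsPrim (fun s => c s i) (fun s => (P.statMat 0 s).mulVec (c s) i) :=
      isPrim_mulVec hΦ'.2 a
    have hcc := continuousOn_mulVec (P.continuousOn_statMat 0) fun i => (hcp i).continuousOn
    have hvc : v.1 = toL2 c := by
      refine L2.ext_ae ?_
      filter_upwards [hv, toL2_coe fun i => (hcp i).continuousOn] with s h3 h4
      rw [h3, h4]
    have hf := toL2_coe hcc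
    refine ⟨toL2 fun s => (P.statMat 0 s).mulVec (c s), c, ?_, ?_, ?_, ?_⟩
    · rw [hvc]
      exact isH1_toL2 hcp fun i => memLp_of_continuousOn (hcc i)
    · rw [BoundaryCondition, incoming_mulVec hΦ'.1, outgoing_mulVec hΦ'.1, add_assoc, ← h1, hN]
      abel
    · filter_upwards [hv, hf, L2.coe_zero (ℓ := ℓ) (r := r),
        ae_restrict_mem measurableSet_Ioo] with s h3 h4 h5 hs
      rw [show ((0 : State ℓ r m).1 s).ofLp = 0 from h5, h3, h4]
      funext i
      rw [zero_add, Lam0, Pi.add_apply, Matrix.mulVec_diagonal,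
        P.lam_mul_statMat_mulVec 0 (Ioo_subset_Icc_self hs)]
      simp [c]
    · rw [output, incoming_mulVec hΦ'.1, outgoing_mulVec hΦ'.1, ← hG, h2]
      simp

/-! ### Invertibility of `Φ₋(1) - K Φ₊(1)` under the Lyapunov condition -/

/-- At `s = 1` the positive components are outgoing and the boundary condition supplies the negative
ones; `Kminus` plays this role at `s = 0`. -/
theorem Kplus_mulVec_outgoing {c : ℝ → Idx ℓ r → ℝ}
    (h : incoming c = P.K.mulVec (outgoing c)) : P.Kplus.mulVec (outgoing c) = c 1 := by
  funext i
  rcases i with i | i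
  · simp [Kplus, outgoing, Matrix.mulVec, dotProduct, Fintype.sum_sum_type, Matrix.one_apply]
  · have := congrFun h (Sum.inr i)
    simp only [incoming, Sum.elim_inr] at this
    rw [this]
    simp [Kplus, Matrix.mulVec, dotProduct, Fintype.sum_sum_type, Matrix.toBlocks₂₁,
      Matrix.toBlocks₂₂]

theorem Kminus_mulVec_outgoing {c : ℝ → Idx ℓ r → ℝ}
    (h : incoming c = P.K.mulVec (outgoing c)) : P.Kminus.mulVec (outgoing c) = c 0 := by
  funext i
  rcases i with i | i
  · have := congrFun h (Sum.inl i)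
    simp only [incoming, Sum.elim_inl] at this
    rw [this]
    simp [Kminus, Matrix.mulVec, dotProduct, Fintype.sum_sum_type, Matrix.toBlocks₁₁,
      Matrix.toBlocks₁₂]
  · simp [Kminus, outgoing, Matrix.mulVec, dotProduct, Fintype.sum_sum_type, Matrix.one_apply]

/-- A kernel vector is the initial value of a stationary profile with homogeneous boundary
condition, on which the Lyapunov density is strictly contradictory unless the outgoing trace
vanishes. -/
theorem isUnit_matN_of_ISSCondition (hΦ : P.IsFundamental Φ) (h : P.ISSCondition) :
    IsUnit (P.matN Φ) := by
  obtain ⟨q, μ, ql, qu, S, hq, hμ, hql, -, hS, hdec, hbd, hbc⟩ := h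
  have hΦ' := P.isFundamental_iff.mp hΦ
  rw [← Matrix.mulVec_injective_iff_isUnit]
  refine (injective_iff_map_eq_zero (P.matN Φ).mulVecLin).mpr fun a ha => ?_
  rw [Matrix.mulVecLin_apply, matN, Matrix.sub_mulVec, ← Matrix.mulVec_mulVec,
    ← incoming_mulVec hΦ'.1, ← outgoing_mulVec hΦ'.1, sub_eq_zero] at ha
  set c : ℝ → Idx ℓ r → ℝ := fun s => (Φ s).mulVec a
  have hcp : ∀ i, IsPrim (fun s => c s i) (fun s => (P.statMat 0 s).mulVec (c s) i) :=
    isPrim_mulVec hΦ'.2 a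
  set W : ℝ → ℝ := fun s => ∑ i, (q i s * P.lam i s) * (c s i * c s i)
  have hW : IsPrim W (fun s => ∑ i, (derivWithin (fun x => q i x * P.lam i x) (Icc 0 1) s
      * (c s i * c s i) + q i s * P.lam i s * ((P.statMat 0 s).mulVec (c s) i * c s i
        + c s i * (P.statMat 0 s).mulVec (c s) i))) :=
    IsPrim.sum _ fun i => (IsPrim.of_contDiffOn ((hq i).mul (P.lam_C1 i))).mul
      ((hcp i).mul (hcp i))
  -- Along the profile the derivative of `W` is the quadratic form of `(PΛ₀)_s - PΛ₁ - Λ₁ᵀP`, which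
  -- is at most `-μ c · P c`.
  have hle : W 1 - W 0 ≤ 0 := by
    rw [← hW.eq_sub]
    refine integral_nonpos_of_ae ?_
    filter_upwards [ae_restrict_mem measurableSet_Ioo] with s hs'
    have hs := Ioo_subset_Icc_self hs'
    have h1 := (hdec s hs).dotProduct_mulVec_nonneg (c s)
    have e : c s ⬝ᵥ ((P.Lam1 s).transpose * Matrix.diagonal fun i => q i s).mulVec (c s)
        = ∑ i, q i s * c s i * (P.Lam1 s).mulVec (c s) i := by
      rw [← Matrix.mulVec_mulVec, Matrix.dotProduct_mulVec, Matrix.vecMul_transpose, dotProduct]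
      exact Finset.sum_congr rfl fun i _ => by rw [Matrix.mulVec_diagonal]; ring
    have e' : c s ⬝ᵥ ((Matrix.diagonal fun i => q i s) * P.Lam1 s).mulVec (c s)
        = ∑ i, q i s * c s i * (P.Lam1 s).mulVec (c s) i := by
      rw [← Matrix.mulVec_mulVec, dotProduct]
      exact Finset.sum_congr rfl fun i _ => by rw [Matrix.mulVec_diagonal]; ring
    have e'' : ∀ w : Idx ℓ r → ℝ, c s ⬝ᵥ (Matrix.diagonal w).mulVec (c s)
        = ∑ i, w i * (c s i * c s i) := fun w => by
      rw [dotProduct]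
      exact Finset.sum_congr rfl fun i _ => by rw [Matrix.mulVec_diagonal]; ring
    rw [star_trivial] at h1
    simp only [Matrix.sub_mulVec, Matrix.neg_mulVec, Matrix.smul_mulVec, dotProduct_sub,
      dotProduct_neg, dotProduct_smul, e, e', e'', smul_eq_mul] at h1
    have h2 : 0 ≤ μ * ∑ i, q i s * (c s i * c s i) :=
      mul_nonneg hμ.le (Finset.sum_nonneg fun i _ =>
        mul_nonneg (hql.le.trans (hbd s hs i).1) (mul_self_nonneg _))
    have h3 : (∑ i, (derivWithin (fun x => q i x * P.lam i x) (Icc 0 1) s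
        * (c s i * c s i) + q i s * P.lam i s * ((P.statMat 0 s).mulVec (c s) i * c s i
        + c s i * (P.statMat 0 s).mulVec (c s) i)))
        = (∑ i, derivWithin (fun x => q i x * P.lam i x) (Icc 0 1) s * (c s i * c s i))
          - (∑ i, q i s * c s i * (P.Lam1 s).mulVec (c s) i)
          - ∑ i, q i s * c s i * (P.Lam1 s).mulVec (c s) i := by
      rw [← Finset.sum_sub_distrib, ← Finset.sum_sub_distrib]
      refine Finset.sum_congr rfl fun i _ => ?_
      have := P.lam_mul_statMat_mulVec 0 hs (c s) i
      linear_combination 2 * q i s * c s i * this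
    simp only [Pi.zero_apply]
    rw [h3]
    linarith
  have hdiag : ∀ s, c s ⬝ᵥ ((Matrix.diagonal fun i => q i s) * P.Lam0 s).mulVec (c s) = W s := by
    intro s
    rw [Lam0, Matrix.diagonal_mul_diagonal, dotProduct]
    exact Finset.sum_congr rfl fun i _ => by rw [Matrix.mulVec_diagonal]; ring
  have h1 := hbc.dotProduct_mulVec_nonneg (outgoing c)
  rw [star_trivial] at h1
  simp only [Matrix.sub_mulVec, Matrix.add_mulVec, Matrix.neg_mulVec, dotProduct_sub,
    dotProduct_add, dotProduct_neg, quadForm_conj, P.Kplus_mulVec_outgoing ha,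
    P.Kminus_mulVec_outgoing ha, hdiag] at h1
  -- The boundary inequality bounds `x · S x`, for the outgoing trace `x`, by `W 1 - W 0`.
  have hout : outgoing c = 0 := by
    by_contra hne
    have h2 := hS.dotProduct_mulVec_pos hne
    rw [star_trivial] at h2
    linarith
  have h0 := P.Kminus_mulVec_outgoing ha
  rw [hout, Matrix.mulVec_zero] at h0
  simpa [c, hΦ'.1] using h0.symm

/-! ### Equilibria -/

theorem matN_rank_eq_iff : (P.matN Φ).rank = ℓ + r ↔ IsUnit (P.matN Φ) := by
  rw [isUnit_iff_rank_eq]; simp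

theorem matT1_rank_eq_iff : (P.matT1 Φ).rank = m ↔ IsUnit (P.matT1 Φ) := by
  rw [isUnit_iff_rank_eq]; simp

/-- The equilibrium equations, solved for the input `u`. -/
theorem matN_matG_mulVec_iff (hN : IsUnit (P.matN Φ)) {a wb : Idx ℓ r → ℝ} {u y : Fin m → ℝ} :
    ((P.matN Φ).mulVec a = P.B.mulVec u + wb ∧ (P.matG Φ).mulVec a = y) ↔
      a = (P.matN Φ)⁻¹.mulVec (P.B.mulVec u + wb) ∧
        (P.matT1 Φ).mulVec u = y - (P.matG Φ * (P.matN Φ)⁻¹).mulVec wb := by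
  have hdet := (Matrix.isUnit_iff_isUnit_det _).mp hN
  have h1 : (P.matN Φ).mulVec a = P.B.mulVec u + wb
      ↔ a = (P.matN Φ)⁻¹.mulVec (P.B.mulVec u + wb) := by
    constructor
    · intro h
      rw [← h, Matrix.mulVec_mulVec, Matrix.nonsing_inv_mul _ hdet, Matrix.one_mulVec]
    · intro h
      rw [h, Matrix.mulVec_mulVec, Matrix.mul_nonsing_inv _ hdet, Matrix.one_mulVec]
  rw [h1]
  refine and_congr_right fun ha => ?_
  rw [ha, eq_sub_iff_add_eq, matT1]
  simp only [← Matrix.mulVec_mulVec, Matrix.mulVec_add]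

theorem eq_zInf_iff (hki : ki ≠ 0) (hKi : IsUnit Ki) (hT : IsUnit (P.matT1 Φ))
    {d : Exo ℓ r m} {z : Fin m → ℝ} :
    (P.matT1 Φ).mulVec (ki • Ki.mulVec z)
        = d.yref - d.wy - (P.matG Φ * (P.matN Φ)⁻¹).mulVec d.wb ↔ z = P.zInf Φ ki Ki d := by
  have hK := (Matrix.isUnit_iff_isUnit_det _).mp hKi
  have hTd := (Matrix.isUnit_iff_isUnit_det _).mp hT
  constructor
  · intro h
    rw [zInf, ← h, ← Matrix.mulVec_mulVec, Matrix.mulVec_mulVec _ _ (P.matT1 Φ),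
      Matrix.nonsing_inv_mul _ hTd, Matrix.one_mulVec, Matrix.mulVec_smul, Matrix.mulVec_mulVec,
      Matrix.nonsing_inv_mul _ hK, Matrix.one_mulVec, smul_smul, inv_mul_cancel₀ hki, one_smul]
  · rintro rfl
    rw [zInf, Matrix.mulVec_smul Ki, smul_smul, mul_inv_cancel₀ hki, one_smul,
      ← Matrix.mulVec_mulVec, Matrix.mulVec_mulVec _ Ki, Matrix.mul_nonsing_inv _ hK,
      Matrix.one_mulVec, Matrix.mulVec_mulVec, Matrix.mul_nonsing_inv _ hTd, Matrix.one_mulVec]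

theorem exists_unique_equilibrium (hΦ : P.IsFundamental Φ) (hki : ki ≠ 0) (hKi : IsUnit Ki)
    (hN : IsUnit (P.matN Φ)) (hT : IsUnit (P.matT1 Φ)) (d : Exo ℓ r m) :
    ∃ v : State ℓ r m, P.IsEquilibrium ki Ki d v ∧
      (∀ v₁, P.IsEquilibrium ki Ki d v₁ → v₁ = v) ∧ v.2.ofLp = P.zInf Φ ki Ki d ∧
      ∀ᵐ s ∂(volume.restrict (Ioo (0 : ℝ) 1)),
        (v.1 s).ofLp = (Φ s).mulVec (P.phiInf0 Φ ki Ki d) := by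
  have hΦ' := P.isFundamental_iff.mp hΦ
  have hu : P.B.mulVec (ki • Ki.mulVec (P.zInf Φ ki Ki d))
      = ki • (P.B * Ki).mulVec (P.zInf Φ ki Ki d) := by
    rw [Matrix.mulVec_smul, Matrix.mulVec_mulVec]
  have hiff : ∀ v : State ℓ r m, P.IsEquilibrium ki Ki d v ↔ v.2.ofLp = P.zInf Φ ki Ki d ∧
      ∀ᵐ s ∂(volume.restrict (Ioo (0 : ℝ) 1)),
        (v.1 s).ofLp = (Φ s).mulVec (P.phiInf0 Φ ki Ki d) := by
    intro v
    simp only [P.isEquilibrium_iff hΦ, P.matN_matG_mulVec_iff hN,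
      P.eq_zInf_iff hki hKi hT]
    constructor
    · rintro ⟨a, ha, rfl, hz⟩
      rw [hz, hu] at ha
      exact ⟨hz, ha⟩
    · rintro ⟨hz, ha⟩
      exact ⟨_, ha, by rw [hz, hu, phiInf0], hz⟩
  have hcont : ∀ i, ContinuousOn (fun s => (Φ s).mulVec (P.phiInf0 Φ ki Ki d) i) (Icc 0 1) :=
    fun i => (isPrim_mulVec hΦ'.2 _ i).continuousOn
  let v : State ℓ r m := (toL2 fun s => (Φ s).mulVec (P.phiInf0 Φ ki Ki d),
    WithLp.toLp 2 (P.zInf Φ ki Ki d))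
  have hv : v.2.ofLp = P.zInf Φ ki Ki d ∧ ∀ᵐ s ∂(volume.restrict (Ioo (0 : ℝ) 1)),
      (v.1 s).ofLp = (Φ s).mulVec (P.phiInf0 Φ ki Ki d) := ⟨rfl, toL2_coe hcont⟩
  refine ⟨v, (hiff v).mpr hv, fun v₁ h₁ => ?_, hv⟩
  obtain ⟨hz, hp⟩ := (hiff v₁).mp h₁
  refine Prod.ext (L2.ext_ae ?_) (WithLp.ofLp_injective 2 (hz.trans hv.1.symm))
  filter_upwards [hp, hv.2] with s h2 h3
  rw [h2, h3]

/-- Varying `y_ref` alone, with zero disturbances, already forces `T₁` to be onto; the preimage of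
`y` is the equilibrium input `kᵢ Kᵢ z`. -/
theorem isUnit_matT1_of_forall_exists (hΦ : P.IsFundamental Φ) (hN : IsUnit (P.matN Φ))
    (h : ∀ d : Exo ℓ r m, ∃ v, P.IsEquilibrium ki Ki d v) : IsUnit (P.matT1 Φ) := by
  rw [← Matrix.mulVec_surjective_iff_isUnit]
  intro y
  obtain ⟨v, hv⟩ := h ⟨0, 0, y⟩
  obtain ⟨a, -, ha⟩ := (P.isEquilibrium_iff hΦ).mp hv
  refine ⟨_, ((P.matN_matG_mulVec_iff hN).mp ha).2.trans ?_⟩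
  simp

theorem rankCondition_iff (hΦ : P.IsFundamental Φ) (hki : ki ≠ 0) (hKi : IsUnit Ki)
    (hN : IsUnit (P.matN Φ)) :
    P.RankCondition Φ ↔ ∀ d : Exo ℓ r m, ∃ v, P.IsEquilibrium ki Ki d v := by
  rw [RankCondition, matN_rank_eq_iff, matT1_rank_eq_iff]
  constructor
  · rintro ⟨-, hT⟩ d
    obtain ⟨v, hv, -⟩ := P.exists_unique_equilibrium hΦ hki hKi hN hT d
    exact ⟨v, hv⟩
  · exact fun h => ⟨hN, P.isUnit_matT1_of_forall_exists hΦ hN h⟩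

end Plant

end HypReg

end

theorem mainTheorem5 {ℓ r m : ℕ} (P : HypReg.Plant ℓ r m)
    (ki : ℝ) (hki : 0 < ki) (Ki : Matrix (Fin m) (Fin m) ℝ) (hKi : Ki.rank = m) :
    ∃ Φ : ℝ → Matrix (HypReg.Idx ℓ r) (HypReg.Idx ℓ r) ℝ,
      -- `Φ` is the fundamental matrix on `[0,1]`
      P.IsFundamental Φ ∧
      (∀ Φ', P.IsFundamental Φ' → Set.EqOn Φ' Φ (Set.Icc 0 1)) ∧
      -- sufficiency, with the explicit and unique equilibrium
      (P.RankCondition Φ → ∀ d : HypReg.Exo ℓ r m, ∃ v : HypReg.State ℓ r m,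
        P.IsEquilibrium ki Ki d v ∧
        (∀ v₁, P.IsEquilibrium ki Ki d v₁ → v₁ = v) ∧
        v.2.ofLp = P.zInf Φ ki Ki d ∧
        ∀ᵐ s ∂(MeasureTheory.volume.restrict (Set.Ioo (0 : ℝ) 1)),
          (v.1 s).ofLp = (Φ s).mulVec (P.phiInf0 Φ ki Ki d)) ∧
      -- necessity and sufficiency, for an open loop that is input-to-state exponentially stable
      (P.ISSCondition →
        (P.RankCondition Φ ↔ ∀ d : HypReg.Exo ℓ r m, ∃ v, P.IsEquilibrium ki Ki d v)) ∧
      -- the same as soon as the matrix inverted in `T₁` is invertible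
      ((P.matN Φ).rank = ℓ + r →
        (P.RankCondition Φ ↔ ∀ d : HypReg.Exo ℓ r m, ∃ v, P.IsEquilibrium ki Ki d v)) ∧
      -- well-posedness
      (P.RankCondition Φ → ∀ d : HypReg.Exo ℓ r m, P.WellPosed ki Ki d) := by
  obtain ⟨Φ, hΦ⟩ := P.exists_isFundamental
  have hK : IsUnit Ki := HypReg.isUnit_iff_rank_eq.mpr (by simpa using hKi)
  have heq : P.RankCondition Φ → ∀ d : HypReg.Exo ℓ r m, _ := fun h d =>
    P.exists_unique_equilibrium hΦ hki.ne' hK (P.matN_rank_eq_iff.mp h.1)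
      (P.matT1_rank_eq_iff.mp h.2) d
  refine ⟨Φ, hΦ, fun Φ' h' => h'.eqOn hΦ, heq, fun h => ?_, fun h => ?_, fun h d => ?_⟩
  · exact P.rankCondition_iff hΦ hki.ne' hK (P.isUnit_matN_of_ISSCondition hΦ h)
  · exact P.rankCondition_iff hΦ hki.ne' hK (P.matN_rank_eq_iff.mp h)
  · obtain ⟨v, hv, -⟩ := heq h d
    exact P.wellPosed_of_isEquilibrium hv
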